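/- Let $\mathfrak g$ be a finite-dimensional semisimple Lie algebra over $\mathbb C$ with a fixed Cartan subalgebra $\mathfrak h$, and let $W$ be its Weyl group acting on $\mathfrak h$, i.e. the group generated by the reflections $s_\alpha(h)=h-\alpha(h)\alpha^\vee$ for $\alpha$ a root of $\mathfrak g$ with respect to $\mathfrak h$. Two subalgebras $\mathfrak a,\mathfrak b\subset\mathfrak g$ are called linearly equivalent if for every finite-dimensional representation $\rho:\mathfrak g\to\mathfrak{gl}(V)$ the subalgebras $\rho(\mathfrak a)$ and $\rho(\mathfrak b)$ of $\mathfrak{gl}(V)$ are conjugate under $\mathrm{GL}(V)$. A canonical generating set of a semisimple Lie algebra $\mathfrak s$ consists of elements $x_1,\dots,x_r,y_1,\dots,y_r,h_1,\dots,h_r$ generating $\mathfrak s$ with $$[h_i,h_j]=0,\quad [x_i,y_j]=\delta_{ij}h_i,\quad [h_j,x_i]=C(i,j)x_i,\quad [h_j,y_i]=-C(i,j)y_i,$$ where $C=(\langle\alpha_i,\alpha_j^\vee\rangle)_{1\le i,j\le r}$ is the Cartan matrix of the root system of $\mathfrak s$ (for some ordering $\alpha_1,\dots,\alpha_r$ of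 a set of simple roots); the sequence $(h_1,\dots,h_r)$ is its $h$-part. Let $\tilde{\mathfrak g}_1,\tilde{\mathfrak g}_2$ be two semisimple subalgebras of $\mathfrak g$, both isomorphic to a Lie algebra $\tilde{\mathfrak g}$. Let $(\tilde h_1^1,\dots,\tilde h_r^1)$ and $(\tilde h_1^2,\dots,\tilde h_r^2)$ be the $h$-parts of canonical generating sets of $\tilde{\mathfrak g}_1$ and $\tilde{\mathfrak g}_2$ respectively, and assume that $\tilde h_i^k\in\mathfrak h$ for all $i,k$. Then $\tilde{\mathfrak g}_1$ and $\tilde{\mathfrak g}_2$ are linearly equivalent if and only if there is a $w\in W$ with $$\{w(\tilde h_i^1)\mid 1\le i\le r\}=\{\tilde h_i^2\mid 1\le i\le r\}.$$ -/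

import Mathlib

universe u

/-- The Weyl group of a semisimple complex Lie algebra `L` with respect to a Cartan subalgebra `H`,
acting on `H`: it is generated by the reflections `s_α h = h - α(h) • α^∨`, for `α` a root. -/
def cartanWeylGroup {L : Type*} [LieRing L] [LieAlgebra ℂ L] [FiniteDimensional ℂ L]
    [LieAlgebra.IsSemisimple ℂ L] (H : LieSubalgebra ℂ L) [H.IsCartanSubalgebra] :
    Subgroup (H ≃ₗ[ℂ] H) :=
  Subgroup.closure (Set.range (LieAlgebra.IsKilling.rootSystem H).coreflection)

/-- `C` is the Cartan matrix of the root system of the semisimple complex Lie algebra `L`, for some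
Cartan subalgebra, some base of the root system and some ordering `α₁, …, αᵣ` of that base:
`C i j = ⟨αᵢ, αⱼ^∨⟩`. -/
def IsCartanMatrixOf {r : ℕ} (C : Matrix (Fin r) (Fin r) ℤ)
    (L : Type*) [LieRing L] [LieAlgebra ℂ L] [FiniteDimensional ℂ L]
    [LieAlgebra.IsSemisimple ℂ L] : Prop :=
  ∃ (H : LieSubalgebra ℂ L) (_ : H.IsCartanSubalgebra)
    (b : (LieAlgebra.IsKilling.rootSystem H).Base) (e : Fin r ≃ b.support),
    ∀ i j, C i j = b.cartanMatrix (e i) (e j)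

/-- `x, y, h` form a canonical generating set of the semisimple complex Lie algebra `L`. -/
structure IsCanonicalGeneratingSet {L : Type*} [LieRing L] [LieAlgebra ℂ L]
    [FiniteDimensional ℂ L] [LieAlgebra.IsSemisimple ℂ L] {r : ℕ} (x y h : Fin r → L) : Prop where
  generates : LieSubalgebra.lieSpan ℂ L (Set.range x ∪ Set.range y ∪ Set.range h) = ⊤
  relations : ∃ C : Matrix (Fin r) (Fin r) ℤ, IsCartanMatrixOf C L ∧
    (∀ i j, ⁅h i, h j⁆ = 0) ∧
    (∀ i j, ⁅x i, y j⁆ = if i = j then h i else 0) ∧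
    (∀ i j, ⁅h j, x i⁆ = C i j • x i) ∧
    (∀ i j, ⁅h j, y i⁆ = -(C i j • y i))

section

attribute [local instance] LieRing.ofAssociativeRing

/-- Two subalgebras `s₁, s₂` of `L` are linearly equivalent if for every finite-dimensional
representation `ρ : L → gl(V)` the subalgebras `ρ(s₁)` and `ρ(s₂)` of `gl(V)` are conjugate under
`GL(V)`. (Every finite-dimensional space is isomorphic to one in any given universe.) -/
def LinearlyEquivalent {L : Type u} [LieRing L] [LieAlgebra ℂ L] (s₁ s₂ : LieSubalgebra ℂ L) :
    Prop :=
  ∀ (V : Type u) [AddCommGroup V] [Module ℂ V] [FiniteDimensional ℂ V]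
    (ρ : L →ₗ⁅ℂ⁆ Module.End ℂ V),
    ∃ a : V ≃ₗ[ℂ] V, (s₁.map ρ).map (a.lieConj : Module.End ℂ V →ₗ⁅ℂ⁆ Module.End ℂ V) = s₂.map ρ

end

set_option linter.unusedSectionVars false

/-! If `w` carries one h-part to the other, extend `w` to an automorphism of 𝔤 that is a conjugation
in every representation (`exists_isInner_of_mem_cartanWeylGroup`). After this conjugation and a
reindexing, both subalgebras act with the same operators `h i`. The Cartan integers can be read off
from the Killing form of 𝔤 on the `h i`, so the Cartan matrices coincide too. By Weyl's complete
reducibility theorem a representation is determined up to isomorphism by its weight multiplicities,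
hence by the operators `h i`. The two restricted representations are therefore conjugate on
generators (`LieAlgebra.Basis.exists_conj_eq`), and so the images are conjugate.

Conversely, linear equivalence conjugates images of subalgebras, not of generators. But Cartan
subalgebras are conjugate and bases are permuted by the Weyl group, so the h-part is unique up to
inner automorphism and order. Every faithful representation thus conjugates the two h-parts up to a
permutation, which may depend on the representation (`exists_conj_h_eq`).

It remains to pass from conjugacy in representations to the Weyl group. A single dominant integral
`x` is separated from the dominant integral `y` that are not longer by the representation of highest
weight κ(x, ·), taken together with the adjoint one: the eigenvalue κ(x, x) of `x` must occur for
`y`, which gives κ(x, x) ≤ κ(x, y) unless it occurs in the adjoint part, and then κ(x - y, x - y) ≤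
0 (`exists_injective_representation_eq_of_conj`). A family is encoded in one element ∑ Mʲ vⱼ, with
`M` chosen so that equality of such sums forces equality term by term. The unknown permutation is
harmless once the longest of these sums is used to choose the representation
(`exists_cartanWeylGroup_perm`). -/

section

open Module LieAlgebra LieModule
open scoped Topology

/-! ### Integrality of eigenvalues for `sl₂` triples -/

section IntegralEigenvalues

variable {L M : Type*} [LieRing L] [LieAlgebra ℂ L] [AddCommGroup M] [Module ℂ M]
  [LieRingModule L M] [LieModule ℂ L M] [FiniteDimensional ℂ M]

/-- The eigenvalues of the semisimple element of an `sl₂` triple on a finite-dimensional module are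
integers. -/
theorem IsSl2Triple.exists_int_of_lie_eq_smul {h e f : L} (t : IsSl2Triple h e f) {m : M} {μ : ℂ}
    (hm : m ≠ 0) (hμ : ⁅h, m⁆ = μ • m) : ∃ n : ℤ, μ = n := by
  -- The vectors `e ^ k m` have pairwise distinct `h`-eigenvalues `μ + 2k`, so they cannot all be
  -- nonzero in finite dimension. The last nonzero one is primitive.
  have hz : ∃ k, ((toEnd ℂ L M e) ^ k) m = 0 := by
    by_contra! hne
    have hs : (Set.range fun n : ℕ ↦ μ + 2 * (n : ℂ)).Infinite := by
      rw [Set.infinite_range_iff (fun n m ↦ by simp)]; infer_instance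
    exact hs ((toEnd ℂ L M h).eigenvectors_linearIndependent
      {μ + 2 * (n : ℂ) | n : ℕ}
      (fun ⟨s, hs⟩ ↦ ((toEnd ℂ L M e) ^ (Classical.choose hs)) m)
      (fun ⟨r, hr⟩ ↦ by
        simp [t.lie_h_pow_toEnd_e hμ, Classical.choose_spec hr, hne,
          Module.End.hasEigenvector_iff])).finite
  obtain ⟨k, hk, hk'⟩ := Nat.exists_not_and_succ_of_not_zero_of_exists
    (p := fun k ↦ ((toEnd ℂ L M e) ^ k) m = 0) (by simpa using hm) hz
  have P : t.HasPrimitiveVectorWith (((toEnd ℂ L M e) ^ k) m) (μ + 2 * k) :=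
    ⟨hk, t.lie_h_pow_toEnd_e hμ k, by rw [IsSl2Triple.lie_e_pow_toEnd_e]; exact hk'⟩
  obtain ⟨n, hn⟩ := P.exists_nat
  exact ⟨n - 2 * k, by push_cast; linear_combination hn⟩

end IntegralEigenvalues

/-! ### Trace criterion for vanishing -/

section DiagonalTrace

/-- An endomorphism of trace zero that has a spanning set of eigenvectors with non-negative rational
eigenvalues vanishes. -/
theorem LinearMap.eq_zero_of_trace_eq_zero_of_span_eq_top {V : Type*} [AddCommGroup V] [Module ℂ V]
    [FiniteDimensional ℂ V] (T : End ℂ V)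
    (hT : Submodule.span ℂ {v | ∃ q : ℚ, 0 ≤ q ∧ T v = (q : ℂ) • v} = ⊤)
    (h0 : LinearMap.trace ℂ V T = 0) : T = 0 := by
  classical
  obtain ⟨s, hs, hspan, hli⟩ :=
    exists_linearIndependent ℂ {v | ∃ q : ℚ, 0 ≤ q ∧ T v = (q : ℂ) • v}
  let b : Basis s ℂ V := Basis.mk hli (by rw [Subtype.range_coe, hspan, hT])
  have : Fintype s := FiniteDimensional.fintypeBasisIndex b
  choose q hq0 hq using fun i : s ↦ hs i.2
  have hb (i : s) : b i = i := by simp [b]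
  have hTb (i : s) : T (b i) = (q i : ℂ) • b i := by rw [hb, hq]
  have htr : ∑ i, (q i : ℂ) = 0 := by
    rw [← h0, LinearMap.trace_eq_matrix_trace ℂ b, Matrix.trace]
    exact Finset.sum_congr rfl fun i _ ↦ by simp [LinearMap.toMatrix_apply, hTb]
  have hq' : ∀ i, q i = 0 := by
    have : ∑ i, q i = 0 := by exact_mod_cast htr
    intro i
    exact (Finset.sum_eq_zero_iff_of_nonneg fun i _ ↦ hq0 i).mp this i (Finset.mem_univ i)
  exact b.ext fun i ↦ by simp [hTb, hq']

end DiagonalTrace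

/-! ### Casimir operator, Whitehead's first lemma and Weyl's theorem -/

section Casimir

variable {L : Type*} [LieRing L] [LieAlgebra ℂ L] [FiniteDimensional ℂ L] [IsKilling ℂ L]
variable {M : Type*} [AddCommGroup M] [Module ℂ M] [LieRingModule L M] [LieModule ℂ L M]

variable (L) in
/-- The basis dual to the standard basis of `L` with respect to the Killing form. -/
noncomputable def killingDualBasis :
    Basis (Fin (finrank ℂ L)) ℂ L :=
  LinearMap.BilinForm.dualBasis (killingForm ℂ L) (IsKilling.killingForm_nondegenerate ℂ L)
    (finBasis ℂ L)

theorem killingForm_killingDualBasis_left (i j : Fin (finrank ℂ L)) :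
    killingForm ℂ L (killingDualBasis L i) (finBasis ℂ L j) = if j = i then 1 else 0 :=
  LinearMap.BilinForm.apply_dualBasis_left _ _ _ _

theorem killingForm_killingDualBasis_right (i j : Fin (finrank ℂ L)) :
    killingForm ℂ L (finBasis ℂ L j) (killingDualBasis L i) = if j = i then 1 else 0 := by
  rw [traceForm_comm, killingForm_killingDualBasis_left]

theorem sum_killingForm_smul_finBasis (X : L) :
    ∑ i, killingForm ℂ L X (killingDualBasis L i) • finBasis ℂ L i = X := by
  have h (i) : killingForm ℂ L X (killingDualBasis L i) = (finBasis ℂ L).repr X i := by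
    conv_lhs => rw [← (finBasis ℂ L).sum_repr X]
    simp [killingForm_killingDualBasis_right, -Basis.sum_repr]
  simp_rw [h]
  exact (finBasis ℂ L).sum_repr X

theorem sum_killingForm_smul_killingDualBasis (X : L) :
    ∑ i, killingForm ℂ L X (finBasis ℂ L i) • killingDualBasis L i = X := by
  have h (i) : killingForm ℂ L X (finBasis ℂ L i) = (killingDualBasis L).repr X i := by
    conv_lhs => rw [← (killingDualBasis L).sum_repr X]
    simp [killingForm_killingDualBasis_left, -Basis.sum_repr]
  simp_rw [h]
  exact (killingDualBasis L).sum_repr X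

omit [LieRingModule L M] [LieModule ℂ L M] in
/-- The Casimir tensor is invariant. -/
theorem sum_lie_casimir_eq_zero (β : L →ₗ[ℂ] L →ₗ[ℂ] M) (X : L) :
    ∑ i, (β ⁅X, finBasis ℂ L i⁆ (killingDualBasis L i) +
      β (finBasis ℂ L i) ⁅X, killingDualBasis L i⁆) = 0 := by
  have h1 (i) : β ⁅X, finBasis ℂ L i⁆ (killingDualBasis L i) =
      ∑ j, killingForm ℂ L ⁅X, finBasis ℂ L i⁆ (killingDualBasis L j) •
        β (finBasis ℂ L j) (killingDualBasis L i) := by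
    conv_lhs => rw [← sum_killingForm_smul_finBasis ⁅X, finBasis ℂ L i⁆]
    simp
  have h2 (i) : β (finBasis ℂ L i) ⁅X, killingDualBasis L i⁆ =
      ∑ j, killingForm ℂ L ⁅X, killingDualBasis L i⁆ (finBasis ℂ L j) •
        β (finBasis ℂ L i) (killingDualBasis L j) := by
    conv_lhs => rw [← sum_killingForm_smul_killingDualBasis ⁅X, killingDualBasis L i⁆]
    simp
  rw [Finset.sum_add_distrib]
  simp_rw [h1, h2]
  rw [Finset.sum_comm, ← Finset.sum_add_distrib]
  refine Finset.sum_eq_zero fun i _ ↦ ?_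
  rw [← Finset.sum_add_distrib]
  refine Finset.sum_eq_zero fun j _ ↦ ?_
  rw [← add_smul]
  have : killingForm ℂ L ⁅X, finBasis ℂ L j⁆ (killingDualBasis L i) +
      killingForm ℂ L ⁅X, killingDualBasis L i⁆ (finBasis ℂ L j) = 0 := by
    rw [← lie_skew, map_neg, LinearMap.neg_apply, traceForm_apply_lie_apply, traceForm_comm]
    simp
  rw [this, zero_smul]

variable (L M) in
/-- The action of the Casimir element of `L` on a module. -/
noncomputable def casimir : End ℂ M :=
  ∑ i, toEnd ℂ L M (finBasis ℂ L i) ∘ₗ toEnd ℂ L M (killingDualBasis L i)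

theorem casimir_apply (m : M) :
    casimir L M m = ∑ i, ⁅finBasis ℂ L i, ⁅killingDualBasis L i, m⁆⁆ := by
  simp [casimir]

theorem casimir_lie (X : L) (m : M) : casimir L M ⁅X, m⁆ = ⁅X, casimir L M m⁆ := by
  let β : L →ₗ[ℂ] L →ₗ[ℂ] M := LinearMap.mk₂ ℂ (fun a b ↦ ⁅a, ⁅b, m⁆⁆)
    (by simp) (by simp) (by simp) (by simp)
  have h := sum_lie_casimir_eq_zero β X
  simp only [β, LinearMap.mk₂_apply] at h
  rw [casimir_apply, casimir_apply, lie_sum, ← sub_eq_zero, ← Finset.sum_sub_distrib,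
    ← neg_eq_zero, ← h, ← Finset.sum_neg_distrib]
  refine Finset.sum_congr rfl fun i _ ↦ ?_
  rw [lie_lie X (finBasis ℂ L i), lie_lie X (killingDualBasis L i), lie_sub]
  abel

variable [FiniteDimensional ℂ M]

variable (L M) in
/-- The endomorphism of `L` relating the trace form of a module to the Killing form. -/
noncomputable def traceFormEnd : End ℂ L :=
  ∑ i, (LinearMap.flip (traceForm ℂ L M) (killingDualBasis L i)).smulRight (finBasis ℂ L i)

theorem killingForm_traceFormEnd (X Y : L) :
    killingForm ℂ L (traceFormEnd L M X) Y = traceForm ℂ L M X Y := by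
  conv_rhs => rw [← sum_killingForm_smul_killingDualBasis Y]
  simp only [traceFormEnd, LinearMap.sum_apply, LinearMap.smulRight_apply, map_sum,
    LinearMap.map_smul, LinearMap.smul_apply, LinearMap.flip_apply, smul_eq_mul]
  refine Finset.sum_congr rfl fun i _ ↦ ?_
  rw [traceForm_comm ℂ L L Y, mul_comm]

theorem eq_of_forall_killingForm_eq {X X' : L}
    (h : ∀ Y, killingForm ℂ L X Y = killingForm ℂ L X' Y) : X = X' := by
  have h1 : X - X' ∈ LinearMap.ker (killingForm ℂ L) := by
    rw [LinearMap.mem_ker]; ext Y; simp [h Y]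
  rw [IsKilling.ker_killingForm_eq_bot, Submodule.mem_bot, sub_eq_zero] at h1
  exact h1

theorem traceFormEnd_lie (X Y : L) : traceFormEnd L M ⁅X, Y⁆ = ⁅X, traceFormEnd L M Y⁆ := by
  refine eq_of_forall_killingForm_eq fun Z ↦ ?_
  rw [killingForm_traceFormEnd, ← lie_skew X Y, ← lie_skew X (traceFormEnd L M Y)]
  simp only [map_neg, LinearMap.neg_apply, traceForm_apply_lie_apply]
  rw [← killingForm_traceFormEnd]

/-- Both traces equal the sum of the trace form over the pairs formed by a basis vector and its
dual. This turns the non-vanishing of the Casimir scalar into a positivity question on `L`. -/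
theorem trace_casimir :
    LinearMap.trace ℂ M (casimir L M) = LinearMap.trace ℂ L (traceFormEnd L M) := by
  rw [LinearMap.trace_eq_matrix_trace ℂ (finBasis ℂ L), Matrix.trace, casimir, map_sum]
  refine Finset.sum_congr rfl fun i _ ↦ ?_
  rw [← traceForm_apply_apply, Matrix.diag_apply, LinearMap.toMatrix_apply, traceFormEnd]
  simp [Finsupp.single_apply, traceForm_comm ℂ L M (finBasis ℂ L i)]

/-- The trace form of a module is non-negative on the semisimple element of an `sl₂` triple
contained in a Cartan subalgebra. -/
theorem traceForm_sl2_nonneg (H : LieSubalgebra ℂ L) [H.IsCartanSubalgebra] {h e f : L}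
    (t : IsSl2Triple h e f) (hH : h ∈ H) :
    ∃ n : ℕ, traceForm ℂ L M h h = n ∧
      (n = 0 → ∀ χ : Weight ℂ H M, χ ⟨h, hH⟩ = 0) := by
  have hint (χ : Weight ℂ H M) : ∃ k : ℤ, χ ⟨h, hH⟩ = k := by
    obtain ⟨v, hv⟩ := (χ.hasEigenvalueAt ⟨h, hH⟩).exists_hasEigenvector
    exact t.exists_int_of_lie_eq_smul hv.2 hv.apply_eq_smul
  choose k hk using hint
  have h1 : traceForm ℂ L M h h = traceForm ℂ H M ⟨h, hH⟩ ⟨h, hH⟩ := rfl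
  refine ⟨∑ χ : Weight ℂ H M, finrank ℂ (genWeightSpace M χ) * ((k χ).natAbs) ^ 2, ?_, ?_⟩
  · rw [h1, traceForm_eq_sum_finrank_nsmul_mul]
    push_cast
    refine Finset.sum_congr rfl fun χ _ ↦ ?_
    rw [hk, nsmul_eq_mul]
    congr 1
    rw [← sq]
    have : (((k χ).natAbs : ℤ) : ℂ) ^ 2 = ((k χ : ℤ) : ℂ) ^ 2 := by
      rw [← Int.cast_pow, ← Int.cast_pow, Int.natAbs_sq]
    simpa using this.symm
  · intro h0 χ
    have h2 := (Finset.sum_eq_zero_iff.mp h0) χ (Finset.mem_univ χ)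
    have h3 : finrank ℂ (genWeightSpace M χ) ≠ 0 := (zero_lt_finrank_genWeightSpace
      χ.genWeightSpace_ne_bot).ne'
    have h4 : k χ = 0 := by simpa [h3] using h2
    rw [hk, h4, Int.cast_zero]

/-- The form `B(e, f)` is half of `B(h, h)` for an invariant form and an `sl₂` triple. -/
theorem traceForm_sl2 {h e f : L} (t : IsSl2Triple h e f) :
    traceForm ℂ L M h h = 2 * traceForm ℂ L M e f := by
  conv_lhs => rw [← t.lie_e_f]
  rw [traceForm_apply_lie_apply, t.lie_e_f, ← lie_skew, t.lie_lie_smul_f ℂ]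
  simp

/-- `traceFormEnd` commutes with the adjoint action, so it preserves the one-dimensional root
spaces. The scalar is the ratio of the trace form to the Killing form on the coroot, both of which
are sums of squares of integers. -/
theorem traceFormEnd_coroot_eq_smul (H : LieSubalgebra ℂ L) [H.IsCartanSubalgebra]
    (α : Weight ℂ H L) (hα : α.IsNonZero) :
    ∃ q : ℚ, 0 ≤ q ∧ (∀ e ∈ rootSpace H α, traceFormEnd L M e = (q : ℂ) • e) ∧
      traceFormEnd L M (IsKilling.coroot α : L) = (q : ℂ) • (IsKilling.coroot α : L) := by
  obtain ⟨h, e, f, t, he, hf⟩ := IsKilling.exists_isSl2Triple_of_weight_isNonZero hα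
  have hh := t.h_eq_coroot hα he hf
  have hH : h ∈ H := hh ▸ SetLike.coe_mem _
  have he0 : e ≠ 0 := t.e_ne_zero
  have hTe : traceFormEnd L M e ∈ rootSpace H α := by
    refine weightSpace_le_genWeightSpace L α ?_
    rw [mem_weightSpace]
    intro x
    have := IsKilling.lie_eq_smul_of_mem_rootSpace he x
    rw [LieSubalgebra.coe_bracket_of_module] at this ⊢
    rw [← traceFormEnd_lie, this, map_smul]
  obtain ⟨c, hc⟩ := exists_smul_eq_of_finrank_eq_one
    (IsKilling.finrank_rootSpace_eq_one α hα) (x := ⟨e, he⟩) (by simpa using! he0) ⟨_, hTe⟩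
  replace hc : c • e = traceFormEnd L M e := congrArg Subtype.val hc
  obtain ⟨m, hm, -⟩ := traceForm_sl2_nonneg (M := M) H t hH
  obtain ⟨k, hk, hk0⟩ := traceForm_sl2_nonneg (M := L) H t hH
  have hk1 : k ≠ 0 := by
    intro h0
    have := hk0 h0 α
    have h2 : α ⟨h, hH⟩ = 2 := by
      rw [← IsKilling.root_apply_coroot hα]; congr 1; exact Subtype.ext hh
    rw [h2] at this
    norm_num at this
  have hcq : c = ((m / k : ℚ) : ℂ) := by
    have h1 := killingForm_traceFormEnd (M := M) e f
    rw [← hc, map_smul, LinearMap.smul_apply, smul_eq_mul] at h1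
    have h2 := traceForm_sl2 (M := M) t
    have h3 := traceForm_sl2 (M := L) t
    rw [hm] at h2
    rw [hk] at h3
    have hk2 : (k : ℂ) ≠ 0 := by exact_mod_cast hk1
    push_cast
    rw [eq_div_iff hk2, h3, h2, ← h1]
    ring
  refine ⟨m / k, by positivity, fun e' he' ↦ ?_, ?_⟩
  · obtain ⟨d, hd⟩ := exists_smul_eq_of_finrank_eq_one
      (IsKilling.finrank_rootSpace_eq_one α hα) (x := ⟨e, he⟩) (by simpa using! he0) ⟨_, he'⟩
    replace hd : d • e = e' := congrArg Subtype.val hd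
    rw [← hd, map_smul, ← hc, hcq, smul_comm]
  · rw [← hh, ← t.lie_e_f, ← lie_skew, map_neg, traceFormEnd_lie, ← hc, hcq, lie_smul,
      ← smul_neg, lie_skew]

/-- By invariance of the Killing form, an element orthogonal to all brackets is central, hence zero.
-/
theorem derivedSeries_one_eq_top : derivedSeries ℂ L 1 = ⊤ := by
  have h := LieIdeal.isCompl_killingCompl (derivedSeries ℂ L 1)
  suffices (derivedSeries ℂ L 1).killingCompl ℂ L = ⊥ by
    rw [this] at h
    exact h.sup_eq_top ▸ (sup_bot_eq _).symm
  rw [LieSubmodule.eq_bot_iff]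
  intro z hz
  have hc : z ∈ LieAlgebra.center ℂ L := by
    rw [LieModule.mem_maxTrivSubmodule]
    intro y
    refine eq_of_forall_killingForm_eq fun x ↦ ?_
    rw [traceForm_comm, ← traceForm_apply_lie_apply, traceForm_comm]
    rw [LieIdeal.mem_killingCompl] at hz
    rw [traceForm_comm, hz, map_zero, LinearMap.zero_apply]
    exact LieSubmodule.lie_mem_lie (LieSubmodule.mem_top x) (LieSubmodule.mem_top y)
  simpa [LieAlgebra.center_eq_bot ℂ L] using hc

/-- Root vectors and coroots span `L` and are eigenvectors of `traceFormEnd` with non-negative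
rational eigenvalues. Trace zero therefore kills it, and with it the trace form; a Cartan-type
criterion then gives nilpotency. -/
theorem isNilpotent_of_trace_casimir_eq_zero
    (h0 : LinearMap.trace ℂ M (casimir L M) = 0) : LieModule.IsNilpotent L M := by
  obtain ⟨H, hH⟩ : ∃ H : LieSubalgebra ℂ L, H.IsCartanSubalgebra :=
    let ⟨x, hx⟩ := LieAlgebra.exists_isCartanSubalgebra_engel ℂ L
    ⟨_, hx⟩
  have hT : traceFormEnd L M = 0 := by
    refine LinearMap.eq_zero_of_trace_eq_zero_of_span_eq_top _ ?_
      ((trace_casimir (L := L) (M := M)).symm.trans h0)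
    rw [eq_top_iff]
    have htop : (⨆ χ : Weight ℂ H L, (genWeightSpace L χ).toSubmodule) = ⊤ :=
      LieSubmodule.iSup_toSubmodule_eq_top.mpr (iSup_genWeightSpace_eq_top' ℂ H L)
    rw [← htop, iSup_le_iff]
    intro χ x hx
    by_cases hχ : χ.IsZero
    · replace hx : x ∈ rootSpace H 0 := by
        have : (χ : H → ℂ) = 0 := hχ
        rwa [this] at hx
      rw [rootSpace_zero_eq ℂ L H] at hx
      have hx' : (⟨x, hx⟩ : H) ∈ (⊤ : Submodule ℂ H) := trivial
      rw [← RootPairing.IsRootSystem.span_coroot_eq_top (P := IsKilling.rootSystem H)] at hx'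
      have := Submodule.mem_map_of_mem (f := H.toSubmodule.subtype) hx'
      rw [Submodule.map_span] at this
      refine Submodule.span_mono ?_ this
      rintro - ⟨-, ⟨β, rfl⟩, rfl⟩
      obtain ⟨q, hq, -, h⟩ := traceFormEnd_coroot_eq_smul (M := M) H β.1
        (LieSubalgebra.isNonZero_coe_root β)
      exact ⟨q, hq, h⟩
    · obtain ⟨q, hq, h, -⟩ := traceFormEnd_coroot_eq_smul (M := M) H χ hχ
      exact Submodule.subset_span ⟨q, hq, h x hx⟩
  have hB : traceForm ℂ L M = 0 := by
    ext x y
    rw [← killingForm_traceFormEnd, hT]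
    simp
  have := isNilpotent_derivedSeries_of_traceForm_eq_zero (R := ℂ) (L := L) (M := M) hB
  rw [LieModule.isNilpotent_iff_forall' (R := ℂ)] at this ⊢
  intro x
  have hx : x ∈ derivedSeries ℂ L 1 := by
    rw [derivedSeries_one_eq_top]; trivial
  exact this ⟨x, hx⟩

variable (L M) in
/-- On a non-trivial irreducible module the Casimir element acts by a non-zero scalar. -/
theorem exists_casimir_eq_smul [IsIrreducible ℂ L M] (hM : ¬ IsTrivial L M) :
    ∃ c : ℂ, c ≠ 0 ∧ ∀ m, casimir L M m = c • m := by
  have : Nontrivial M := (LieSubmodule.nontrivial_iff ℂ L M).mp inferInstance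
  obtain ⟨c, hc⟩ := Module.End.exists_eigenvalue (casimir L M)
  let E : LieSubmodule ℂ L M :=
    { (casimir L M).eigenspace c with
      lie_mem := by
        intro X m hm
        simp only [AddSubsemigroup.mem_carrier, AddSubmonoid.mem_toSubsemigroup,
          Submodule.mem_toAddSubmonoid, End.mem_eigenspace_iff] at hm ⊢
        rw [casimir_lie, hm, lie_smul] }
  have hE : E = ⊤ := by
    refine (IsSimpleOrder.eq_bot_or_eq_top E).resolve_left fun h ↦ hc ?_
    rw [← LieSubmodule.toSubmodule_eq_bot] at h
    exact h
  have hE' (m : M) : casimir L M m = c • m := by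
    have : m ∈ E := hE ▸ LieSubmodule.mem_top m
    exact End.mem_eigenspace_iff.mp this
  refine ⟨c, ?_, hE'⟩
  rintro rfl
  have h0 : casimir L M = 0 := by ext m; simp [hE']
  have : LieModule.IsNilpotent L M := isNilpotent_of_trace_casimir_eq_zero (by rw [h0, map_zero])
  have := LieModule.nontrivial_max_triv_of_isNilpotent ℂ L M
  have := LieSubmodule.eq_top_of_isIrreducible ℂ L M (maxTrivSubmodule ℂ L M)
  exact hM (LieModule.isTrivial_iff_max_triv_eq_top ℂ L M |>.mpr this)

/-- Whitehead's first lemma: cocycles with values in a finite-dimensional module are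
coboundaries. -/
theorem exists_eq_lie_of_cocycle (n : ℕ) : ∀ (M : Type*) [AddCommGroup M] [Module ℂ M]
    [LieRingModule L M] [LieModule ℂ L M] [FiniteDimensional ℂ M], finrank ℂ M = n →
    ∀ f : L →ₗ[ℂ] M, (∀ x y, f ⁅x, y⁆ = ⁅x, f y⁆ - ⁅y, f x⁆) → ∃ m, ∀ x, f x = ⁅x, m⁆ := by
  induction n using Nat.strong_induction_on with
  | _ n ih =>
  intro M _ _ _ _ _ hn f hf
  by_cases htriv : IsTrivial L M
  · refine ⟨0, fun x ↦ ?_⟩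
    have hx : x ∈ (derivedSeries ℂ L 1).toSubmodule := by rw [derivedSeries_one_eq_top]; trivial
    rw [lie_zero, ← LinearMap.mem_ker]
    revert x
    change (derivedSeries ℂ L 1).toSubmodule ≤ LinearMap.ker f
    rw [derivedSeries_def, derivedSeriesOfIdeal_succ, derivedSeriesOfIdeal_zero,
      LieSubmodule.lieIdeal_oper_eq_linear_span', Submodule.span_le]
    rintro _ ⟨x, -, y, -, rfl⟩
    simp [hf, htriv.trivial]
  by_cases hirr : IsIrreducible ℂ L M
  · obtain ⟨c, hc, hcas⟩ := exists_casimir_eq_smul L M htriv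
    -- If `f` were the coboundary of `m`, this sum would be the Casimir operator applied to `m`,
    -- that is `c • m`.
    refine ⟨c⁻¹ • ∑ i, ⁅finBasis ℂ L i, f (killingDualBasis L i)⁆, fun X ↦ ?_⟩
    rw [lie_smul, eq_inv_smul_iff₀ hc, ← hcas, casimir_apply, lie_sum, ← sub_eq_zero,
      ← Finset.sum_sub_distrib, ← neg_eq_zero]
    let β : L →ₗ[ℂ] L →ₗ[ℂ] M := LinearMap.mk₂ ℂ (fun a b ↦ ⁅a, f b⁆)
      (by simp) (by simp) (by simp) (by simp)
    have h := sum_lie_casimir_eq_zero β X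
    simp only [β, LinearMap.mk₂_apply] at h
    rw [← h, ← Finset.sum_neg_distrib]
    refine Finset.sum_congr rfl fun i _ ↦ ?_
    rw [hf, lie_sub, leibniz_lie X]
    abel
  · have : Nontrivial M := by
      by_contra hsub
      rw [not_nontrivial_iff_subsingleton] at hsub
      exact htriv ⟨fun _ _ ↦ Subsingleton.elim _ _⟩
    obtain ⟨N, hN0, hN1⟩ : ∃ N : LieSubmodule ℂ L M, N ≠ ⊥ ∧ N ≠ ⊤ := by
      by_contra! h
      exact hirr (IsIrreducible.mk h)
    have hpos : 0 < finrank ℂ N := by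
      have : Nontrivial N := (LieSubmodule.nontrivial_iff_ne_bot ℂ L M).mpr hN0
      exact finrank_pos
    have hlt : finrank ℂ N < finrank ℂ M := by
      refine Submodule.finrank_lt (s := N.toSubmodule) ?_
      simpa using hN1
    have hadd : finrank ℂ (M ⧸ N) + finrank ℂ N = finrank ℂ M :=
      Submodule.finrank_quotient_add_finrank N.toSubmodule
    -- Solve modulo `N` and lift the solution; the error is a cocycle with values in `N`, to which
    -- induction applies again.
    obtain ⟨mq, hmq⟩ := ih (finrank ℂ (M ⧸ N)) (by omega) (M ⧸ N) rfl
      ((LieSubmodule.Quotient.mk' N : M →ₗ[ℂ] M ⧸ N) ∘ₗ f) (by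
        intro x y
        simp only [LinearMap.comp_apply, hf, map_sub]
        rfl)
    obtain ⟨m, rfl⟩ := LieSubmodule.Quotient.surjective_mk' N mq
    have hmem (x : L) : f x - ⁅x, m⁆ ∈ N := by
      have h1 := hmq x
      rw [← LieSubmodule.Quotient.mk_eq_zero, map_sub, sub_eq_zero, LieModuleHom.map_lie]
      exact h1
    let g : L →ₗ[ℂ] N := LinearMap.codRestrict N.toSubmodule
      (f - (toEnd ℂ L M : L →ₗ[ℂ] End ℂ M).flip m) hmem
    have hg (x : L) : (g x : M) = f x - ⁅x, m⁆ := rfl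
    obtain ⟨k, hk⟩ := ih (finrank ℂ N) (by omega) N rfl g (by
      intro x y
      ext
      simp only [hg, hf, LieSubmodule.coe_sub, LieSubmodule.coe_bracket, lie_sub, lie_lie]
      abel)
    refine ⟨m + k, fun x ↦ ?_⟩
    have := congrArg Subtype.val (hk x)
    rw [hg, LieSubmodule.coe_bracket] at this
    rw [lie_add, ← this]
    abel

/-- **Weyl's theorem** on complete reducibility. -/
theorem LieSubmodule.exists_isCompl_of_isKilling (N : LieSubmodule ℂ L M) :
    ∃ N' : LieSubmodule ℂ L M, IsCompl N.toSubmodule N'.toSubmodule := by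
  obtain ⟨π, hπ⟩ := LinearMap.exists_leftInverse_of_injective N.toSubmodule.subtype
    (by simp)
  let π₀ : End ℂ M := N.toSubmodule.subtype ∘ₗ π
  have hπN (m : M) : π₀ m ∈ N := (π m).2
  have hπid (m : M) (hm : m ∈ N) : π₀ m = m :=
    congrArg Subtype.val (LinearMap.congr_fun hπ ⟨m, hm⟩)
  -- `Q` is Hom(M/N, N). The bracket of any `x` with a projection onto `N` lies in it and is a
  -- cocycle there. Subtracting from the projection the `q` whose coboundary it is leaves an
  -- equivariant projection, whose kernel is the complement.
  let Q : LieSubmodule ℂ L (M →ₗ[ℂ] M) :=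
    { carrier := {φ | (∀ m, φ m ∈ N) ∧ ∀ m ∈ N, φ m = 0}
      add_mem' := fun {a b} ha hb ↦ ⟨fun m ↦ add_mem (ha.1 m) (hb.1 m),
        fun m hm ↦ by simp [ha.2 m hm, hb.2 m hm]⟩
      zero_mem' := ⟨fun m ↦ zero_mem _, fun m _ ↦ rfl⟩
      smul_mem' := fun c a ha ↦ ⟨fun m ↦ N.smul_mem c (ha.1 m),
        fun m hm ↦ by simp [ha.2 m hm]⟩
      lie_mem := fun {x a} ha ↦ ⟨fun m ↦ by
          rw [LieHom.lie_apply]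
          exact sub_mem (N.lie_mem (ha.1 m)) (ha.1 _), fun m hm ↦ by
          rw [LieHom.lie_apply, ha.2 m hm, ha.2 _ (N.lie_mem hm), lie_zero, sub_zero]⟩ }
  let f : L →ₗ[ℂ] Q := LinearMap.codRestrict Q.toSubmodule
    ((toEnd ℂ L (M →ₗ[ℂ] M) : L →ₗ[ℂ] End ℂ (M →ₗ[ℂ] M)).flip π₀) (fun x ↦ by
      constructor
      · intro m
        change ⁅x, π₀⁆ m ∈ N
        rw [LieHom.lie_apply]
        exact sub_mem (N.lie_mem (hπN m)) (hπN _)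
      · intro m hm
        change ⁅x, π₀⁆ m = 0
        rw [LieHom.lie_apply, hπid m hm, hπid _ (N.lie_mem hm), sub_self])
  have hf (x : L) : (f x : M →ₗ[ℂ] M) = ⁅x, π₀⁆ := rfl
  obtain ⟨q, hq⟩ := exists_eq_lie_of_cocycle _ Q rfl f (by
    intro x y
    ext1
    simp only [hf, LieSubmodule.coe_sub, LieSubmodule.coe_bracket, lie_lie])
  have hq' (x : L) : ⁅x, π₀ - (q : M →ₗ[ℂ] M)⁆ = 0 := by
    rw [lie_sub, ← hf, hq, LieSubmodule.coe_bracket, sub_self]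
  let p : End ℂ M := π₀ - (q : M →ₗ[ℂ] M)
  have hp (x : L) (m : M) : p ⁅x, m⁆ = ⁅x, p m⁆ := by
    have := LinearMap.congr_fun (hq' x) m
    rw [LieHom.lie_apply, LinearMap.zero_apply, sub_eq_zero] at this
    exact this.symm
  have hpN (m : M) : p m ∈ N := sub_mem (hπN m) (q.2.1 m)
  have hpid (m : M) (hm : m ∈ N) : p m = m := by
    simp only [p, LinearMap.sub_apply, hπid m hm]
    rw [q.2.2 m hm, sub_zero]
  refine ⟨{ LinearMap.ker p with
    lie_mem := fun {x m} hm ↦ by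
      have hm' : p m = 0 := hm
      change p ⁅x, m⁆ = 0
      rw [hp, hm', lie_zero] }, ?_⟩
  change IsCompl N.toSubmodule (LinearMap.ker p)
  constructor
  · rw [disjoint_iff_inf_le]
    rintro m ⟨h1, h2⟩
    rw [Submodule.mem_bot, ← hpid m h1]
    exact h2
  · rw [codisjoint_iff_le_sup]
    intro m _
    rw [← add_sub_cancel (p m) m]
    refine Submodule.add_mem_sup (hpN m) ?_
    rw [LinearMap.mem_ker, map_sub, hpid _ (hpN m), sub_self]

end Casimir

/-! ### Semisimple modules are determined by their weight multiplicities -/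

section TriangularFamily

variable {ι : Type*} [Fintype ι] [DecidableEq ι]

/-- Families of operators satisfying the Chevalley relations for a matrix `C`. -/
structure IsChevalleyFamily (C : ι → ι → ℂ) {M : Type*} [AddCommGroup M] [Module ℂ M]
    (x y h : ι → End ℂ M) : Prop where
  h_h : ∀ i j m, h i (h j m) = h j (h i m)
  x_y : ∀ i j m, x i (y j m) = y j (x i m) + if i = j then h i m else 0
  h_x : ∀ i j m, h j (x i m) = x i (h j m) + C i j • x i m
  h_y : ∀ i j m, h j (y i m) = y i (h j m) - C i j • y i m

/-- The simultaneous eigenspace of a family of operators. -/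
def jointEigenspace {M : Type*} [AddCommGroup M] [Module ℂ M] (h : ι → End ℂ M) (χ : ι → ℂ) :
    Submodule ℂ M := ⨅ i, (h i).eigenspace (χ i)

omit [Fintype ι] [DecidableEq ι] in
theorem mem_jointEigenspace {M : Type*} [AddCommGroup M] [Module ℂ M] {h : ι → End ℂ M}
    {χ : ι → ℂ} {m : M} : m ∈ jointEigenspace h χ ↔ ∀ i, h i m = χ i • m := by
  simp [jointEigenspace]

/-- Stability of a subspace under two families of operators. -/
def IsStable {M : Type*} [AddCommGroup M] [Module ℂ M] (x y : ι → End ℂ M)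
    (N : Submodule ℂ M) : Prop :=
  ∀ i, ∀ m ∈ N, x i m ∈ N ∧ y i m ∈ N

/-- Every subspace stable under two families of operators has a stable complement. -/
def HasStableComplements {M : Type*} [AddCommGroup M] [Module ℂ M] (x y : ι → End ℂ M) : Prop :=
  ∀ N, IsStable x y N → ∃ N', IsStable x y N' ∧ IsCompl N N'

variable {C : ι → ι → ℂ} {M : Type*} [AddCommGroup M] [Module ℂ M] {x y h : ι → End ℂ M}

omit [Fintype ι] [DecidableEq ι] in
theorem exists_joint_eigenvector [FiniteDimensional ℂ M]
    (hh : ∀ i j m, h i (h j m) = h j (h i m)) (s : Finset ι) :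
    ∀ U : Submodule ℂ M, U ≠ ⊥ → (∀ i, ∀ m ∈ U, h i m ∈ U) →
      ∃ v ∈ U, v ≠ 0 ∧ ∀ i ∈ s, ∃ c : ℂ, h i v = c • v := by
  classical
  induction s using Finset.induction_on with
  | empty =>
    intro U hU _
    obtain ⟨v, hv, hv0⟩ := U.ne_bot_iff.mp hU
    exact ⟨v, hv, hv0, by simp⟩
  | insert a s _ ih =>
    intro U hU hinv
    have : Nontrivial U := (Submodule.nontrivial_iff_ne_bot).mpr hU
    obtain ⟨c, hc⟩ := Module.End.exists_eigenvalue ((h a).restrict (hinv a))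
    obtain ⟨⟨w, hw⟩, hw1⟩ := hc.exists_hasEigenvector
    have hw2 : h a w = c • w := congrArg Subtype.val hw1.apply_eq_smul
    have hw0 : w ≠ 0 := fun h ↦ hw1.2 (Subtype.ext h)
    obtain ⟨v, hv, hv0, hvs⟩ := ih (U ⊓ (h a).eigenspace c)
      ((Submodule.ne_bot_iff _).mpr ⟨w, ⟨hw, End.mem_eigenspace_iff.mpr hw2⟩, hw0⟩)
      (fun i m hm ↦ ⟨hinv i m hm.1, by
        have := End.mem_eigenspace_iff.mp hm.2
        exact End.mem_eigenspace_iff.mpr (by rw [hh, this, map_smul])⟩)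
    refine ⟨v, hv.1, hv0, fun i hi ↦ ?_⟩
    rcases Finset.mem_insert.mp hi with rfl | hi
    · exact ⟨c, End.mem_eigenspace_iff.mp hv.2⟩
    · exact hvs i hi

namespace IsChevalleyFamily

theorem h_mem (H : IsChevalleyFamily C x y h) {N : Submodule ℂ M} (hN : IsStable x y N) (i : ι)
    {m : M} (hm : m ∈ N) : h i m ∈ N := by
  have := H.x_y i i m
  rw [if_pos rfl, ← sub_eq_iff_eq_add'] at this
  rw [← this]
  exact sub_mem (hN i _ (hN i m hm).2).1 (hN i _ (hN i m hm).1).2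

/-- The span of the vectors obtained by applying words in the lowering operators to a vector. -/
def loweringSpan (y : ι → End ℂ M) (v : M) : Submodule ℂ M :=
  Submodule.span ℂ (Set.range fun l : List ι ↦ (l.map y).prod v)

theorem self_mem_loweringSpan (v : M) : v ∈ loweringSpan y v :=
  Submodule.subset_span ⟨[], by simp⟩

theorem y_mem_loweringSpan {v m : M} (i : ι) (hm : m ∈ loweringSpan y v) :
    y i m ∈ loweringSpan y v := by
  have : loweringSpan y v ≤ (loweringSpan y v).comap (y i) := by
    rw [loweringSpan, Submodule.span_le]
    rintro _ ⟨l, rfl⟩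
    exact Submodule.subset_span ⟨i :: l, by simp⟩
  exact this hm

theorem loweringSpan_le {v : M} {N : Submodule ℂ M} (hv : v ∈ N) (hN : ∀ i, ∀ m ∈ N, y i m ∈ N) :
    loweringSpan y v ≤ N := by
  rw [loweringSpan, Submodule.span_le]
  rintro _ ⟨l, rfl⟩
  induction l with
  | nil => simpa using hv
  | cons i l ih => simpa using hN i _ ih

/-- The Chevalley relations move each `x` and `h` to the right through a word in the `y`'s until it
reaches `v`. No Serre relations are needed. -/
theorem isStable_loweringSpan (H : IsChevalleyFamily C x y h) {v : M} {χ : ι → ℂ}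
    (hx : ∀ i, x i v = 0) (hv : ∀ i, h i v = χ i • v) : IsStable x y (loweringSpan y v) := by
  have hh (j : ι) : loweringSpan y v ≤ (loweringSpan y v).comap (h j) := by
    rw [loweringSpan, Submodule.span_le]
    rintro _ ⟨l, rfl⟩
    change h j _ ∈ loweringSpan y v
    induction l with
    | nil => simpa [hv] using Submodule.smul_mem _ _ (self_mem_loweringSpan v)
    | cons i l ih =>
      simp only [List.map_cons, List.prod_cons, Module.End.mul_apply]
      rw [H.h_y]
      exact sub_mem (y_mem_loweringSpan i ih)
        (Submodule.smul_mem _ _ (Submodule.subset_span ⟨i :: l, by simp⟩))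
  have hx' (j : ι) : loweringSpan y v ≤ (loweringSpan y v).comap (x j) := by
    rw [loweringSpan, Submodule.span_le]
    rintro _ ⟨l, rfl⟩
    change x j _ ∈ loweringSpan y v
    induction l with
    | nil => simp [hx]
    | cons i l ih =>
      simp only [List.map_cons, List.prod_cons, Module.End.mul_apply]
      rw [H.x_y]
      refine add_mem (y_mem_loweringSpan i ih) ?_
      split_ifs
      · exact hh j (Submodule.subset_span ⟨l, rfl⟩)
      · exact zero_mem _
  exact fun i m hm ↦ ⟨hx' i hm, y_mem_loweringSpan i hm⟩

variable {a : ι → ℂ}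

theorem sum_smul_y (H : IsChevalleyFamily C x y h) (ha : ∀ i, ∑ j, C i j * a j = 1) (i : ι)
    (m : M) : (∑ j, a j • h j) (y i m) = y i ((∑ j, a j • h j) m) - y i m := by
  simp only [LinearMap.sum_apply, LinearMap.smul_apply, map_sum, H.h_y, smul_sub,
    Finset.sum_sub_distrib, map_smul, smul_smul]
  rw [← Finset.sum_smul]
  simp_rw [mul_comm (a _)]
  rw [ha, one_smul]

/-- The choice of `a` makes ∑ a_j h_j a grading operator that every `y i` lowers by one. A word of
length `k` applied to `v` has degree `c - k`, so only the empty word contributes in degree `c`. -/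
theorem mem_span_singleton_of_mem_loweringSpan (H : IsChevalleyFamily C x y h)
    (ha : ∀ i, ∑ j, C i j * a j = 1) {v : M} {c : ℂ} (hv : (∑ j, a j • h j) v = c • v)
    {u : M} (hu : u ∈ loweringSpan y v) (hu' : (∑ j, a j • h j) u = c • u) :
    u ∈ Submodule.span ℂ {v} := by
  set p := ∑ j, a j • h j with hp
  let S : Set ℂ := {z | ∃ k : ℕ, z = c - (k + 1)}
  have hmon (l : List ι) : p ((l.map y).prod v) = (c - l.length) • (l.map y).prod v := by
    induction l with
    | nil => simp [hv]
    | cons i l ih =>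
      simp only [List.map_cons, List.prod_cons, Module.End.mul_apply]
      rw [H.sum_smul_y ha, ih, map_smul, List.length_cons]
      push_cast
      module
  have hle : loweringSpan y v ≤ Submodule.span ℂ {v} ⊔ ⨆ z ∈ S, p.eigenspace z := by
    rw [loweringSpan, Submodule.span_le]
    rintro _ ⟨l, rfl⟩
    rcases l with _ | ⟨i, l⟩
    · exact Submodule.mem_sup_left (by simp [Submodule.mem_span_singleton_self])
    · refine Submodule.mem_sup_right ?_
      refine Submodule.mem_iSup_of_mem (c - (l.length + 1)) (Submodule.mem_iSup_of_mem
        ⟨l.length, rfl⟩ ?_)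
      rw [End.mem_eigenspace_iff, hmon]
      simp
  obtain ⟨_, hs, w, hw, rfl⟩ := Submodule.mem_sup.mp (hle hu)
  obtain ⟨s, rfl⟩ := Submodule.mem_span_singleton.mp hs
  have hdis := p.eigenspaces_iSupIndep.disjoint_biSup (x := c) (y := S) (by
    rintro ⟨k, hk⟩
    have : ((k + 1 : ℕ) : ℂ) = 0 := by push_cast; linear_combination hk
    exact Nat.succ_ne_zero k (by exact_mod_cast this))
  have hw' : w ∈ p.eigenspace c := by
    rw [End.mem_eigenspace_iff]
    rw [map_add, map_smul, hv, smul_add, smul_comm] at hu'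
    exact add_left_cancel hu'
  have : w = 0 := Submodule.disjoint_def.mp hdis w hw' hw
  rw [this, add_zero]
  exact hs

/-- The stable subspace generated by a vector annihilated by the raising operators meets a direct
summand not containing that vector trivially. -/
theorem comap_loweringSpan_eq_bot (H : IsChevalleyFamily C x y h)
    (ha : ∀ i, ∑ j, C i j * a j = 1) {v : M} {χ : ι → ℂ}
    (hx : ∀ i, x i v = 0) (hv : ∀ i, h i v = χ i • v)
    {M' : Type*} [AddCommGroup M'] [Module ℂ M'] {x' y' h' : ι → End ℂ M'}
    (H' : IsChevalleyFamily C x' y' h') (hc : HasStableComplements x' y')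
    (f : M' →ₗ[ℂ] M) (q : M →ₗ[ℂ] M') (hqf : ∀ m, q (f m) = m)
    (hfx : ∀ i m, f (x' i m) = x i (f m)) (hfy : ∀ i m, f (y' i m) = y i (f m))
    (hfh : ∀ i m, f (h' i m) = h i (f m))
    (hqy : ∀ i m, q (y i m) = y' i (q m)) (hqh : ∀ i m, q (h i m) = h' i (q m))
    (hvf : v ∉ LinearMap.range f) : (loweringSpan y v).comap f = ⊥ := by
  have hst := H.isStable_loweringSpan hx hv
  obtain ⟨K', hK', hcompl⟩ := hc ((loweringSpan y v).comap f) (fun i m hm ↦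
    ⟨by simpa [hfx] using (hst i _ hm).1, by simpa [hfy] using (hst i _ hm).2⟩)
  have hK : IsStable x' y' ((loweringSpan y v).comap f) := fun i m hm ↦
    ⟨by simpa [hfx] using (hst i _ hm).1, by simpa [hfy] using (hst i _ hm).2⟩
  obtain ⟨k, hk, k', hk', hkk⟩ : ∃ k ∈ (loweringSpan y v).comap f, ∃ k' ∈ K', k + k' = q v :=
    Submodule.mem_sup.mp (hcompl.sup_eq_top ▸ Submodule.mem_top)
  have hkχ (i : ι) : h' i k = χ i • k := by
    have h1 : h' i k + h' i k' = χ i • k + χ i • k' := by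
      rw [← map_add, ← smul_add, hkk, ← hqh, hv, map_smul]
    have h2 : h' i k - χ i • k = χ i • k' - h' i k' := by
      rw [sub_eq_sub_iff_add_eq_add, h1, add_comm]
    have h3 : h' i k - χ i • k = 0 :=
      Submodule.disjoint_def.mp hcompl.disjoint _
        (sub_mem (H'.h_mem hK i hk) (Submodule.smul_mem _ _ hk))
        (h2 ▸ sub_mem (Submodule.smul_mem _ _ hk') (H'.h_mem hK' i hk'))
    exact sub_eq_zero.mp h3
  -- `f k` has the same degree as `v`, hence is a multiple of `v`; a nonzero multiple would put `v`
  -- into the range of `f`. So `q v` lies in the complement `K'`, and `q` maps the whole lowering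
  -- span there.
  have hk0 : k = 0 := by
    have h1 : f k ∈ Submodule.span ℂ {v} := by
      refine H.mem_span_singleton_of_mem_loweringSpan ha (c := ∑ j, a j * χ j) ?_ hk ?_
      · simp [LinearMap.sum_apply, hv, Finset.sum_smul, smul_smul]
      · simp [LinearMap.sum_apply, ← hfh, hkχ, Finset.sum_smul, smul_smul]
    obtain ⟨s, hs⟩ := Submodule.mem_span_singleton.mp h1
    by_cases hs0 : s = 0
    · rw [hs0, zero_smul] at hs
      rw [← hqf k, ← hs, map_zero]
    · exact absurd ⟨s⁻¹ • k, by rw [map_smul, ← hs, smul_smul, inv_mul_cancel₀ hs0, one_smul]⟩ hvf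
  have hqv : q v ∈ K' := by rw [← hkk, hk0, zero_add]; exact hk'
  have hle : loweringSpan y v ≤ K'.comap q := loweringSpan_le hqv fun i m hm ↦ by
    rw [Submodule.mem_comap, hqy]
    exact (hK' i _ hm).2
  rw [eq_bot_iff]
  intro m hm
  have : q (f m) ∈ K' := hle hm
  rw [hqf] at this
  exact Submodule.disjoint_def.mp hcompl.disjoint m hm this

variable {M₁ M₂ : Type*} [AddCommGroup M₁] [Module ℂ M₁] [AddCommGroup M₂] [Module ℂ M₂]
  {x₁ y₁ h₁ : ι → End ℂ M₁} {x₂ y₂ h₂ : ι → End ℂ M₂}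

theorem prodMap (H₁ : IsChevalleyFamily C x₁ y₁ h₁) (H₂ : IsChevalleyFamily C x₂ y₂ h₂) :
    IsChevalleyFamily C (fun i ↦ (x₁ i).prodMap (x₂ i)) (fun i ↦ (y₁ i).prodMap (y₂ i))
      (fun i ↦ (h₁ i).prodMap (h₂ i)) where
  h_h i j m := Prod.ext (H₁.h_h i j m.1) (H₂.h_h i j m.2)
  x_y i j m := by
    refine Prod.ext ?_ ?_
    · simp only [LinearMap.prodMap_apply, H₁.x_y]; split_ifs <;> simp
    · simp only [LinearMap.prodMap_apply, H₂.x_y]; split_ifs <;> simp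
  h_x i j m := Prod.ext (H₁.h_x i j m.1) (H₂.h_x i j m.2)
  h_y i j m := Prod.ext (H₁.h_y i j m.1) (H₂.h_y i j m.2)

/-- A nonzero stable subspace contains a simultaneous eigenvector that is annihilated by the raising
operators; the proviso is that `c + 1` is not an eigenvalue of the grading operator. -/
theorem exists_highest [FiniteDimensional ℂ M] (H : IsChevalleyFamily C x y h)
    (a : ι → ℂ) {U : Submodule ℂ M} (hU : IsStable x y U) (hU0 : U ≠ ⊥) :
    ∃ v ∈ U, v ≠ 0 ∧ ∃ χ : ι → ℂ, (∀ i, h i v = χ i • v) ∧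
      ∀ χ' : ι → ℂ, ∑ j, a j * χ' j = ∑ j, a j * χ j + 1 → jointEigenspace h χ' ⊓ U = ⊥ := by
  set p : End ℂ M := ∑ j, a j • h j with hp
  have hpU : ∀ m ∈ U, p m ∈ U := fun m hm ↦ by
    simp only [hp, LinearMap.sum_apply, LinearMap.smul_apply]
    exact sum_mem fun j _ ↦ Submodule.smul_mem _ _ (H.h_mem hU j hm)
  have : Nontrivial U := Submodule.nontrivial_iff_ne_bot.mpr hU0
  let pU : End ℂ U := p.restrict hpU
  -- Otherwise adding one repeatedly would give infinitely many eigenvalues.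
  obtain ⟨c, hc, hc1⟩ : ∃ c, pU.HasEigenvalue c ∧ ¬ pU.HasEigenvalue (c + 1) := by
    obtain ⟨c₀, hc₀⟩ := Module.End.exists_eigenvalue pU
    by_contra! hcon
    have hall (n : ℕ) : pU.HasEigenvalue (c₀ + n) := by
      induction n with
      | zero => simpa using hc₀
      | succ n ih => simpa [add_assoc] using hcon _ ih
    have hinj : Function.Injective (fun n : ℕ ↦ c₀ + n) := fun n m hnm ↦ by simpa using hnm
    exact ((Set.infinite_range_of_injective hinj).mono
      (Set.range_subset_iff.mpr hall)) pU.finite_hasEigenvalue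
  obtain ⟨⟨w, hw⟩, hw1⟩ := hc.exists_hasEigenvector
  have hw2 : p w = c • w := congrArg Subtype.val hw1.apply_eq_smul
  have hw0 : w ≠ 0 := fun h ↦ hw1.2 (Subtype.ext h)
  have hph (i : ι) (m : M) : p (h i m) = h i (p m) := by
    simp only [hp, LinearMap.sum_apply, LinearMap.smul_apply, map_sum, map_smul, H.h_h i]
  obtain ⟨v, hv, hv0, hvs⟩ := exists_joint_eigenvector H.h_h Finset.univ (U ⊓ p.eigenspace c)
    ((Submodule.ne_bot_iff _).mpr ⟨w, ⟨hw, End.mem_eigenspace_iff.mpr hw2⟩, hw0⟩)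
    (fun i m hm ↦ ⟨H.h_mem hU i hm.1, by
      have := End.mem_eigenspace_iff.mp hm.2
      exact End.mem_eigenspace_iff.mpr (by rw [hph, this, map_smul])⟩)
  choose χ hχ using fun i ↦ hvs i (Finset.mem_univ i)
  refine ⟨v, hv.1, hv0, χ, hχ, fun χ' hχ' ↦ ?_⟩
  have hpχ {χ : ι → ℂ} {m : M} (hm : ∀ i, h i m = χ i • m) : p m = (∑ j, a j * χ j) • m := by
    simp [hp, LinearMap.sum_apply, hm, Finset.sum_smul, smul_smul]
  have hcχ : c = ∑ j, a j * χ j := by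
    have h1 := End.mem_eigenspace_iff.mp hv.2
    rw [hpχ hχ] at h1
    exact (smul_left_injective ℂ hv0 h1).symm
  by_contra hne
  obtain ⟨u, hu, hu0⟩ := (Submodule.ne_bot_iff _).mp hne
  refine hc1 (End.hasEigenvalue_of_hasEigenvector (x := ⟨u, hu.2⟩)
    ⟨End.mem_eigenspace_iff.mpr (Subtype.ext ?_), fun h ↦ hu0 (congrArg Subtype.val h)⟩)
  change p u = (c + 1) • u
  rw [hpχ (mem_jointEigenspace.mp hu.1), hχ', hcχ]

theorem finrank_inf_add_finrank_inf [FiniteDimensional ℂ M] (H : IsChevalleyFamily C x y h)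
    {N N' : Submodule ℂ M} (hN : IsStable x y N) (hN' : IsStable x y N') (hc : IsCompl N N')
    (χ : ι → ℂ) :
    finrank ℂ (jointEigenspace h χ ⊓ N : Submodule ℂ M) +
      finrank ℂ (jointEigenspace h χ ⊓ N' : Submodule ℂ M) = finrank ℂ (jointEigenspace h χ) := by
  have hdis : (jointEigenspace h χ ⊓ N) ⊓ (jointEigenspace h χ ⊓ N') = ⊥ := by
    rw [eq_bot_iff, ← hc.inf_eq_bot]
    exact inf_le_inf inf_le_right inf_le_right
  have hsup : (jointEigenspace h χ ⊓ N) ⊔ (jointEigenspace h χ ⊓ N') = jointEigenspace h χ := by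
    refine le_antisymm (sup_le inf_le_left inf_le_left) fun m hm ↦ ?_
    obtain ⟨n, hn, n', hn', rfl⟩ := Submodule.mem_sup.mp (hc.sup_eq_top ▸ Submodule.mem_top (x := m))
    rw [mem_jointEigenspace] at hm
    have key (i : ι) : h i n - χ i • n = 0 := by
      have h2 : h i n - χ i • n = χ i • n' - h i n' := by
        have := hm i
        rw [map_add, smul_add] at this
        rw [sub_eq_sub_iff_add_eq_add, this, add_comm]
      exact Submodule.disjoint_def.mp hc.disjoint _
        (sub_mem (H.h_mem hN i hn) (Submodule.smul_mem _ _ hn))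
        (h2 ▸ sub_mem (Submodule.smul_mem _ _ hn') (H.h_mem hN' i hn'))
    have key' (i : ι) : h i n' = χ i • n' := by
      have := hm i
      rw [map_add, smul_add, sub_eq_zero.mp (key i)] at this
      exact add_left_cancel this
    exact Submodule.add_mem_sup ⟨mem_jointEigenspace.mpr fun i ↦ sub_eq_zero.mp (key i), hn⟩
      ⟨mem_jointEigenspace.mpr key', hn'⟩
  have := Submodule.finrank_sup_add_finrank_inf_eq (jointEigenspace h χ ⊓ N)
    (jointEigenspace h χ ⊓ N')
  rw [hdis, hsup, finrank_bot] at this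
  omega

theorem finrank_inf_map [FiniteDimensional ℂ M]
    {h₁ : ι → End ℂ M₁} (H : IsChevalleyFamily C x y h) (q : M →ₗ[ℂ] M₁)
    (hq : ∀ i m, q (h i m) = h₁ i (q m)) {N : Submodule ℂ M} (hN : IsStable x y N)
    (hqN : ∀ m ∈ N, q m = 0 → m = 0) (χ : ι → ℂ) :
    finrank ℂ (jointEigenspace h₁ χ ⊓ N.map q : Submodule ℂ M₁) =
      finrank ℂ (jointEigenspace h χ ⊓ N : Submodule ℂ M) := by
  have hmap : jointEigenspace h₁ χ ⊓ N.map q =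
      LinearMap.range (q.domRestrict (jointEigenspace h χ ⊓ N)) := by
    rw [LinearMap.range_domRestrict]
    ext m
    constructor
    · rintro ⟨h1, n, hn, rfl⟩
      refine ⟨n, ⟨mem_jointEigenspace.mpr fun i ↦ ?_, hn⟩, rfl⟩
      rw [← sub_eq_zero]
      refine hqN _ (sub_mem (H.h_mem hN i hn) (N.smul_mem _ hn)) ?_
      rw [map_sub, hq, map_smul, mem_jointEigenspace.mp h1 i, sub_self]
    · rintro ⟨n, ⟨h1, hn⟩, rfl⟩
      exact ⟨mem_jointEigenspace.mpr fun i ↦ by rw [← hq, mem_jointEigenspace.mp h1 i, map_smul],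
        n, hn, rfl⟩
  rw [hmap]
  refine LinearMap.finrank_range_of_inj ?_
  rw [injective_iff_map_eq_zero]
  rintro ⟨m, hm⟩ h0
  exact Subtype.ext (hqN m hm.2 h0)

theorem isStable_map {q : M →ₗ[ℂ] M₁} (hqx : ∀ i m, q (x i m) = x₁ i (q m))
    (hqy : ∀ i m, q (y i m) = y₁ i (q m)) {N : Submodule ℂ M} (hN : IsStable x y N) :
    IsStable x₁ y₁ (N.map q) := by
  rintro i _ ⟨n, hn, rfl⟩
  exact ⟨⟨_, (hN i n hn).1, hqx i n⟩, ⟨_, (hN i n hn).2, hqy i n⟩⟩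

/-- Two finite-dimensional semisimple modules over the same Chevalley generators are isomorphic if
their weight multiplicities agree. -/
theorem exists_equiv [FiniteDimensional ℂ M₁] [FiniteDimensional ℂ M₂]
    (H₁ : IsChevalleyFamily C x₁ y₁ h₁) (H₂ : IsChevalleyFamily C x₂ y₂ h₂)
    {a : ι → ℂ} (ha : ∀ i, ∑ j, C i j * a j = 1)
    (hc₁ : HasStableComplements x₁ y₁) (hc₂ : HasStableComplements x₂ y₂)
    (hχ : ∀ χ, finrank ℂ (jointEigenspace h₁ χ) = finrank ℂ (jointEigenspace h₂ χ)) :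
    ∃ e : M₁ ≃ₗ[ℂ] M₂, (∀ i m, e (x₁ i m) = x₂ i (e m)) ∧ ∀ i m, e (y₁ i m) = y₂ i (e m) := by
  have H := H₁.prodMap H₂
  set X := fun i ↦ (x₁ i).prodMap (x₂ i)
  set Y := fun i ↦ (y₁ i).prodMap (y₂ i)
  set Z := fun i ↦ (h₁ i).prodMap (h₂ i)
  -- These are the graphs of isomorphisms between stable subspaces of the two modules. A maximal
  -- graph turns out to be the graph of an isomorphism `M₁ ≃ M₂`.
  let S : Set (Submodule ℂ (M₁ × M₂)) := {N | IsStable X Y N ∧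
    (∀ m ∈ N, m.1 = 0 → m = 0) ∧ (∀ m ∈ N, m.2 = 0 → m = 0)}
  have hS : (⊥ : Submodule ℂ (M₁ × M₂)) ∈ S :=
    ⟨fun i m hm ↦ by rw [Submodule.mem_bot] at hm; simp [hm], fun m hm _ ↦ hm, fun m hm _ ↦ hm⟩
  obtain ⟨N, ⟨hN, hN1, hN2⟩, hmax⟩ := WellFounded.has_min
    (wellFounded_gt (α := Submodule ℂ (M₁ × M₂))) S ⟨_, hS⟩
  set N₁ := N.map (LinearMap.fst ℂ M₁ M₂)
  set N₂ := N.map (LinearMap.snd ℂ M₁ M₂)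
  have hN₁ : IsStable x₁ y₁ N₁ := isStable_map (x := X) (y := Y) (fun _ _ ↦ rfl) (fun _ _ ↦ rfl) hN
  have hN₂ : IsStable x₂ y₂ N₂ := isStable_map (x := X) (y := Y) (fun _ _ ↦ rfl) (fun _ _ ↦ rfl) hN
  obtain ⟨N₁', hN₁', hcompl₁⟩ := hc₁ N₁ hN₁
  obtain ⟨N₂', hN₂', hcompl₂⟩ := hc₂ N₂ hN₂
  have hχ' (χ : ι → ℂ) : finrank ℂ (jointEigenspace h₁ χ ⊓ N₁' : Submodule ℂ M₁) =
      finrank ℂ (jointEigenspace h₂ χ ⊓ N₂' : Submodule ℂ M₂) := by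
    have e1 := H₁.finrank_inf_add_finrank_inf hN₁ hN₁' hcompl₁ χ
    have e2 := H₂.finrank_inf_add_finrank_inf hN₂ hN₂' hcompl₂ χ
    have e3 : finrank ℂ (jointEigenspace h₁ χ ⊓ N₁ : Submodule ℂ M₁) = _ :=
      H.finrank_inf_map (LinearMap.fst ℂ M₁ M₂) (fun _ _ ↦ rfl) hN hN1 χ
    have e4 : finrank ℂ (jointEigenspace h₂ χ ⊓ N₂ : Submodule ℂ M₂) = _ :=
      H.finrank_inf_map (LinearMap.snd ℂ M₁ M₂) (fun _ _ ↦ rfl) hN hN2 χ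
    have := hχ χ
    omega
  have hbot (χ : ι → ℂ) : jointEigenspace h₁ χ ⊓ N₁' = ⊥ ↔ jointEigenspace h₂ χ ⊓ N₂' = ⊥ := by
    rw [← Submodule.finrank_eq_zero, ← Submodule.finrank_eq_zero, hχ']
  have hN₁0 : N₁' = ⊥ := by
    by_contra hne
    obtain ⟨v₁, hv₁, hv₁0, χ, hvχ₁, hcon₁⟩ := H₁.exists_highest a hN₁' hne
    -- The complements have equal multiplicities, so the weight of `v₁` also occurs on the second
    -- side, and the weights one degree higher are absent from both. The pair `(v₁, v₂)` is thus a
    -- highest weight vector, and the graph it generates enlarges `N`.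
    obtain ⟨v₂, hv₂, hv₂0⟩ := (Submodule.ne_bot_iff _).mp ((hbot χ).not.mp
      ((Submodule.ne_bot_iff _).mpr ⟨v₁, ⟨mem_jointEigenspace.mpr hvχ₁, hv₁⟩, hv₁0⟩))
    have hvχ₂ := mem_jointEigenspace.mp hv₂.1
    have hx₁ (i : ι) : x₁ i v₁ = 0 := by
      have h1 : x₁ i v₁ ∈ jointEigenspace h₁ (fun j ↦ χ j + C i j) ⊓ N₁' := by
        refine ⟨mem_jointEigenspace.mpr fun j ↦ ?_, (hN₁' i _ hv₁).1⟩
        rw [H₁.h_x, hvχ₁, map_smul, add_smul]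
      rw [hcon₁] at h1
      · exact h1
      · simp only [mul_add, Finset.sum_add_distrib]
        rw [← ha i]; simp_rw [mul_comm]
    have hx₂ (i : ι) : x₂ i v₂ = 0 := by
      have h1 : x₂ i v₂ ∈ jointEigenspace h₂ (fun j ↦ χ j + C i j) ⊓ N₂' := by
        refine ⟨mem_jointEigenspace.mpr fun j ↦ ?_, (hN₂' i _ hv₂.2).1⟩
        rw [H₂.h_x, hvχ₂, map_smul, add_smul]
      rw [(hbot _).mp (hcon₁ _ ?_)] at h1
      · exact h1
      · simp only [mul_add, Finset.sum_add_distrib]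
        rw [← ha i]; simp_rw [mul_comm]
    have hX (i : ι) : X i (v₁, v₂) = 0 := Prod.ext (hx₁ i) (hx₂ i)
    have hZ (i : ι) : Z i (v₁, v₂) = χ i • (v₁, v₂) := Prod.ext (hvχ₁ i) (hvχ₂ i)
    set P := loweringSpan Y (v₁, v₂)
    have hP : IsStable X Y P := H.isStable_loweringSpan hX hZ
    have hPle : P ≤ N₁'.prod N₂' := loweringSpan_le ⟨hv₁, hv₂.2⟩ fun i m hm ↦
      ⟨(hN₁' i _ hm.1).2, (hN₂' i _ hm.2).2⟩
    have hP2 : P.comap (LinearMap.inr ℂ M₁ M₂) = ⊥ :=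
      H.comap_loweringSpan_eq_bot ha hX hZ H₂ hc₂ (LinearMap.inr ℂ M₁ M₂) (LinearMap.snd ℂ M₁ M₂)
        (fun _ ↦ rfl) (fun i m ↦ Prod.ext (map_zero (x₁ i)).symm rfl)
        (fun i m ↦ Prod.ext (map_zero (y₁ i)).symm rfl) (fun i m ↦ Prod.ext (map_zero (h₁ i)).symm rfl)
        (fun _ _ ↦ rfl) (fun _ _ ↦ rfl)
        (by rintro ⟨m, hm⟩; exact hv₁0 (congrArg Prod.fst hm).symm)
    have hP1 : P.comap (LinearMap.inl ℂ M₁ M₂) = ⊥ :=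
      H.comap_loweringSpan_eq_bot ha hX hZ H₁ hc₁ (LinearMap.inl ℂ M₁ M₂) (LinearMap.fst ℂ M₁ M₂)
        (fun _ ↦ rfl) (fun i m ↦ Prod.ext rfl (map_zero (x₂ i)).symm)
        (fun i m ↦ Prod.ext rfl (map_zero (y₂ i)).symm) (fun i m ↦ Prod.ext rfl (map_zero (h₂ i)).symm)
        (fun _ _ ↦ rfl) (fun _ _ ↦ rfl)
        (by rintro ⟨m, hm⟩; exact hv₂0 (congrArg Prod.snd hm).symm)
    have hPz1 (m : M₁ × M₂) (hm : m ∈ P) (h0 : m.1 = 0) : m = 0 := by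
      have : m.2 ∈ P.comap (LinearMap.inr ℂ M₁ M₂) := by
        rw [Submodule.mem_comap, LinearMap.inr_apply, ← h0]; exact hm
      rw [hP2, Submodule.mem_bot] at this
      exact Prod.ext h0 this
    have hPz2 (m : M₁ × M₂) (hm : m ∈ P) (h0 : m.2 = 0) : m = 0 := by
      have : m.1 ∈ P.comap (LinearMap.inl ℂ M₁ M₂) := by
        rw [Submodule.mem_comap, LinearMap.inl_apply, ← h0]; exact hm
      rw [hP1, Submodule.mem_bot] at this
      exact Prod.ext this h0
    refine hmax (N ⊔ P) ⟨?_, ?_, ?_⟩ ?_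
    · intro i m hm
      obtain ⟨n, hn, q, hq, rfl⟩ := Submodule.mem_sup.mp hm
      exact ⟨by rw [map_add]; exact Submodule.add_mem_sup (hN i n hn).1 (hP i q hq).1,
        by rw [map_add]; exact Submodule.add_mem_sup (hN i n hn).2 (hP i q hq).2⟩
    · intro m hm h0
      obtain ⟨n, hn, q, hq, rfl⟩ := Submodule.mem_sup.mp hm
      have h1 : n.1 = 0 := Submodule.disjoint_def.mp hcompl₁.disjoint _ ⟨n, hn, rfl⟩
        (by rw [eq_neg_of_add_eq_zero_left h0]; exact neg_mem (hPle hq).1)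
      have h2 : q.1 = 0 := by simpa [h1] using h0
      rw [hN1 n hn h1, hPz1 q hq h2, add_zero]
    · intro m hm h0
      obtain ⟨n, hn, q, hq, rfl⟩ := Submodule.mem_sup.mp hm
      have h1 : n.2 = 0 := Submodule.disjoint_def.mp hcompl₂.disjoint _ ⟨n, hn, rfl⟩
        (by rw [eq_neg_of_add_eq_zero_left h0]; exact neg_mem (hPle hq).2)
      have h2 : q.2 = 0 := by simpa [h1] using h0
      rw [hN2 n hn h1, hPz2 q hq h2, add_zero]
    · refine lt_of_le_of_ne le_sup_left fun heq ↦ hv₁0 ?_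
      have h1 : (v₁, v₂) ∈ N := heq ▸ Submodule.mem_sup_right (self_mem_loweringSpan _)
      exact Submodule.disjoint_def.mp hcompl₁.disjoint _ ⟨_, h1, rfl⟩ hv₁
  have hN₂0 : N₂' = ⊥ := by
    by_contra hne
    obtain ⟨v₂, hv₂, hv₂0, χ, hvχ₂, -⟩ := H₂.exists_highest a hN₂' hne
    have := (hbot χ).mp (by rw [hN₁0, inf_bot_eq])
    exact hv₂0 (this.le ⟨mem_jointEigenspace.mpr hvχ₂, hv₂⟩)
  have hs₁ : N₁ = ⊤ := by simpa [hN₁0] using hcompl₁.sup_eq_top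
  have hs₂ : N₂ = ⊤ := by simpa [hN₂0] using hcompl₂.sup_eq_top
  let e₁ : N ≃ₗ[ℂ] M₁ := LinearEquiv.ofBijective (LinearMap.fst ℂ M₁ M₂ ∘ₗ N.subtype)
    ⟨(injective_iff_map_eq_zero _).mpr fun m hm ↦ Subtype.ext (hN1 m m.2 hm), fun m ↦ by
      obtain ⟨n, hn, rfl⟩ : m ∈ N₁ := hs₁ ▸ Submodule.mem_top
      exact ⟨⟨n, hn⟩, rfl⟩⟩
  let e₂ : N ≃ₗ[ℂ] M₂ := LinearEquiv.ofBijective (LinearMap.snd ℂ M₁ M₂ ∘ₗ N.subtype)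
    ⟨(injective_iff_map_eq_zero _).mpr fun m hm ↦ Subtype.ext (hN2 m m.2 hm), fun m ↦ by
      obtain ⟨n, hn, rfl⟩ : m ∈ N₂ := hs₂ ▸ Submodule.mem_top
      exact ⟨⟨n, hn⟩, rfl⟩⟩
  refine ⟨e₁.symm.trans e₂, fun i m ↦ ?_, fun i m ↦ ?_⟩
  · obtain ⟨n, rfl⟩ := e₁.surjective m
    have h1 : x₁ i (e₁ n) = e₁ ⟨X i n, (hN i n n.2).1⟩ := rfl
    rw [h1, LinearEquiv.trans_apply, LinearEquiv.symm_apply_apply, LinearEquiv.trans_apply,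
      LinearEquiv.symm_apply_apply]
    rfl
  · obtain ⟨n, rfl⟩ := e₁.surjective m
    have h1 : y₁ i (e₁ n) = e₁ ⟨Y i n, (hN i n n.2).2⟩ := rfl
    rw [h1, LinearEquiv.trans_apply, LinearEquiv.symm_apply_apply, LinearEquiv.trans_apply,
      LinearEquiv.symm_apply_apply]
    rfl

end IsChevalleyFamily

end TriangularFamily

/-! ### Exponentials of endomorphisms -/

section EndExp

variable {V W : Type*} [AddCommGroup V] [Module ℂ V] [FiniteDimensional ℂ V]
  [AddCommGroup W] [Module ℂ W] [FiniteDimensional ℂ W]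

/-- A norm on a finite-dimensional complex vector space, given by the coordinates in a basis. -/
noncomputable abbrev coordNorm (V : Type*) [AddCommGroup V] [Module ℂ V] [FiniteDimensional ℂ V] :
    NormedAddCommGroup V :=
  NormedAddCommGroup.induced V (Fin (finrank ℂ V) → ℂ) (finBasis ℂ V).equivFun
    (finBasis ℂ V).equivFun.injective

/-- The normed space structure belonging to `coordNorm`. -/
noncomputable abbrev coordNormedSpace (V : Type*) [AddCommGroup V] [Module ℂ V]
    [FiniteDimensional ℂ V] : @NormedSpace ℂ V _ (coordNorm V).toSeminormedAddCommGroup :=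
  let _ := coordNorm V
  NormedSpace.induced ℂ V (Fin (finrank ℂ V) → ℂ) (finBasis ℂ V).equivFun

/-- The exponential of an endomorphism of a finite-dimensional complex vector space. -/
noncomputable def endExp (A : End ℂ V) : End ℂ V :=
  letI := coordNorm V
  letI := coordNormedSpace V
  (NormedSpace.exp (LinearMap.toContinuousLinearMap A) : V →L[ℂ] V)

theorem hasSum_exp_toContinuousLinearMap {E : Type*} [NormedAddCommGroup E] [NormedSpace ℂ E]
    [FiniteDimensional ℂ E] (A : End ℂ E) (v : E) :
    HasSum (fun n : ℕ ↦ (n.factorial⁻¹ : ℂ) • (A ^ n) v)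
      ((NormedSpace.exp (LinearMap.toContinuousLinearMap A) : E →L[ℂ] E) v) := by
  have : CompleteSpace E := FiniteDimensional.complete ℂ E
  have h := NormedSpace.exp_series_hasSum_exp' (𝕂 := ℂ) (LinearMap.toContinuousLinearMap A)
  have h2 := h.mapL (ContinuousLinearMap.apply ℂ E v)
  refine h2.congr_fun fun n ↦ ?_
  change _ = (n.factorial⁻¹ : ℂ) • ((LinearMap.toContinuousLinearMap A : E →L[ℂ] E) ^ n) v
  congr 1
  clear h2
  induction n generalizing v with
  | zero => rfl
  | succ n ih => rw [pow_succ, End.mul_apply, ih, pow_succ]; rfl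

theorem hasSum_endExp (A : End ℂ V) (f : V →ₗ[ℂ] ℂ) (v : V) :
    HasSum (fun n : ℕ ↦ (n.factorial⁻¹ : ℂ) * f ((A ^ n) v)) (f (endExp A v)) := by
  let _ := coordNorm V
  let _ := coordNormedSpace V
  have h := (hasSum_exp_toContinuousLinearMap A v).mapL (LinearMap.toContinuousLinearMap f)
  simp only [map_smul, smul_eq_mul, LinearMap.coe_toContinuousLinearMap'] at h
  exact h

/-- Functionals separate points, so the scalar series determine the exponential; the auxiliary norm
never has to be mentioned again. -/
theorem endExp_unique {A : End ℂ V} {v w : V}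
    (h : ∀ f : V →ₗ[ℂ] ℂ, HasSum (fun n : ℕ ↦ (n.factorial⁻¹ : ℂ) * f ((A ^ n) v)) (f w)) :
    endExp A v = w := by
  rw [← sub_eq_zero, ← Module.forall_dual_apply_eq_zero_iff ℂ]
  intro f
  rw [map_sub, (hasSum_endExp A f v).unique (h f), sub_self]

theorem endExp_eq_exp {E : Type*} [NormedAddCommGroup E] [NormedSpace ℂ E]
    [FiniteDimensional ℂ E] (A : End ℂ E) (v : E) :
    endExp A v = (NormedSpace.exp (LinearMap.toContinuousLinearMap A) : E →L[ℂ] E) v := by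
  refine endExp_unique fun f ↦ ?_
  simpa using (hasSum_exp_toContinuousLinearMap A v).mapL (LinearMap.toContinuousLinearMap f)

theorem endExp_add {A B : End ℂ V} (h : Commute A B) : endExp (A + B) = endExp A * endExp B := by
  let _ := coordNorm V
  let _ := coordNormedSpace V
  have : CompleteSpace V := FiniteDimensional.complete ℂ V
  let _ := NormedAlgebra.restrictScalars ℚ ℂ (V →L[ℂ] V)
  have h2 : Commute (LinearMap.toContinuousLinearMap A : V →L[ℂ] V)
      (LinearMap.toContinuousLinearMap B) := by
    ext v
    exact LinearMap.congr_fun h v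
  have h3 := NormedSpace.exp_add_of_commute h2
  ext v
  rw [End.mul_apply, endExp_eq_exp, endExp_eq_exp, endExp_eq_exp, map_add, h3]
  rfl

@[simp] theorem endExp_zero : endExp (0 : End ℂ V) = 1 := by
  ext v
  refine endExp_unique fun f ↦ ?_
  convert hasSum_single (f := fun n : ℕ ↦ (n.factorial⁻¹ : ℂ) * f (((0 : End ℂ V) ^ n) v)) 0 ?_
  · simp
  · intro n hn
    simp [hn]

theorem endExp_mul_endExp_neg (A : End ℂ V) : endExp A * endExp (-A) = 1 := by
  rw [← endExp_add (Commute.refl A).neg_right, add_neg_cancel, endExp_zero]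

theorem endExp_neg_mul_endExp (A : End ℂ V) : endExp (-A) * endExp A = 1 := by
  rw [← endExp_add (Commute.refl A).neg_left, neg_add_cancel, endExp_zero]

theorem endExp_apply_of_pow_three {A : End ℂ V} {v : V} (h : A (A (A v)) = 0) :
    endExp A v = v + A v + (2⁻¹ : ℂ) • A (A v) := by
  refine endExp_unique fun f ↦ ?_
  have : f (v + A v + (2⁻¹ : ℂ) • A (A v)) =
      ∑ n ∈ Finset.range 3, (n.factorial⁻¹ : ℂ) * f ((A ^ n) v) := by
    simp [Finset.sum_range_succ, pow_succ]
  rw [this]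
  refine hasSum_sum_of_ne_finset_zero fun n hn ↦ ?_
  obtain ⟨k, rfl⟩ := Nat.exists_eq_add_of_le (not_lt.mp (Finset.mem_range.not.mp hn))
  rw [add_comm, pow_add, End.mul_apply]
  simp [pow_succ, h]

theorem endExp_apply_of_pow_two {A : End ℂ V} {v : V} (h : A (A v) = 0) :
    endExp A v = v + A v := by
  rw [endExp_apply_of_pow_three (by rw [h, map_zero]), h, smul_zero, add_zero]

theorem map_endExp {A : End ℂ V} {B : End ℂ W} (T : V →ₗ[ℂ] W) (h : ∀ v, T (A v) = B (T v))
    (v : V) : T (endExp A v) = endExp B (T v) := by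
  refine (endExp_unique fun f ↦ ?_).symm
  have h2 (n : ℕ) : (B ^ n) (T v) = T ((A ^ n) v) := by
    induction n with
    | zero => rfl
    | succ n ih => rw [pow_succ', End.mul_apply, ih, ← h, pow_succ', End.mul_apply]
  simpa [h2] using hasSum_endExp A (f ∘ₗ T) v

theorem endExp_mulLeft (A B : End ℂ V) : endExp (LinearMap.mulLeft ℂ A) B = endExp A * B := by
  ext v
  exact map_endExp (LinearMap.applyₗ v) (fun _ ↦ rfl) B

theorem endExp_mulRight (A B : End ℂ V) : endExp (LinearMap.mulRight ℂ A) B = B * endExp A := by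
  ext v
  rw [← sub_eq_zero, ← Module.forall_dual_apply_eq_zero_iff ℂ]
  intro f
  have h1 := hasSum_endExp (LinearMap.mulRight ℂ A) (f ∘ₗ LinearMap.applyₗ v) B
  have h2 := hasSum_endExp A (f ∘ₗ B) v
  have h3 (n : ℕ) : (f ∘ₗ LinearMap.applyₗ v) ((LinearMap.mulRight ℂ A ^ n) B) =
      (f ∘ₗ B) ((A ^ n) v) := by
    rw [LinearMap.pow_mulRight]; rfl
  simp only [h3] at h1
  rw [map_sub, sub_eq_zero]
  exact h1.unique h2

/-- The exponential of `A`, as an automorphism. -/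
noncomputable def endExpEquiv (A : End ℂ V) : V ≃ₗ[ℂ] V :=
  LinearEquiv.ofLinearMap (endExp A) (endExp (-A)) (endExp_mul_endExp_neg A) (endExp_neg_mul_endExp A)

/-- Left and right multiplication commute, so the exponential of their difference factors: exp(ad A)
is conjugation by exp A. -/
theorem endExp_mulLeft_sub_mulRight (A B : End ℂ V) :
    endExp (LinearMap.mulLeft ℂ A - LinearMap.mulRight ℂ A) B = (endExpEquiv A).conj B := by
  have hc : Commute (LinearMap.mulLeft ℂ A) (LinearMap.mulRight ℂ A) :=
    LinearMap.ext fun _ ↦ (mul_assoc _ _ _).symm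
  rw [sub_eq_add_neg, endExp_add hc.neg_right,
    End.mul_apply, endExp_mulLeft]
  have : -LinearMap.mulRight ℂ A = LinearMap.mulRight ℂ (-A) := by ext; simp
  rw [this, endExp_mulRight]
  rfl

end EndExp

/-! ### A local conjugacy statement from the open mapping property -/

section Openness

/-- If `E` is spanned by `H ∋ v` and the vectors `B x v`, then the `exp (B x)` move `H` over a
neighbourhood of `v`. -/
theorem endExp_image_mem_nhds {E : Type*} [NormedAddCommGroup E] [NormedSpace ℂ E]
    [FiniteDimensional ℂ E] (B : E →ₗ[ℂ] End ℂ E) (H : Submodule ℂ E) {v : E} (hv : v ∈ H)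
    (hs : ∀ y, ∃ x, ∃ h ∈ H, B x v + h = y) :
    {y | ∃ x, ∃ h ∈ H, endExp (B x) h = y} ∈ 𝓝 v := by
  have : CompleteSpace E := FiniteDimensional.complete ℂ E
  let B' : E →L[ℂ] E →L[ℂ] E := LinearMap.toContinuousLinearMap
    ((LinearMap.toContinuousLinearMap (𝕜 := ℂ) (E := E) (F' := E)).toLinearMap ∘ₗ B)
  let f : E × H → E := fun p ↦ (NormedSpace.exp (B' p.1) : E →L[ℂ] E) p.2
  have h1 : HasStrictFDerivAt (fun p : E × H ↦ (NormedSpace.exp (B' p.1) : E →L[ℂ] E))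
      ((1 : (E →L[ℂ] E) →L[ℂ] (E →L[ℂ] E)).comp (B'.comp (ContinuousLinearMap.fst ℂ E H)))
      ((0, ⟨v, hv⟩) : E × H) := by
    refine HasStrictFDerivAt.comp (g := (NormedSpace.exp : (E →L[ℂ] E) → (E →L[ℂ] E)))
      _ ?_ (B'.comp (ContinuousLinearMap.fst ℂ E H)).hasStrictFDerivAt
    simpa using hasStrictFDerivAt_exp_zero (𝕂 := ℂ) (𝔸 := E →L[ℂ] E)
  have h2 : HasStrictFDerivAt (fun p : E × H ↦ (p.2 : E))
      (H.subtypeL.comp (ContinuousLinearMap.snd ℂ E H)) ((0, ⟨v, hv⟩) : E × H) :=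
    (H.subtypeL.comp (ContinuousLinearMap.snd ℂ E H)).hasStrictFDerivAt
  -- The derivative of `(x, h) ↦ exp (B x) h` at `(0, v)` is `(x, h) ↦ B x v + h`, which is onto by
  -- `hs`.
  have h3 := (h1.clm_apply h2).map_nhds_eq_of_surj (by
    rw [LinearMap.range_eq_top]
    intro y
    obtain ⟨x, h, hh, rfl⟩ := hs y
    refine ⟨(x, ⟨h, hh⟩), ?_⟩
    simp [B', add_comm])
  have h4 : (NormedSpace.exp (B' 0) : E →L[ℂ] E) v = v := by simp
  simp only [h4] at h3
  rw [← h3, Filter.mem_map]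
  refine Filter.univ_mem' fun p ↦ ⟨p.1, p.2, p.2.2, ?_⟩
  rw [endExp_eq_exp]
  rfl

end Openness

/-! ### Automorphisms that are conjugations in every representation -/

section Inner

attribute [local instance] LieRing.ofAssociativeRing

variable {L : Type u} [LieRing L] [LieAlgebra ℂ L] [FiniteDimensional ℂ L]

/-- A linear automorphism of a Lie algebra is called inner here if, in every finite-dimensional
representation, it is given by a conjugation. -/
def IsInner (φ : L ≃ₗ[ℂ] L) : Prop :=
  ∀ (V : Type u) [AddCommGroup V] [Module ℂ V] [FiniteDimensional ℂ V] (ρ : L →ₗ⁅ℂ⁆ End ℂ V),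
    ∃ a : V ≃ₗ[ℂ] V, ∀ X, ρ (φ X) = a.conj (ρ X)

namespace IsInner

variable {φ ψ : L ≃ₗ[ℂ] L}

theorem refl : IsInner (LinearEquiv.refl ℂ L) := fun V _ _ _ _ ↦
  ⟨LinearEquiv.refl ℂ V, fun _ ↦ rfl⟩

theorem trans (hφ : IsInner φ) (hψ : IsInner ψ) : IsInner (φ.trans ψ) := fun V _ _ _ ρ ↦ by
  obtain ⟨a, ha⟩ := hφ V ρ
  obtain ⟨b, hb⟩ := hψ V ρ
  exact ⟨a.trans b, fun X ↦ by rw [LinearEquiv.trans_apply, hb, ha]; rfl⟩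

theorem symm (hφ : IsInner φ) : IsInner φ.symm := fun V _ _ _ ρ ↦ by
  obtain ⟨a, ha⟩ := hφ V ρ
  refine ⟨a.symm, fun X ↦ ?_⟩
  have := ha (φ.symm X)
  rw [LinearEquiv.apply_symm_apply] at this
  rw [this]
  ext
  simp [LinearEquiv.conj_apply]

/-- In the adjoint representation, which is faithful, `φ` becomes a conjugation, and conjugations
respect commutators. -/
theorem map_lie [LieAlgebra.IsSemisimple ℂ L] (hφ : IsInner φ) (X Y : L) :
    φ ⁅X, Y⁆ = ⁅φ X, φ Y⁆ := by
  obtain ⟨a, ha⟩ := hφ L (ad ℂ L)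
  have hinj : Function.Injective (ad ℂ L) := by
    rw [← LieHom.ker_eq_bot, LieAlgebra.ad_ker_eq_self_module_ker]
    simp
  apply hinj
  rw [ha, LieHom.map_lie, LieHom.map_lie, ha, ha, LieRing.of_associative_ring_bracket,
    LieRing.of_associative_ring_bracket, map_sub, End.mul_eq_comp, End.mul_eq_comp,
    LinearEquiv.conj_comp, LinearEquiv.conj_comp]
  rfl

/-- `ρ` intertwines `ad X` with the commutator by `ρ X`, so it carries exp(ad X) to conjugation by
exp(ρ X). -/
theorem endExp (X : L) : IsInner (endExpEquiv (ad ℂ L X)) := fun V _ _ _ ρ ↦ by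
  refine ⟨endExpEquiv (ρ X), fun Y ↦ ?_⟩
  rw [← endExp_mulLeft_sub_mulRight]
  refine map_endExp (ρ : L →ₗ[ℂ] End ℂ V) (fun Z ↦ ?_) Y
  simp [LieRing.of_associative_ring_bracket]

theorem ad_pow_apply [LieAlgebra.IsSemisimple ℂ L] (hφ : IsInner φ) (X Y : L) (n : ℕ) :
    ((ad ℂ L (φ X)) ^ n) (φ Y) = φ (((ad ℂ L X) ^ n) Y) := by
  induction n with
  | zero => rfl
  | succ n ih => rw [pow_succ', pow_succ', End.mul_apply, ih, End.mul_apply, ad_apply, ad_apply,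
      hφ.map_lie]

theorem map_engel [LieAlgebra.IsSemisimple ℂ L] (hφ : IsInner φ) (X : L) :
    (LieSubalgebra.engel ℂ X).toSubmodule.map φ.toLinearMap =
      (LieSubalgebra.engel ℂ (φ X)).toSubmodule := by
  ext Y
  rw [LieSubalgebra.mem_toSubmodule, LieSubalgebra.mem_engel_iff]
  constructor
  · rintro ⟨Z, hZ, rfl⟩
    obtain ⟨n, hn⟩ := (LieSubalgebra.mem_engel_iff ℂ X Z).mp hZ
    exact ⟨n, (hφ.ad_pow_apply X Z n).trans (by rw [hn, map_zero])⟩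
  · rintro ⟨n, hn⟩
    refine ⟨φ.symm Y, (LieSubalgebra.mem_engel_iff ℂ X _).mpr ⟨n, φ.injective ?_⟩,
      φ.apply_symm_apply Y⟩
    rw [← hφ.ad_pow_apply, φ.apply_symm_apply, hn, map_zero]

theorem finrank_engel_apply [LieAlgebra.IsSemisimple ℂ L] (hφ : IsInner φ) (X : L) :
    finrank ℂ (LieSubalgebra.engel ℂ (φ X)) = finrank ℂ (LieSubalgebra.engel ℂ X) := by
  have h := φ.finrank_map_eq (LieSubalgebra.engel ℂ X).toSubmodule
  exact (congrArg (fun p : Submodule ℂ L ↦ finrank ℂ p) (hφ.map_engel X)).symm.trans h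

end IsInner

end Inner

/-! ### Conjugacy of Cartan subalgebras -/

section CartanConjugacy

attribute [local instance] LieRing.ofAssociativeRing

variable {L : Type u} [LieRing L] [LieAlgebra ℂ L] [FiniteDimensional ℂ L]

open LieSubalgebra

/-- This is the Fitting decomposition of `ad X`; it supplies the surjectivity required by
`endExp_image_mem_nhds`. -/
theorem LieSubalgebra.exists_lie_add_mem_engel (X Y : L) :
    ∃ Z : L, ∃ h ∈ engel ℂ X, ⁅Z, X⁆ + h = Y := by
  obtain ⟨n, hn⟩ := Filter.eventually_atTop.mp
    (LinearMap.eventually_codisjoint_ker_pow_range_pow (ad ℂ L X))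
  have h1 := hn (n + 1) n.le_succ
  obtain ⟨h, hh, w, ⟨z, rfl⟩, rfl⟩ := Submodule.mem_sup.mp
    (h1.eq_top ▸ Submodule.mem_top (x := Y))
  refine ⟨-((ad ℂ L X) ^ n) z, h, (mem_engel_iff ℂ X h).mpr ⟨n + 1, hh⟩, ?_⟩
  rw [pow_succ', End.mul_apply, ad_apply, neg_lie, lie_skew, add_comm]

/-- An Engel subalgebra of dimension equal to the rank is minimal, and a minimal one is least among
the Engel subalgebras of its own elements. -/
theorem LieAlgebra.IsRegular.engel_le {X Y : L} (hX : IsRegular ℂ X) (hY : Y ∈ engel ℂ X) :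
    engel ℂ X ≤ engel ℂ Y := by
  set Ex : {engel ℂ z | z ∈ engel ℂ X} := ⟨engel ℂ X, X, self_mem_engel _ _, rfl⟩
  suffices IsBot Ex from @this ⟨engel ℂ Y, Y, hY, rfl⟩
  refine engel_isBot_of_isMin (Cardinal.natCast_le_aleph0.trans (Cardinal.infinite_iff.mp
    inferInstance)) (engel ℂ X) Ex le_rfl ?_
  rintro ⟨_, y, hy, rfl⟩ hyx
  have h : finrank ℂ (engel ℂ X) ≤ finrank ℂ (engel ℂ y) := by
    rw [(isRegular_iff_finrank_engel_eq_rank ℂ X).mp hX]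
    exact rank_le_finrank_engel ℂ y
  have h2 : engel ℂ y = engel ℂ X :=
    LieSubalgebra.toSubmodule_injective (Submodule.eq_of_le_of_finrank_le hyx h)
  exact h2.ge

/-- On a line through a regular element all but finitely many elements are regular. -/
theorem LieAlgebra.IsRegular.finite_setOf_not {X : L} (hX : IsRegular ℂ X) (p : L) :
    {z : ℂ | ¬ IsRegular ℂ (p + z • (X - p))}.Finite := by
  classical
  let b := finBasis ℂ L
  -- Regularity is the non-vanishing of this polynomial function. Its restriction `Q` to the line is
  -- nonzero at `z = 1`, which corresponds to `X`.
  let P := (LinearMap.polyCharpoly (ad ℂ L).toLinearMap b).coeff (rank ℂ L)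
  let Q : Polynomial ℂ := MvPolynomial.aeval
    (fun i ↦ Polynomial.C (b.repr p i) + Polynomial.X * Polynomial.C (b.repr (X - p) i)) P
  have hQ (z : ℂ) : Q.eval z = MvPolynomial.eval (b.repr (p + z • (X - p))) P := by
    rw [← Polynomial.coe_aeval_eq_eval, MvPolynomial.comp_aeval_apply,
      ← MvPolynomial.aeval_eq_eval]
    congr 2
    ext i
    simp
  have hQ0 : Q ≠ 0 := by
    intro h0
    refine (isRegular_iff_coeff_polyCharpoly_rank_ne_zero ℂ b X).mp hX ?_
    have := hQ 1
    rw [h0, Polynomial.eval_zero, one_smul, add_sub_cancel] at this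
    exact this.symm
  refine (Q.finite_setOfPred_isRoot hQ0).subset fun z hz ↦ ?_
  rw [Set.mem_ofPred_eq, isRegular_iff_coeff_polyCharpoly_rank_ne_zero ℂ b, not_not] at hz
  exact (hQ z).trans hz

variable [LieAlgebra.IsSemisimple ℂ L]

/-- The points of a complex line near `X` are conjugate to elements of the Engel subalgebra. -/
theorem eventually_exists_isInner (p d : L) (z₀ : ℂ) :
    ∀ᶠ z in 𝓝 z₀, ∃ φ : L ≃ₗ[ℂ] L, IsInner φ ∧ ∃ h ∈ engel ℂ (p + z₀ • d), φ h = p + z • d := by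
  let _ := coordNorm L
  let _ := coordNormedSpace L
  have h1 := endExp_image_mem_nhds (ad ℂ L : L →ₗ[ℂ] End ℂ L)
    (engel ℂ (p + z₀ • d)).toSubmodule (self_mem_engel ℂ (p + z₀ • d))
    (fun y ↦ LieSubalgebra.exists_lie_add_mem_engel (p + z₀ • d) y)
  have h2 : Filter.Tendsto (fun z : ℂ ↦ p + z • d) (𝓝 z₀) (𝓝 (p + z₀ • d)) :=
    (by fun_prop : Continuous fun z : ℂ ↦ p + z • d).tendsto z₀
  filter_upwards [h2 h1] with z hz
  obtain ⟨x, h, hh, hx⟩ := hz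
  exact ⟨_, IsInner.endExp x, h, hh, hx⟩

/-- The Engel subalgebras of two regular elements are conjugate. -/
theorem LieAlgebra.IsRegular.exists_isInner_map_engel {X Y : L} (hX : IsRegular ℂ X)
    (hY : IsRegular ℂ Y) : ∃ φ : L ≃ₗ[ℂ] L, IsInner φ ∧
      (engel ℂ X).toSubmodule.map φ.toLinearMap = (engel ℂ Y).toSubmodule := by
  let S := {z : ℂ | ¬ IsRegular ℂ (Y + z • (X - Y))}ᶜ
  -- The complex line minus finitely many points is connected, so it is enough to conjugate the
  -- Engel subalgebras of nearby regular points.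
  have hS : IsPreconnected S := ((hX.finite_setOf_not Y).countable.isConnected_compl_of_one_lt_rank
    (by rw [Complex.rank_real_complex]; exact Nat.one_lt_ofNat)).isPreconnected
  have hS' (z : ℂ) : z ∈ S ↔ IsRegular ℂ (Y + z • (X - Y)) := not_not
  have key := hS.induction₂ (fun z w ↦ ∃ φ : L ≃ₗ[ℂ] L, IsInner φ ∧
    (engel ℂ (Y + z • (X - Y))).toSubmodule.map φ.toLinearMap =
      (engel ℂ (Y + w • (X - Y))).toSubmodule) (x := 1) (y := 0) ?_ ?_ ?_ ?_ ?_
  · simpa using key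
  · intro z hz
    filter_upwards [nhdsWithin_le_nhds (eventually_exists_isInner Y (X - Y) z),
      self_mem_nhdsWithin] with w ⟨φ, hφ, h, hh, hw⟩ hwS
    refine ⟨φ, hφ, ?_⟩
    have h1 := ((hS' z).mp hz).engel_le hh
    have h2 : engel ℂ (Y + z • (X - Y)) = engel ℂ h := by
      refine LieSubalgebra.toSubmodule_injective (Submodule.eq_of_le_of_finrank_eq h1 ?_)
      change finrank ℂ (engel ℂ _) = finrank ℂ (engel ℂ _)
      rw [← hφ.finrank_engel_apply h, hw,
        (isRegular_iff_finrank_engel_eq_rank ℂ _).mp ((hS' z).mp hz),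
        (isRegular_iff_finrank_engel_eq_rank ℂ _).mp ((hS' w).mp hwS)]
    rw [h2, hφ.map_engel, hw]
  · rintro x y z - - - ⟨φ, hφ, h⟩ ⟨ψ, hψ, h'⟩
    refine ⟨φ.trans ψ, hφ.trans hψ, ?_⟩
    rw [← h', ← h, ← Submodule.map_comp]
    rfl
  · rintro x y - - ⟨φ, hφ, h⟩
    refine ⟨φ.symm, hφ.symm, ?_⟩
    rw [← h, ← Submodule.map_comp]
    simp
  · simpa [hS'] using hX
  · simpa [hS'] using hY

/-- Take `p` off the kernels of the finitely many nonzero roots: then the generalized 0-eigenspace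
of `ad p` contains no root contribution. -/
theorem LieSubalgebra.IsCartanSubalgebra.exists_engel_eq (H : LieSubalgebra ℂ L)
    [H.IsCartanSubalgebra] : ∃ p, engel ℂ p = H := by
  obtain ⟨p, hp⟩ := Module.Dual.exists_forall_ne_zero_of_forall_exists
    (fun α : {α : Weight ℂ H L // α.IsNonZero} ↦ α.1.toLinear) (fun α ↦ by
      by_contra! h
      exact α.2 (funext h))
  refine ⟨p, le_antisymm (fun y hy ↦ ?_) fun y hy ↦ (mem_engel_iff ℂ (p : L) y).mpr
    ⟨1, by
      rw [pow_one, ad_apply]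
      exact congrArg Subtype.val (trivial_lie_zero H H p ⟨y, hy⟩)⟩⟩
  have htop := cartan_sup_iSup_rootSpace_eq_top (K := ℂ) (L := L) H
  obtain ⟨h, hh, w, hw, rfl⟩ := (LieSubmodule.mem_sup _ _ _).mp
    (htop ▸ LieSubmodule.mem_top (R := ℂ) (L := H) y)
  have hmem {α : Weight ℂ H L} {z : L} (hz : z ∈ rootSpace H α) :
      z ∈ (ad ℂ L (p : L)).maxGenEigenspace (α p) := by
    have := (mem_genWeightSpaceOf L (α p) p z).mp
      (genWeightSpace_le_genWeightSpaceOf L p α hz)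
    rw [End.mem_maxGenEigenspace]
    exact this
  have hw1 : w ∈ ⨆ μ, ⨆ (_ : μ ≠ 0), (ad ℂ L (p : L)).maxGenEigenspace μ := by
    rw [← LieSubmodule.mem_toSubmodule] at hw
    simp only [LieSubmodule.iSup_toSubmodule] at hw
    have hle : (⨆ α : Weight ℂ H L, ⨆ (_ : α.IsNonZero), (rootSpace H α).toSubmodule) ≤
        ⨆ μ, ⨆ (_ : μ ≠ 0), (ad ℂ L (p : L)).maxGenEigenspace μ := iSup₂_le fun α hα ↦
      le_trans (fun z hz ↦ hmem hz) (le_iSup₂_of_le (α p) (hp ⟨α, hα⟩) le_rfl)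
    exact hle hw
  have hw2 : w ∈ (ad ℂ L (p : L)).maxGenEigenspace 0 := by
    have h1 : h ∈ (ad ℂ L (p : L)).maxGenEigenspace 0 :=
      (End.mem_maxGenEigenspace _ _ _).mpr ⟨1, by
        simpa using congrArg Subtype.val (trivial_lie_zero H H p ⟨h, hh⟩)⟩
    have h2 := sub_mem hy h1
    rwa [add_sub_cancel_left] at h2
  have := Submodule.disjoint_def.mp ((ad ℂ L (p : L)).independent_maxGenEigenspace 0) w hw2 hw1
  rw [this, add_zero]
  exact hh

/-- Arbitrarily close to `p` there are regular elements, and near `p` they are conjugate to elements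
`h` of `H`. Since `H` is abelian it lies in the Engel subalgebra of `h`, whose dimension is the
rank; so `p` is regular. -/
theorem LieSubalgebra.IsCartanSubalgebra.exists_isRegular (H : LieSubalgebra ℂ L)
    [H.IsCartanSubalgebra] : ∃ p, IsRegular ℂ p ∧ engel ℂ p = H := by
  obtain ⟨p, rfl⟩ := exists_engel_eq H
  refine ⟨p, ?_, rfl⟩
  obtain ⟨X, hX⟩ := LieAlgebra.exists_isRegular ℂ L
  have h1 : ∀ᶠ z in 𝓝[≠] (0 : ℂ), IsRegular ℂ (p + z • (X - p)) := by
    exact ((hX.finite_setOf_not p).eventually_cofinite_notMem.filter_mono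
      (nhdsNE_le_cofinite 0)).mono fun z hz ↦ not_not.mp hz
  have h2 := eventually_exists_isInner p (X - p) 0
  obtain ⟨z, hz, φ, hφ, h, hh, hφh⟩ := (h1.and (nhdsWithin_le_nhds h2)).exists
  rw [zero_smul, add_zero] at hh
  have h3 : engel ℂ p ≤ engel ℂ h := fun y hy ↦ (mem_engel_iff ℂ h y).mpr
    ⟨1, by
      rw [pow_one, ad_apply]
      exact congrArg Subtype.val (trivial_lie_zero (engel ℂ p) (engel ℂ p) ⟨h, hh⟩ ⟨y, hy⟩)⟩
  rw [isRegular_iff_finrank_engel_eq_rank] at hz ⊢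
  refine le_antisymm ?_ (rank_le_finrank_engel ℂ p)
  rw [← hz, ← hφh, hφ.finrank_engel_apply]
  exact Submodule.finrank_mono h3

/-- Cartan subalgebras are conjugate. -/
theorem exists_isInner_map_isCartanSubalgebra (H H' : LieSubalgebra ℂ L)
    [H.IsCartanSubalgebra] [H'.IsCartanSubalgebra] :
    ∃ φ : L ≃ₗ[ℂ] L, IsInner φ ∧ H.toSubmodule.map φ.toLinearMap = H'.toSubmodule := by
  obtain ⟨p, hp, rfl⟩ := IsCartanSubalgebra.exists_isRegular H
  obtain ⟨q, hq, rfl⟩ := IsCartanSubalgebra.exists_isRegular H'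
  exact hp.exists_isInner_map_engel hq

end CartanConjugacy

/-! ### Lifting the Weyl group to inner automorphisms -/

section WeylGroup

variable {L : Type u} [LieRing L] [LieAlgebra ℂ L] [FiniteDimensional ℂ L]
  [LieAlgebra.IsSemisimple ℂ L]

theorem endExpEquiv_apply (A : End ℂ L) (v : L) : endExpEquiv A v = endExp A v := rfl

/-- Every element of the Weyl group is the restriction of an inner automorphism. -/
theorem exists_isInner_of_mem_cartanWeylGroup (H : LieSubalgebra ℂ L) [H.IsCartanSubalgebra]
    {w : H ≃ₗ[ℂ] H} (hw : w ∈ cartanWeylGroup H) :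
    ∃ φ : L ≃ₗ[ℂ] L, IsInner φ ∧ ∀ x : H, φ x = w x := by
  induction hw using Subgroup.closure_induction with
  | mem w hw =>
    obtain ⟨α, rfl⟩ := hw
    have hα : α.1.IsNonZero := (Finset.mem_filter_univ _).mp α.2
    obtain ⟨h, e, f, t, he, hf⟩ := IsKilling.exists_isSl2Triple_of_weight_isNonZero hα
    have hh : h = IsKilling.coroot α.1 := t.h_eq_coroot hα he hf
    -- The classical lift exp(ad e) exp(-ad f) exp(ad e) of a reflection. On the vectors that occur
    -- each series stops after the quadratic term.
    refine ⟨((endExpEquiv (ad ℂ L e)).trans (endExpEquiv (ad ℂ L (-f)))).trans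
      (endExpEquiv (ad ℂ L e)), ((IsInner.endExp e).trans (IsInner.endExp (-f))).trans
      (IsInner.endExp e), fun x ↦ ?_⟩
    have hxe : ⁅e, (x : L)⁆ = -(α.1 x • e) := by
      rw [← lie_skew]
      exact congrArg _ (IsKilling.lie_eq_smul_of_mem_rootSpace he x)
    have hxf : ⁅f, (x : L)⁆ = α.1 x • f := by
      rw [← lie_skew]
      have := IsKilling.lie_eq_smul_of_mem_rootSpace hf x
      rw [LieSubalgebra.coe_bracket_of_module] at this
      rw [this, Pi.neg_apply, neg_smul, neg_neg]
    have hhe : ⁅e, h⁆ = -((2 : ℂ) • e) := by rw [← lie_skew, t.lie_h_e_smul ℂ]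
    have hhf : ⁅f, h⁆ = (2 : ℂ) • f := by rw [← lie_skew, t.lie_lie_smul_f ℂ, neg_neg]
    have hfe : ⁅f, e⁆ = -h := by rw [← lie_skew, t.lie_e_f]
    have h1 : endExp (ad ℂ L e) (x : L) = x - α.1 x • e := by
      rw [endExp_apply_of_pow_two (by simp [hxe])]
      simp [hxe, sub_eq_add_neg]
    have h2 : endExp (ad ℂ L (-f)) (x : L) = x - α.1 x • f := by
      rw [endExp_apply_of_pow_two (by simp [hxf])]
      simp [hxf, sub_eq_add_neg]
    have h3 : endExp (ad ℂ L (-f)) e = e + h - f := by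
      rw [endExp_apply_of_pow_three (by simp [hhf, hfe])]
      simp [hhf, hfe, sub_eq_add_neg]
    have h4 : endExp (ad ℂ L e) e = e := by
      rw [endExp_apply_of_pow_two (by simp)]
      simp
    have h5 : endExp (ad ℂ L e) h = h - (2 : ℂ) • e := by
      rw [endExp_apply_of_pow_two (by simp [hhe])]
      simp [hhe, sub_eq_add_neg]
    have h6 : (((IsKilling.rootSystem H).coreflection α x : H) : L) = x - α.1 x • h := by
      rw [RootPairing.coreflection_apply, hh]
      rfl
    have h7 : endExp (ad ℂ L (-f)) (x - α.1 x • e) = x - α.1 x • e - α.1 x • h := by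
      rw [map_sub, map_smul, h2, h3]
      module
    rw [h6, LinearEquiv.trans_apply, LinearEquiv.trans_apply, endExpEquiv_apply,
      endExpEquiv_apply, endExpEquiv_apply, h1, h7, map_sub, map_sub, map_smul, map_smul, h1, h4,
      h5]
    module
  | one => exact ⟨_, IsInner.refl, fun x ↦ rfl⟩
  | mul w w' _ _ h h' =>
    obtain ⟨φ, hφ, h⟩ := h
    obtain ⟨ψ, hψ, h'⟩ := h'
    exact ⟨ψ.trans φ, hψ.trans hφ, fun x ↦ by
      rw [LinearEquiv.trans_apply, h', h, LinearEquiv.mul_apply]⟩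
  | inv w _ h =>
    obtain ⟨φ, hφ, h⟩ := h
    refine ⟨φ.symm, hφ.symm, fun x ↦ φ.injective ?_⟩
    rw [LinearEquiv.apply_symm_apply, h]
    exact congrArg Subtype.val (w.apply_symm_apply x).symm

end WeylGroup

/-! ### From canonical generating sets to bases of a semisimple Lie algebra -/

section CanonicalGenerators

variable {S : Type*} [LieRing S] [LieAlgebra ℂ S] {ι : Type*} [Fintype ι]

/-- Bracketing a linear relation ∑ a_j h_j = 0 with each `x i` gives `C a = 0`. -/
theorem linearIndependent_of_lie_eq_smul {x h : ι → S} {C : Matrix ι ι ℤ} (hC : C.Nondegenerate)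
    (hhx : ∀ i j, ⁅h j, x i⁆ = C i j • x i) (hx : ∀ i, x i ≠ 0) : LinearIndependent ℂ h := by
  classical
  rw [Fintype.linearIndependent_iff]
  intro a ha
  have h1 : (C.map (Int.castRingHom ℂ)).mulVec a = 0 := by
    ext i
    have h2 : ⁅∑ j, a j • h j, x i⁆ = (∑ j, (C i j : ℂ) * a j) • x i := by
      rw [sum_lie, Finset.sum_smul]
      refine Finset.sum_congr rfl fun j _ ↦ ?_
      rw [smul_lie, hhx, mul_comm, mul_smul, Int.cast_smul_eq_zsmul]
    rw [ha, zero_lie, eq_comm, smul_eq_zero, or_iff_left (hx i)] at h2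
    simpa [Matrix.mulVec, dotProduct] using h2
  have h3 : (C.map (Int.castRingHom ℂ)).det ≠ 0 := by
    rw [← RingHom.mapMatrix_apply, ← RingHom.map_det]
    simpa using hC.det_ne_zero
  exact congrFun (Matrix.eq_zero_of_mulVec_eq_zero h3 h1)

/-- Chevalley generators with non-zero `h`-part and non-degenerate Cartan matrix form a basis. -/
theorem exists_lieAlgebraBasis {x y h : ι → S} {C : Matrix ι ι ℤ} (hC : C.Nondegenerate)
    (hC2 : ∀ i, C i i = 2) (hspan : LieSubalgebra.lieSpan ℂ S (Set.range x ∪ Set.range y) = ⊤)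
    (hh : ∀ i, h i ≠ 0) (hhh : ∀ i j, ⁅h i, h j⁆ = 0)
    (hxy : ∀ i, ⁅x i, y i⁆ = h i) (hxy' : ∀ i j, i ≠ j → ⁅x i, y j⁆ = 0)
    (hhx : ∀ i j, ⁅h j, x i⁆ = C i j • x i) (hhy : ∀ i j, ⁅h j, y i⁆ = -(C i j • y i)) :
    ∃ b : LieAlgebra.Basis ι (LieSubalgebra.lieSpan ℂ S (Set.range h)),
      b.A = C ∧ b.e = x ∧ b.f = y ∧ b.h = h := by
  refine ⟨⟨C, h, x, y, rfl, hspan, linearIndependent_of_lie_eq_smul hC hhx fun i h0 ↦ hh i ?_, hC,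
    fun i ↦ ⟨hh i, hxy i, ?_, ?_⟩, hhh, hhx, fun i j ↦ ?_, hxy'⟩, rfl, rfl, rfl, rfl⟩
  · rw [← hxy, h0, zero_lie]
  · rw [hhx, hC2, ofNat_smul_eq_nsmul]
  · rw [hhy, hC2, ofNat_smul_eq_nsmul]
  · rw [hhy, neg_smul]

end CanonicalGenerators

section IsCanonicalGeneratingSet

variable {S : Type u} [LieRing S] [LieAlgebra ℂ S] [FiniteDimensional ℂ S]
  [LieAlgebra.IsSemisimple ℂ S] {r : ℕ} {x y h : Fin r → S}

theorem finrank_eq_of_isCartanSubalgebra (H H' : LieSubalgebra ℂ S) [H.IsCartanSubalgebra]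
    [H'.IsCartanSubalgebra] : finrank ℂ H = finrank ℂ H' := by
  obtain ⟨φ, -, hφ⟩ := exists_isInner_map_isCartanSubalgebra H H'
  have h1 := φ.finrank_map_eq H.toSubmodule
  rw [hφ] at h1
  exact h1.symm

theorem LieAlgebra.Basis.finrank_eq {ι : Type*} [Fintype ι] {H : LieSubalgebra ℂ S}
    (b : LieAlgebra.Basis ι H) : finrank ℂ H = Fintype.card ι := by
  rw [← finrank_span_eq_card b.linInd]
  exact congrArg (fun p : Submodule ℂ S ↦ finrank ℂ p) b.coe_cartan_eq_span

/-- A canonical generating set is a basis of the Lie algebra. -/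
theorem IsCanonicalGeneratingSet.exists_lieAlgebraBasis (G : IsCanonicalGeneratingSet x y h) :
    ∃ b : LieAlgebra.Basis (Fin r) (LieSubalgebra.lieSpan ℂ S (Set.range h)),
      b.e = x ∧ b.f = y ∧ b.h = h := by
  classical
  obtain ⟨C, ⟨H, _, b, e, hCb⟩, hhh, hxy, hhx, hhy⟩ := G.relations
  have hCe : C = b.cartanMatrix.submatrix e e := by ext i j; exact hCb i j
  have hC : C.Nondegenerate := by
    rw [Matrix.nondegenerate_iff_det_ne_zero, hCe, Matrix.det_submatrix_equiv_self,
      ← Matrix.nondegenerate_iff_det_ne_zero]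
    exact b.cartanMatrix_nondegenerate
  have hC2 (i : Fin r) : C i i = 2 := by rw [hCb, b.cartanMatrix_apply_same]
  have hxy1 (i : Fin r) : ⁅x i, y i⁆ = h i := by rw [hxy, if_pos rfl]
  have hxy' (i j : Fin r) (hij : i ≠ j) : ⁅x i, y j⁆ = 0 := by rw [hxy, if_neg hij]
  have hspan : LieSubalgebra.lieSpan ℂ S (Set.range x ∪ Set.range y) = ⊤ := by
    rw [eq_top_iff, ← G.generates, LieSubalgebra.lieSpan_le]
    rintro z (hz | ⟨i, rfl⟩)
    · exact LieSubalgebra.subset_lieSpan hz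
    · rw [← hxy1]
      exact LieSubalgebra.lie_mem _ (LieSubalgebra.subset_lieSpan (Or.inl ⟨i, rfl⟩))
        (LieSubalgebra.subset_lieSpan (Or.inr ⟨i, rfl⟩))
  have hx0 (i : Fin r) (h0 : h i = 0) : x i = 0 := by
    have := hhx i i
    rw [h0, zero_lie, hC2] at this
    simpa [← two_smul ℂ] using (two_smul ℤ (x i)).symm.trans this.symm
  have hy0 (i : Fin r) (h0 : h i = 0) : y i = 0 := by
    have := hhy i i
    rw [h0, zero_lie, hC2, eq_comm, neg_eq_zero] at this
    simpa [← two_smul ℂ] using (two_smul ℤ (y i)).symm.trans this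
  -- The relations alone do not exclude `h i = 0`. This makes `C` block triangular, so the block of
  -- the nonzero `h i` is still nondegenerate and these indices alone give a basis.
  have hCI (i : Fin r) (hi : h i ≠ 0) (j : Fin r) (hj : ¬ h j ≠ 0) : C i j = 0 := by
    have := hhx i j
    rw [not_not.mp hj, zero_lie, ← Int.cast_smul_eq_zsmul ℂ, eq_comm, smul_eq_zero] at this
    refine Int.cast_eq_zero.mp (this.resolve_right fun h0 ↦ hi ?_)
    rw [← hxy1, h0, zero_lie]
  have hI : (C.toSquareBlockProp (fun i ↦ h i ≠ 0)).Nondegenerate := by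
    rw [Matrix.nondegenerate_iff_det_ne_zero] at hC ⊢
    rw [Matrix.twoBlockTriangular_det' C (fun i ↦ h i ≠ 0) hCI] at hC
    exact left_ne_zero_of_mul hC
  obtain ⟨b', -⟩ := _root_.exists_lieAlgebraBasis (x := fun i : {i // h i ≠ 0} ↦ x i)
    (y := fun i : {i // h i ≠ 0} ↦ y i) (h := fun i : {i // h i ≠ 0} ↦ h i) hI (fun i ↦ hC2 i) (by
      rw [eq_top_iff, ← hspan, LieSubalgebra.lieSpan_le]
      rintro z (⟨i, rfl⟩ | ⟨i, rfl⟩)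
      · by_cases h0 : h i = 0
        · rw [hx0 i h0]; exact zero_mem _
        · exact LieSubalgebra.subset_lieSpan (Or.inl ⟨⟨i, h0⟩, rfl⟩)
      · by_cases h0 : h i = 0
        · rw [hy0 i h0]; exact zero_mem _
        · exact LieSubalgebra.subset_lieSpan (Or.inr ⟨⟨i, h0⟩, rfl⟩)) (fun i ↦ i.2)
      (fun i j ↦ hhh i j) (fun i ↦ hxy1 i) (fun i j hij ↦ hxy' i j fun h ↦ hij (Subtype.ext h))
      (fun i j ↦ hhx i j) (fun i j ↦ hhy i j)
  have := b'.isCartanSubalgebra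
  -- Both sides are dimensions of Cartan subalgebras of `S`: one spanned by the nonzero `h i`, the
  -- other being the one in which `C` is the Cartan matrix. Hence no `h i` vanishes.
  have hcard : Fintype.card {i // h i ≠ 0} = Fintype.card (Fin r) := by
    rw [← b'.finrank_eq, finrank_eq_of_isCartanSubalgebra _ H, finrank_eq_card_basis
      b.toCoweightBasis, Fintype.card_congr e]
  have hh (i : Fin r) : h i ≠ 0 := by
    by_contra h0
    exact hcard.not_lt (Fintype.card_subtype_lt (x := i) (not_not.mpr h0))
  obtain ⟨b'', -, h1, h2, h3⟩ := _root_.exists_lieAlgebraBasis hC hC2 hspan hh hhh hxy1 hxy' hhx hhy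
  exact ⟨b'', h1, h2, h3⟩

end IsCanonicalGeneratingSet

theorem IsSl2Triple.coe {L : Type*} [LieRing L] [LieAlgebra ℂ L] {S : LieSubalgebra ℂ L}
    {h e f : S} (t : IsSl2Triple h e f) : IsSl2Triple (h : L) e f :=
  ⟨fun h0 ↦ t.h_ne_zero (Subtype.ext h0), congrArg Subtype.val t.lie_e_f,
    congrArg Subtype.val t.lie_h_e_nsmul, congrArg Subtype.val t.lie_h_f_nsmul⟩

/-! ### Cartan integers via the Killing form -/

section KillingForm

variable {L : Type u} [LieRing L] [LieAlgebra ℂ L] [FiniteDimensional ℂ L]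
  [LieAlgebra.IsSemisimple ℂ L]

theorem IsSl2Triple.killingForm_self_ne_zero (H : LieSubalgebra ℂ L) [H.IsCartanSubalgebra]
    {h e f : L} (t : IsSl2Triple h e f) (hH : h ∈ H) : killingForm ℂ L h h ≠ 0 := by
  obtain ⟨n, hn, h0⟩ := traceForm_sl2_nonneg (M := L) H t hH
  intro hz
  have hn0 : n = 0 := by
    have := hn.symm.trans hz
    exact_mod_cast this
  have hmem : (⟨h, hH⟩ : H) ∈ ⨅ α : Weight ℂ H L, α.ker :=
    (Submodule.mem_iInf _).mpr fun χ ↦ h0 hn0 χ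
  rw [IsKilling.iInf_ker_weight_eq_bot, Submodule.mem_bot] at hmem
  exact t.h_ne_zero (congrArg Subtype.val hmem)

theorem IsSl2Triple.killingForm_self {h e f : L} (t : IsSl2Triple h e f) :
    killingForm ℂ L h h = 2 * killingForm ℂ L e f := by
  nth_rw 2 [← t.lie_e_f]
  rw [← traceForm_apply_lie_apply, t.lie_h_e_smul ℂ, map_smul, LinearMap.smul_apply, smul_eq_mul]

/-- By invariance both κ(z, h) and κ(h, h) are multiples of κ(e, f). Thus Cartan integers depend
only on inner products of the `h`'s, even when these are taken in a larger Lie algebra. -/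
theorem IsSl2Triple.mul_killingForm {h e f z : L} (t : IsSl2Triple h e f) {c : ℂ}
    (hz : ⁅z, e⁆ = c • e) : c * killingForm ℂ L h h = 2 * killingForm ℂ L z h := by
  have h1 : killingForm ℂ L z h = c * killingForm ℂ L e f := by
    rw [← t.lie_e_f, ← traceForm_apply_lie_apply, hz, map_smul, LinearMap.smul_apply, smul_eq_mul]
  rw [h1, t.killingForm_self]
  ring

theorem IsInner.killingForm_apply {φ : L ≃ₗ[ℂ] L} (hφ : IsInner φ) (X Y : L) :
    killingForm ℂ L (φ X) (φ Y) = killingForm ℂ L X Y := by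
  let _ := LieRing.ofAssociativeRing (A := End ℂ L)
  obtain ⟨a, ha⟩ := hφ L (ad ℂ L)
  rw [killingForm_apply_apply, killingForm_apply_apply, ha, ha, ← LinearEquiv.conj_comp,
    LinearMap.trace_conj']

end KillingForm

/-! ### Representations agreeing on the h-part are conjugate -/

section ConjugateRepresentations

attribute [local instance] LieRing.ofAssociativeRing

variable {ι : Type*} [Fintype ι] {S S₁ S₂ : Type*} [LieRing S] [LieAlgebra ℂ S]
  [FiniteDimensional ℂ S] [LieAlgebra.IsSemisimple ℂ S]
  [LieRing S₁] [LieAlgebra ℂ S₁] [FiniteDimensional ℂ S₁] [LieAlgebra.IsSemisimple ℂ S₁]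
  [LieRing S₂] [LieAlgebra ℂ S₂] [FiniteDimensional ℂ S₂] [LieAlgebra.IsSemisimple ℂ S₂]
  {H : LieSubalgebra ℂ S} {H₁ : LieSubalgebra ℂ S₁} {H₂ : LieSubalgebra ℂ S₂}
  {V : Type*} [AddCommGroup V] [Module ℂ V] [FiniteDimensional ℂ V]

theorem LieAlgebra.Basis.hasStableComplements (b : LieAlgebra.Basis ι H) (ρ : S →ₗ⁅ℂ⁆ End ℂ V) :
    HasStableComplements (fun i ↦ ρ (b.e i)) fun i ↦ ρ (b.f i) := by
  intro N hN
  let _ := LieRingModule.compLieHom V ρ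
  have := LieModule.compLieHom (R := ℂ) V ρ
  have hmem (X : S) : ∀ m ∈ N, ρ X m ∈ N := by
    have hX : X ∈ LieSubalgebra.lieSpan ℂ S (Set.range b.e ∪ Set.range b.f) :=
      b.span_ef ▸ LieSubalgebra.mem_top X
    induction hX using LieSubalgebra.lieSpan_induction with
    | mem u hu =>
      obtain ⟨i, rfl⟩ | ⟨i, rfl⟩ := hu
      · exact fun m hm ↦ (hN i m hm).1
      · exact fun m hm ↦ (hN i m hm).2
    | zero => simp
    | add u v _ _ hu hv => exact fun m hm ↦ by rw [map_add]; exact N.add_mem (hu m hm) (hv m hm)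
    | smul c u _ hu => exact fun m hm ↦ by rw [map_smul]; exact N.smul_mem c (hu m hm)
    | lie u v _ _ hu hv =>
        intro m hm
        rw [LieHom.map_lie, LieRing.of_associative_ring_bracket]
        exact N.sub_mem (hu _ (hv m hm)) (hv _ (hu m hm))
  obtain ⟨N', hN'⟩ := LieSubmodule.exists_isCompl_of_isKilling (L := S) (M := V)
    { N with lie_mem := fun {X m} hm ↦ hmem X m hm }
  exact ⟨N'.toSubmodule, fun i m hm ↦ ⟨N'.lie_mem hm, N'.lie_mem hm⟩, hN'⟩

theorem LieAlgebra.Basis.isChevalleyFamily [DecidableEq ι] (b : LieAlgebra.Basis ι H)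
    (ρ : S →ₗ⁅ℂ⁆ End ℂ V) :
    IsChevalleyFamily (fun i j ↦ (b.A i j : ℂ)) (fun i ↦ ρ (b.e i)) (fun i ↦ ρ (b.f i))
      fun i ↦ ρ (b.h i) := by
  have key (X Y : S) (m : V) : ρ X (ρ Y m) = ρ Y (ρ X m) + ρ ⁅X, Y⁆ m := by
    rw [LieHom.map_lie, LieRing.of_associative_ring_bracket]
    simp
  refine ⟨fun i j m ↦ ?_, fun i j m ↦ ?_, fun i j m ↦ ?_, fun i j m ↦ ?_⟩
  · rw [key, b.lie_h_h, map_zero, LinearMap.zero_apply, add_zero]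
  · rw [key]
    split_ifs with hij
    · subst hij
      rw [(b.sl2 i).lie_e_f]
    · rw [b.lie_e_f_ne i j hij, map_zero, LinearMap.zero_apply]
  · rw [key, b.lie_h_e, map_zsmul, Int.cast_smul_eq_zsmul]
    rfl
  · rw [key, b.lie_h_f, map_zsmul, Int.cast_smul_eq_zsmul, sub_eq_add_neg, ← neg_smul]
    rfl

/-- Two representations of semisimple Lie algebras with the same Cartan matrix are conjugate as
soon as they agree on the `h`-parts of the Chevalley generators. -/
theorem LieAlgebra.Basis.exists_conj_eq (b₁ : LieAlgebra.Basis ι H₁) (b₂ : LieAlgebra.Basis ι H₂)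
    (hA : b₁.A = b₂.A) (ρ₁ : S₁ →ₗ⁅ℂ⁆ End ℂ V) (ρ₂ : S₂ →ₗ⁅ℂ⁆ End ℂ V)
    (hρ : ∀ i, ρ₁ (b₁.h i) = ρ₂ (b₂.h i)) :
    ∃ a : V ≃ₗ[ℂ] V, ∀ i, a.conj (ρ₁ (b₁.e i)) = ρ₂ (b₂.e i) ∧
      a.conj (ρ₁ (b₁.f i)) = ρ₂ (b₂.f i) := by
  classical
  have hdet : IsUnit (b₁.A.map (Int.castRingHom ℂ)) := by
    rw [Matrix.isUnit_iff_isUnit_det, isUnit_iff_ne_zero, ← RingHom.mapMatrix_apply,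
      ← RingHom.map_det]
    simpa using b₁.nondegen.det_ne_zero
  -- The coefficients of the grading operator that gives every simple root vector degree one.
  obtain ⟨a, ha⟩ := (Matrix.mulVec_surjective_iff_isUnit.mpr hdet) 1
  have h1 := b₁.isChevalleyFamily ρ₁
  have h2 := b₂.isChevalleyFamily ρ₂
  rw [← hA] at h2
  obtain ⟨e, he, he'⟩ := h1.exists_equiv h2 (a := a) (fun i ↦ by
      simpa [Matrix.mulVec, dotProduct] using congrFun ha i) (b₁.hasStableComplements ρ₁)
    (b₂.hasStableComplements ρ₂) (fun χ ↦ by rw [funext hρ])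
  refine ⟨e, fun i ↦ ⟨?_, ?_⟩⟩
  · ext m
    rw [LinearEquiv.conj_apply_apply, he, LinearEquiv.apply_symm_apply]
  · ext m
    rw [LinearEquiv.conj_apply_apply, he', LinearEquiv.apply_symm_apply]

end ConjugateRepresentations

/-! ### Weyl-conjugate h-parts give linearly equivalent subalgebras -/

section LinearEquivalence

attribute [local instance] LieRing.ofAssociativeRing

theorem LieSubalgebra.map_eq_lieSpan {ι L : Type*} [Finite ι] [LieRing L] [LieAlgebra ℂ L]
    {L' : Type*} [LieRing L'] [LieAlgebra ℂ L'] {S : LieSubalgebra ℂ L} {H : LieSubalgebra ℂ S}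
    (b : LieAlgebra.Basis ι H) (f : L →ₗ⁅ℂ⁆ L') : S.map f = LieSubalgebra.lieSpan ℂ L'
      (Set.range (fun i ↦ f (b.e i)) ∪ Set.range fun i ↦ f (b.f i)) := by
  have h1 : S.map f = (⊤ : LieSubalgebra ℂ S).map (f.comp S.incl) := by
    ext z
    simp [LieSubalgebra.mem_map]
  rw [h1, ← b.span_ef, LieSubalgebra.map_lieSpan, Set.image_union, ← Set.range_comp,
    ← Set.range_comp]
  rfl

variable {L : Type u} [LieRing L] [LieAlgebra ℂ L] [FiniteDimensional ℂ L]
  [LieAlgebra.IsSemisimple ℂ L]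

/-- Semisimple subalgebras are linearly equivalent if the `h`-parts of Chevalley generators are
conjugate under the Weyl group. -/
theorem linearlyEquivalent_of_mem_cartanWeylGroup (H : LieSubalgebra ℂ L) [H.IsCartanSubalgebra]
    {S₁ S₂ : LieSubalgebra ℂ L} [LieAlgebra.IsSemisimple ℂ S₁] [LieAlgebra.IsSemisimple ℂ S₂]
    {ι : Type*} [Fintype ι] {H₁ : LieSubalgebra ℂ S₁} {H₂ : LieSubalgebra ℂ S₂}
    (b₁ : LieAlgebra.Basis ι H₁) (b₂ : LieAlgebra.Basis ι H₂)
    (hb₁ : ∀ i, (b₁.h i : L) ∈ H) (hb₂ : ∀ i, (b₂.h i : L) ∈ H) {w : H ≃ₗ[ℂ] H}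
    (hw : w ∈ cartanWeylGroup H) (hwb : ∀ i, w ⟨b₁.h i, hb₁ i⟩ = ⟨b₂.h i, hb₂ i⟩) :
    LinearlyEquivalent S₁ S₂ := by
  obtain ⟨φ, hφ, hφw⟩ := exists_isInner_of_mem_cartanWeylGroup H hw
  have hφb (i : ι) : φ (b₁.h i) = b₂.h i := by
    rw [hφw ⟨b₁.h i, hb₁ i⟩, hwb]
  have t₁ (i : ι) : IsSl2Triple (b₁.h i : L) (b₁.e i) (b₁.f i) := (b₁.sl2 i).coe
  have t₂ (i : ι) : IsSl2Triple (b₂.h i : L) (b₂.e i) (b₂.f i) := (b₂.sl2 i).coe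
  -- Each entry is 2κ(h_j, h_i)/κ(h_i, h_i) for the Killing form of `L`, which `φ` preserves.
  have hA : b₁.A = b₂.A := by
    ext i j
    have h1 : ⁅(b₁.h j : L), (b₁.e i : L)⁆ = (b₁.A i j : ℂ) • (b₁.e i : L) := by
      rw [Int.cast_smul_eq_zsmul]
      exact congrArg Subtype.val (b₁.lie_h_e i j)
    have h2 : ⁅(b₂.h j : L), (b₂.e i : L)⁆ = (b₂.A i j : ℂ) • (b₂.e i : L) := by
      rw [Int.cast_smul_eq_zsmul]
      exact congrArg Subtype.val (b₂.lie_h_e i j)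
    have h3 := (t₁ i).mul_killingForm h1
    have h4 := (t₂ i).mul_killingForm h2
    rw [← hφb, ← hφb, hφ.killingForm_apply, hφ.killingForm_apply, ← h3] at h4
    exact_mod_cast (mul_right_cancel₀ ((t₁ i).killingForm_self_ne_zero H (hb₁ i)) h4).symm
  intro V _ _ _ ρ
  obtain ⟨a, ha⟩ := hφ V ρ
  obtain ⟨e, he⟩ := b₁.exists_conj_eq b₂ hA
    ((a.lieConj : End ℂ V →ₗ⁅ℂ⁆ End ℂ V).comp (ρ.comp S₁.incl)) (ρ.comp S₂.incl) (fun i ↦ by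
      rw [LieHom.comp_apply, LieHom.comp_apply, LieHom.comp_apply, LieSubalgebra.coe_incl,
        LieSubalgebra.coe_incl, ← hφb, ha]
      rfl)
  refine ⟨a.trans e, ?_⟩
  have hcomp : (S₁.map ρ).map ((a.trans e).lieConj : End ℂ V →ₗ⁅ℂ⁆ End ℂ V) =
      S₁.map (((a.trans e).lieConj : End ℂ V →ₗ⁅ℂ⁆ End ℂ V).comp ρ) := by
    ext z
    simp [LieSubalgebra.mem_map]
  rw [hcomp, LieSubalgebra.map_eq_lieSpan b₁, LieSubalgebra.map_eq_lieSpan b₂]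
  congr 2
  · exact congrArg Set.range (funext fun i ↦ (he i).1)
  · exact congrArg Set.range (funext fun i ↦ (he i).2)

end LinearEquivalence

/-! ### Integral elements, dominance and bases -/

section IntegralElements

variable {L : Type u} [LieRing L] [LieAlgebra ℂ L] [FiniteDimensional ℂ L]
  [LieAlgebra.IsSemisimple ℂ L] {H : LieSubalgebra ℂ L} [H.IsCartanSubalgebra]

/-- An element of a Cartan subalgebra is integral if all roots take integral values on it. -/
def IsIntegralElement (x : H) : Prop := ∀ α : Weight ℂ H L, ∃ n : ℤ, α x = n

theorem killingForm_eq_sum_root (x y : H) :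
    killingForm ℂ L x y = ∑ α ∈ H.root, α x * α y := by
  have := congrArg (fun B ↦ B x y) (IsKilling.restrict_killingForm_eq_sum (K := ℂ) (L := L) (H := H))
  simp only [LinearMap.sum_apply, LinearMap.smulRight_apply, LinearMap.smul_apply] at this
  exact this

namespace IsIntegralElement

variable {x y : H}

theorem add (hx : IsIntegralElement x) (hy : IsIntegralElement y) : IsIntegralElement (x + y) :=
  fun α ↦ by
    obtain ⟨n, hn⟩ := hx α
    obtain ⟨m, hm⟩ := hy α
    exact ⟨n + m, by
      rw [← Weight.toLinear_apply, map_add, Weight.toLinear_apply, Weight.toLinear_apply, hn, hm]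
      push_cast; rfl⟩

theorem zsmul (hx : IsIntegralElement x) (k : ℤ) : IsIntegralElement (k • x) := fun α ↦ by
  obtain ⟨n, hn⟩ := hx α
  exact ⟨k * n, by
    rw [← Weight.toLinear_apply, map_zsmul, Weight.toLinear_apply, hn, zsmul_eq_mul]; push_cast; rfl⟩

theorem zero : IsIntegralElement (0 : H) := fun α ↦ ⟨0, by
  rw [← Weight.toLinear_apply, map_zero, Int.cast_zero]⟩

theorem sum {ι : Type*} (s : Finset ι) (f : ι → H) (h : ∀ i ∈ s, IsIntegralElement (f i)) :
    IsIntegralElement (∑ i ∈ s, f i) := by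
  classical
  induction s using Finset.induction_on with
  | empty => exact zero
  | insert a s ha ih =>
    rw [Finset.sum_insert ha]
    exact (h a (Finset.mem_insert_self a s)).add
      (ih fun i hi ↦ h i (Finset.mem_insert_of_mem hi))

theorem neg (hx : IsIntegralElement x) : IsIntegralElement (-x) := by
  simpa using hx.zsmul (-1)

theorem sub (hx : IsIntegralElement x) (hy : IsIntegralElement y) : IsIntegralElement (x - y) := by
  rw [sub_eq_add_neg]
  exact hx.add hy.neg

theorem of_isSl2Triple {h e f : L} (t : IsSl2Triple h e f) (hH : h ∈ H) :
    IsIntegralElement (⟨h, hH⟩ : H) := fun α ↦ by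
  obtain ⟨v, hv, hv0⟩ := α.exists_ne_zero
  exact t.exists_int_of_lie_eq_smul hv0 (IsKilling.lie_eq_smul_of_mem_rootSpace hv ⟨h, hH⟩)

/-- κ(x, x) is the sum of the squares of the integers α(x), and the roots separate points of `H`.
Integral elements thus see a positive definite form without passing to a real form of `H`. -/
theorem killingForm_self (hx : IsIntegralElement x) :
    ∃ n : ℕ, killingForm ℂ L x x = n ∧ (n = 0 → x = 0) := by
  choose a ha using hx
  refine ⟨(∑ α ∈ H.root, a α * a α).toNat, ?_, fun h0 ↦ ?_⟩
  · have h1 : ((∑ α ∈ H.root, a α * a α).toNat : ℤ) = ∑ α ∈ H.root, a α * a α :=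
      Int.toNat_of_nonneg (Finset.sum_nonneg fun α _ ↦ mul_self_nonneg _)
    rw [← Int.cast_natCast, h1, killingForm_eq_sum_root]
    simp [ha]
  · have h1 : ∑ α ∈ H.root, a α * a α = 0 :=
      le_antisymm (Int.toNat_eq_zero.mp h0) (Finset.sum_nonneg fun α _ ↦ mul_self_nonneg _)
    rw [Finset.sum_eq_zero_iff_of_nonneg fun α _ ↦ mul_self_nonneg _] at h1
    have hmem : x ∈ ⨅ α : Weight ℂ H L, α.ker := (Submodule.mem_iInf _).mpr fun α ↦ by
      change α x = 0
      by_cases hα : α.IsZero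
      · exact congrFun hα x
      · rw [ha, mul_self_eq_zero.mp (h1 α ((Finset.mem_filter_univ _).mpr hα)), Int.cast_zero]
    rwa [IsKilling.iInf_ker_weight_eq_bot, Submodule.mem_bot] at hmem

end IsIntegralElement

theorem isIntegralElement_coroot (α : Weight ℂ H L) : IsIntegralElement (IsKilling.coroot α) :=
  fun _ ↦ ⟨_, IsKilling.apply_coroot_eq_cast ..⟩

section WeylGroup

variable {w : H ≃ₗ[ℂ] H}

theorem coreflection_mem_cartanWeylGroup (α : H.root) :
    (IsKilling.rootSystem H).coreflection α ∈ cartanWeylGroup H :=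
  Subgroup.subset_closure ⟨α, rfl⟩

theorem killingForm_cartanWeylGroup (hw : w ∈ cartanWeylGroup H) (x y : H) :
    killingForm ℂ L (w x) (w y) = killingForm ℂ L x y := by
  obtain ⟨φ, hφ, h⟩ := exists_isInner_of_mem_cartanWeylGroup H hw
  rw [← h, ← h, hφ.killingForm_apply]

/-- The group permutes the finitely many coroots, and these span `H`. -/
theorem finite_cartanWeylGroup : (cartanWeylGroup H : Set (H ≃ₗ[ℂ] H)).Finite := by
  let P := IsKilling.rootSystem H
  have hmaps (w : cartanWeylGroup H) : Set.MapsTo w.1 (Set.range P.coroot) (Set.range P.coroot) ∧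
      Set.MapsTo w.1.symm (Set.range P.coroot) (Set.range P.coroot) := by
    obtain ⟨w, hw⟩ := w
    induction hw using Subgroup.closure_induction with
    | mem w hw =>
      obtain ⟨α, rfl⟩ := hw
      exact ⟨P.mapsTo_coreflection_coroot α, P.mapsTo_coreflection_coroot α⟩
    | one => exact ⟨Set.mapsTo_id _, Set.mapsTo_id _⟩
    | mul w w' _ _ h h' => exact ⟨h.1.comp h'.1, h'.2.comp h.2⟩
    | inv w _ h => exact ⟨h.2, h.1⟩
  have hinj : Function.Injective fun w : cartanWeylGroup H ↦
      fun c : Set.range P.coroot ↦ (⟨w.1 c, (hmaps w).1 c.2⟩ : Set.range P.coroot) := by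
    intro w w' h
    refine Subtype.ext (LinearEquiv.toLinearMap_injective (LinearMap.ext_on_range
      (v := P.coroot) RootPairing.IsRootSystem.span_coroot_eq_top fun α ↦ ?_))
    exact congrArg Subtype.val (congrFun h ⟨P.coroot α, α, rfl⟩)
  have := Finite.of_injective _ hinj
  exact Set.toFinite _

theorem IsIntegralElement.cartanWeylGroup_apply (hw : w ∈ cartanWeylGroup H) {x : H}
    (hx : IsIntegralElement x) : IsIntegralElement (w x) := by
  suffices IsIntegralElement (w x) ∧ IsIntegralElement (w.symm x) from this.1
  induction hw using Subgroup.closure_induction generalizing x with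
  | mem w hw =>
    obtain ⟨α, rfl⟩ := hw
    have h : IsIntegralElement ((IsKilling.rootSystem H).coreflection α x) := by
      obtain ⟨n, hn⟩ := hx α
      rw [RootPairing.coreflection_apply]
      have h1 : (IsKilling.rootSystem H).root' α x = n := hn
      rw [h1, Int.cast_smul_eq_zsmul]
      exact hx.sub ((isIntegralElement_coroot α.1).zsmul n)
    exact ⟨h, h⟩
  | one => exact ⟨hx, hx⟩
  | mul w w' _ _ h h' => exact ⟨(h (h' hx).1).1, (h' (h hx).2).2⟩
  | inv w _ h => exact ⟨(h hx).2, (h hx).1⟩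

/-- Every integral element is conjugate to a dominant one under the Weyl group. -/
theorem exists_mem_cartanWeylGroup_dominant {p x : H} (hp : IsIntegralElement p)
    (hx : IsIntegralElement x) : ∃ w ∈ cartanWeylGroup H, ∀ α : Weight ℂ H L,
      0 < (α p).re → 0 ≤ (α (w x)).re := by
  -- Maximise κ(p, w x). Reflecting in `α` subtracts α(w x)κ(p, h) with κ(p, h) = α(p)κ(h, h)/2 > 0,
  -- so maximality forces α(w x) ≥ 0.
  obtain ⟨w, hw, hmax⟩ := Set.exists_max_image (cartanWeylGroup H : Set (H ≃ₗ[ℂ] H))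
    (fun w ↦ (killingForm ℂ L p (w x)).re) finite_cartanWeylGroup ⟨1, one_mem _⟩
  refine ⟨w, hw, fun α hα ↦ ?_⟩
  obtain ⟨n, hn⟩ := hp α
  obtain ⟨m, hm⟩ := hx.cartanWeylGroup_apply hw α
  have hα0 : α.IsNonZero := fun h0 ↦ by
    have : α p = 0 := congrFun h0 p
    simp [this] at hα
  obtain ⟨h, e, f, t, he, hf⟩ := IsKilling.exists_isSl2Triple_of_weight_isNonZero hα0
  have hh := t.h_eq_coroot hα0 he hf
  obtain ⟨k, hk, hk0⟩ := (isIntegralElement_coroot α).killingForm_self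
  have hkpos : 0 < k := by
    refine Nat.pos_of_ne_zero fun h0 ↦ t.h_ne_zero ?_
    rw [hh, hk0 h0]; rfl
  have h1 := t.mul_killingForm (z := (p : L)) (c := α p)
    (IsKilling.lie_eq_smul_of_mem_rootSpace he p)
  have h2 := hmax _ (mul_mem (coreflection_mem_cartanWeylGroup
    ⟨α, (Finset.mem_filter_univ _).mpr hα0⟩) hw)
  have h3 : ((((IsKilling.rootSystem H).coreflection
      ⟨α, (Finset.mem_filter_univ _).mpr hα0⟩ * w) x : H) : L) = w x - α (w x) • h := by
    rw [LinearEquiv.mul_apply, RootPairing.coreflection_apply, hh]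
    rfl
  rw [h3, map_sub, map_smul, Complex.sub_re, sub_le_self_iff] at h2
  rw [hn, Complex.intCast_re] at hα
  rw [hh, hk, hn] at h1
  have h4 : killingForm ℂ L p h = ((n * k / 2 : ℝ) : ℂ) := by
    rw [hh]
    push_cast
    linear_combination -h1 / 2
  rw [h4, hm, smul_eq_mul, ← Complex.ofReal_intCast, ← Complex.ofReal_mul, Complex.ofReal_re] at h2
  rw [hm, Complex.intCast_re]
  have h5 : (0 : ℝ) < n * k / 2 := by positivity
  exact nonneg_of_mul_nonneg_left h2 h5

end WeylGroup

section Base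

open RootPairing

variable (b : (IsKilling.rootSystem H).Base)

/-- There is an element on which all simple roots take the value `1`. -/
theorem RootPairing.Base.exists_root_eq_one : ∃ p : H, ∀ α ∈ b.support, α.1 p = 1 := by
  classical
  refine ⟨(Module.evalEquiv ℂ H).symm (∑ i, b.toWeightBasis.coord i), fun α hα ↦ ?_⟩
  have h1 := Module.apply_evalEquiv_symm_apply (R := ℂ) (M := H) (α.1.toLinear)
    (∑ i, b.toWeightBasis.coord i)
  rw [Weight.toLinear_apply] at h1
  rw [h1]
  have h2 : α.1.toLinear = b.toWeightBasis ⟨α, hα⟩ := by simp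
  rw [h2, LinearMap.sum_apply, Finset.sum_eq_single ⟨α, hα⟩
    (fun i _ hi ↦ by rw [Basis.coord_apply, Basis.repr_self, Finsupp.single_eq_of_ne hi])
    fun h ↦ (h (Finset.mem_univ _)).elim, Basis.coord_apply, Basis.repr_self,
    Finsupp.single_eq_same]

theorem RootPairing.Base.exists_nat_combination (α : H.root) :
    ∃ n : H.root → ℕ, (∀ x : H, α.1 x = ∑ β ∈ b.support, n β * β.1 x) ∨
      ∀ x : H, α.1 x = -∑ β ∈ b.support, n β * β.1 x := by
  have key (f : Dual ℂ H) (hf : f ∈ AddSubmonoid.closure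
      ((IsKilling.rootSystem H).root '' b.support)) : ∃ n : H.root → ℕ, ∀ x : H, f x =
        ∑ β ∈ b.support, n β * β.1 x := by
    induction hf using AddSubmonoid.closure_induction with
    | mem f hf =>
      classical
      obtain ⟨β, hβ, rfl⟩ := hf
      exact ⟨Pi.single β 1, fun x ↦ by
        rw [Finset.sum_eq_single β (fun γ _ hγ ↦ by simp [hγ]) fun h ↦ (h hβ).elim]
        simp⟩
    | zero => exact ⟨0, fun x ↦ by simp⟩
    | add f g _ _ hf hg =>
      obtain ⟨n, hn⟩ := hf
      obtain ⟨m, hm⟩ := hg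
      exact ⟨n + m, fun x ↦ by
        rw [LinearMap.add_apply, hn, hm, ← Finset.sum_add_distrib]
        exact Finset.sum_congr rfl fun β _ ↦ by simp [add_mul]⟩
  obtain h | h := b.root_mem_or_neg_mem α
  · obtain ⟨n, hn⟩ := key _ h
    exact ⟨n, Or.inl hn⟩
  · obtain ⟨n, hn⟩ := key _ h
    exact ⟨n, Or.inr fun x ↦ neg_eq_iff_eq_neg.mp (hn x)⟩

variable {b}

theorem RootPairing.Base.isIntegralElement {p : H} (hp : ∀ α ∈ b.support, α.1 p = 1) :
    IsIntegralElement p := fun α ↦ by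
  by_cases hα : α.IsZero
  · exact ⟨0, by rw [Int.cast_zero]; exact congrFun hα p⟩
  obtain ⟨n, h | h⟩ := b.exists_nat_combination ⟨α, (Finset.mem_filter_univ _).mpr hα⟩
  · refine ⟨∑ β ∈ b.support, n β, ?_⟩
    rw [h p, Finset.sum_congr rfl fun β hβ ↦ by rw [hp β hβ, mul_one]]
    simp
  · refine ⟨-∑ β ∈ b.support, n β, ?_⟩
    rw [h p, Finset.sum_congr rfl fun β hβ ↦ by rw [hp β hβ, mul_one]]
    simp

/-- The value of a root at `p` is, up to sign, its height with respect to the base. -/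
theorem RootPairing.Base.re_apply_ne_zero {p : H} (hp : ∀ α ∈ b.support, α.1 p = 1)
    (α : H.root) : (α.1 p).re ≠ 0 := by
  have hα : α.1.IsNonZero := (Finset.mem_filter_univ _).mp α.2
  obtain ⟨n, h⟩ := b.exists_nat_combination α
  have hsum : ∑ β ∈ b.support, (n β : ℂ) * β.1 p = ((∑ β ∈ b.support, n β : ℕ) : ℂ) := by
    rw [Finset.sum_congr rfl fun β hβ ↦ by rw [hp β hβ, mul_one]]
    simp
  have hne : ∑ β ∈ b.support, n β ≠ 0 := by
    intro h0
    rw [Finset.sum_eq_zero_iff] at h0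
    refine hα (funext fun x ↦ ?_)
    have hz : ∑ β ∈ b.support, (n β : ℂ) * β.1 x = 0 :=
      Finset.sum_eq_zero fun β hβ ↦ by rw [h0 β hβ]; simp
    obtain h | h := h
    · exact (h x).trans hz
    · exact (h x).trans (by rw [hz, neg_zero]; rfl)
  obtain h | h := h
  · rw [h p, hsum, Complex.natCast_re]
    exact_mod_cast hne
  · rw [h p, hsum, Complex.neg_re, Complex.natCast_re]
    exact neg_ne_zero.mpr (by exact_mod_cast hne)

/-- A base is determined by an element on which its members take the value `1`, among the bases
that are non-negative on this element. -/
theorem RootPairing.Base.support_subset {b' : (IsKilling.rootSystem H).Base} {p : H}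
    (hp : ∀ α ∈ b'.support, α.1 p = 1) (hb : ∀ α ∈ b.support, 0 ≤ (α.1 p).re) :
    b'.support ⊆ b.support := by
  intro γ hγ
  have hint := RootPairing.Base.isIntegralElement hp
  have hone (β : H.root) (hβ : β ∈ b.support) : ∃ k : ℕ, 1 ≤ k ∧ β.1 p = k := by
    obtain ⟨k, hk⟩ := hint β
    have h0 := hb β hβ
    have h1 := RootPairing.Base.re_apply_ne_zero hp β
    rw [hk, Complex.intCast_re] at h0 h1
    have h2 : 0 ≤ k := by exact_mod_cast h0
    have h3 : k ≠ 0 := by exact_mod_cast h1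
    exact ⟨k.toNat, by omega, by rw [hk, ← Int.cast_natCast, Int.toNat_of_nonneg h2]⟩
  choose! k hk hk' using hone
  obtain ⟨n, h⟩ := b.exists_nat_combination γ
  have hsum : ∑ β ∈ b.support, (n β : ℂ) * β.1 p = ((∑ β ∈ b.support, n β * k β : ℕ) : ℂ) := by
    push_cast
    exact Finset.sum_congr rfl fun β hβ ↦ by rw [hk' β hβ]
  obtain h | h := h
  · have h1 : ∑ β ∈ b.support, n β * k β = 1 := by
      have := (h p).symm.trans (hp γ hγ)
      rw [hsum] at this
      exact_mod_cast this
    obtain ⟨β, hβ, hβ0⟩ := Finset.exists_ne_zero_of_sum_ne_zero (by rw [h1]; exact one_ne_zero)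
    have h2 : ∀ δ ∈ b.support, δ ≠ β → n δ = 0 := by
      classical
      intro δ hδ hne
      have h3 := Finset.sum_le_sum_of_subset (f := fun β ↦ n β * k β)
        (show {δ, β} ⊆ b.support by simp [Finset.insert_subset_iff, hδ, hβ])
      rw [Finset.sum_pair hne, h1] at h3
      have h4 := Nat.pos_of_ne_zero hβ0
      have h5 : n δ * k δ = 0 := by omega
      exact (mul_eq_zero.mp h5).resolve_right (by have := hk δ hδ; omega)
    have h3 : n β = 1 := by
      rw [Finset.sum_eq_single β (fun δ hδ hne ↦ by rw [h2 δ hδ hne, zero_mul])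
        fun h ↦ (h hβ).elim] at h1
      exact Nat.eq_one_of_mul_eq_one_right h1
    have h4 : γ = β := by
      refine Subtype.ext (DFunLike.ext _ _ fun x ↦ ?_)
      rw [h x, Finset.sum_eq_single β (fun δ hδ hne ↦ by rw [h2 δ hδ hne]; simp)
        fun h ↦ (h hβ).elim, h3]
      simp
    exact h4 ▸ hβ
  · exfalso
    have := (h p).symm.trans (hp γ hγ)
    rw [hsum] at this
    have h2 := congrArg Complex.re this
    rw [Complex.neg_re, Complex.natCast_re, Complex.one_re] at h2
    have h3 : (0 : ℝ) ≤ (∑ β ∈ b.support, n β * k β : ℕ) := Nat.cast_nonneg _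
    linarith

end Base

end IntegralElements

/-! ### Multilinear and determinant forms as representations -/

section MultilinearForms

attribute [local instance] LieRing.ofAssociativeRing

variable {L E ι : Type*} [LieRing L] [LieAlgebra ℂ L] [AddCommGroup E] [Module ℂ E] [Fintype ι]
  [DecidableEq ι]

theorem LieHom.apply_apply_eq (ρ : L →ₗ⁅ℂ⁆ End ℂ E) (X Y : L) (m : E) :
    ρ X (ρ Y m) = ρ Y (ρ X m) + ρ ⁅X, Y⁆ m := by
  rw [LieHom.map_lie, LieRing.of_associative_ring_bracket]
  simp

/-- The action of an endomorphism on multilinear forms, as a derivation. -/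
def formDerivation (A : End ℂ E) : End ℂ (MultilinearMap ℂ (fun _ : ι ↦ E) ℂ) :=
  -∑ i, MultilinearMap.compLinearMapₗ (Function.update (fun _ ↦ LinearMap.id) i A)

theorem formDerivation_apply (A : End ℂ E) (f : MultilinearMap ℂ (fun _ : ι ↦ E) ℂ) (u : ι → E) :
    formDerivation A f u = -∑ i, f (Function.update u i (A (u i))) := by
  simp only [formDerivation, LinearMap.neg_apply, LinearMap.sum_apply, neg_apply,
    sum_apply]
  congr 1
  refine Finset.sum_congr rfl fun i _ ↦ ?_
  rw [MultilinearMap.compLinearMapₗ_apply, MultilinearMap.compLinearMap_apply]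
  congr 1
  funext j
  by_cases h : j = i
  · subst h; simp
  · simp [h]

/-- In the commutator the terms acting on two different slots cancel; only those acting twice on one
slot remain. -/
theorem formDerivation_lie (A B : End ℂ E) :
    formDerivation (ι := ι) (A * B - B * A) =
      formDerivation A * formDerivation B - formDerivation B * formDerivation A := by
  ext f u
  rw [LinearMap.sub_apply, sub_apply, End.mul_apply, End.mul_apply]
  simp only [formDerivation_apply, Finset.sum_neg_distrib, neg_neg]
  rw [Finset.sum_comm (s := Finset.univ) (t := Finset.univ) (f := fun i j ↦
    f (Function.update (Function.update u i (B (u i))) j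
      (A (Function.update u i (B (u i)) j)))), ← Finset.sum_sub_distrib,
    ← Finset.sum_neg_distrib]
  refine Finset.sum_congr rfl fun i _ ↦ ?_
  rw [← Finset.sum_sub_distrib, Finset.sum_eq_single i]
  · simp only [Function.update_self, Function.update_idem, LinearMap.sub_apply, End.mul_apply]
    rw [f.map_update_sub]
    ring
  · intro j _ hj
    rw [Function.update_of_ne hj, Function.update_of_ne hj.symm, Function.update_comm hj, sub_self]
  · simp

/-- The representation on multilinear forms induced by a representation. -/
def formRep (τ : L →ₗ⁅ℂ⁆ End ℂ E) : L →ₗ⁅ℂ⁆ End ℂ (MultilinearMap ℂ (fun _ : ι ↦ E) ℂ) where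
  toFun X := formDerivation (τ X)
  map_add' X Y := by
    ext f u
    simp [formDerivation_apply, MultilinearMap.map_update_add, Finset.sum_add_distrib, add_comm]
  map_smul' c X := by
    ext f u
    simp [formDerivation_apply, MultilinearMap.map_update_smul, Finset.mul_sum]
  map_lie' {X Y} := by
    rw [LieHom.map_lie, LieRing.of_associative_ring_bracket, formDerivation_lie,
      LieRing.of_associative_ring_bracket]

theorem formRep_apply (τ : L →ₗ⁅ℂ⁆ End ℂ E) (X : L) (f : MultilinearMap ℂ (fun _ : ι ↦ E) ℂ)
    (u : ι → E) : formRep τ X f u = -∑ i, f (Function.update u i (τ X (u i))) :=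
  formDerivation_apply ..

/-- Both sides are the trace of adj(M)N, the derivative of the determinant at `M` in direction `N`.
It converts an action on the arguments of a determinant form into one on its functionals. -/
theorem Matrix.sum_det_updateRow_eq_sum_det_updateCol (M N : Matrix ι ι ℂ) :
    ∑ i, (M.updateRow i (N i)).det = ∑ j, (M.updateCol j fun i ↦ N i j).det := by
  have h1 (i : ι) : (M.updateRow i (N i)).det = ∑ j, M.adjugate j i * N i j := by
    rw [← Matrix.cramer_transpose_apply, Matrix.cramer_eq_adjugate_mulVec, ← Matrix.adjugate_transpose]
    rfl
  have h2 (j : ι) : (M.updateCol j fun i ↦ N i j).det = ∑ i, M.adjugate j i * N i j := by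
    rw [← Matrix.cramer_apply, Matrix.cramer_eq_adjugate_mulVec]
    rfl
  simp_rw [h1, h2]
  exact Finset.sum_comm

/-- The alternating form given by the determinant of a family of functionals. -/
def detForm (ξ : ι → Dual ℂ E) : MultilinearMap ℂ (fun _ : ι ↦ E) ℂ :=
  (Matrix.detRowAlternating (R := ℂ) (n := ι)).toMultilinearMap.compLinearMap
    fun _ ↦ LinearMap.pi ξ

theorem detForm_apply (ξ : ι → Dual ℂ E) (u : ι → E) :
    detForm ξ u = (Matrix.of fun b a ↦ ξ a (u b)).det := rfl

theorem formRep_detForm (τ : L →ₗ⁅ℂ⁆ End ℂ E) (X : L) (ξ : ι → Dual ℂ E) :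
    formRep τ X (detForm ξ) = ∑ a, detForm (Function.update ξ a (-(ξ a ∘ₗ τ X))) := by
  ext u
  rw [formRep_apply, sum_apply]
  simp only [detForm_apply]
  rw [← Finset.sum_neg_distrib]
  set M : Matrix ι ι ℂ := Matrix.of fun b a ↦ ξ a (u b) with hM
  refine Eq.trans (Finset.sum_congr rfl fun i _ ↦ ?_) ((Matrix.sum_det_updateRow_eq_sum_det_updateCol
    M (fun b a ↦ -ξ a (τ X (u b)))).trans (Finset.sum_congr rfl fun i _ ↦ ?_))
  · have h := Matrix.det_updateRow_smul M i (-1) (fun a ↦ ξ a (τ X (u i)))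
    rw [neg_one_mul] at h
    trans -(M.updateRow i fun a ↦ ξ a (τ X (u i))).det
    · congr 2
      ext b a
      by_cases hb : b = i
      · subst hb; simp
      · simp [hb, hM]
    · rw [← h]
      congr 2
      ext a
      simp
  · congr 1
    ext b a
    by_cases ha : a = i
    · subst ha; simp
    · simp [ha, hM]

theorem detForm_update_smul (ξ : ι → Dual ℂ E) (a : ι) (c : ℂ) (η : Dual ℂ E) :
    detForm (Function.update ξ a (c • η)) = c • detForm (Function.update ξ a η) := by
  ext u
  rw [smul_apply, detForm_apply, detForm_apply, smul_eq_mul]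
  have key (η : Dual ℂ E) : (Matrix.of fun b a' ↦ Function.update ξ a η a' (u b)) =
      (Matrix.of fun b a' ↦ ξ a' (u b)).updateCol a fun b ↦ η (u b) := by
    ext b a'
    by_cases h : a' = a
    · subst h; simp
    · simp [h]
  rw [key, key, ← Matrix.det_updateCol_smul]
  rfl

theorem detForm_update_smul_self (ξ : ι → Dual ℂ E) (a : ι) (c : ℂ) :
    detForm (Function.update ξ a (c • ξ a)) = c • detForm ξ := by
  rw [detForm_update_smul, Function.update_eq_self]

theorem detForm_update_smul_of_ne (ξ : ι → Dual ℂ E) {a b : ι} (hab : a ≠ b) (c : ℂ) :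
    detForm (Function.update ξ a (c • ξ b)) = 0 := by
  rw [detForm_update_smul]
  ext u
  rw [smul_apply, detForm_apply, Matrix.det_zero_of_column_eq hab fun i ↦ ?_]
  · simp
  · simp [hab.symm]

end MultilinearForms

/-! ### Representations with prescribed highest weight -/

section HighestWeight

attribute [local instance] LieRing.ofAssociativeRing

variable {L : Type u} [LieRing L] [LieAlgebra ℂ L] [FiniteDimensional ℂ L]
  [LieAlgebra.IsSemisimple ℂ L] {H : LieSubalgebra ℂ L} [H.IsCartanSubalgebra]
  {V : Type*} [AddCommGroup V] [Module ℂ V]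

theorem rootSpace_induction {P : L → Prop} (hH : ∀ x ∈ H, P x)
    (hroot : ∀ α : Weight ℂ H L, α.IsNonZero → ∀ e ∈ rootSpace H α, P e)
    (hadd : ∀ X Y, P X → P Y → P (X + Y)) (X : L) : P X := by
  have hX : X ∈ ⨆ α : Weight ℂ H L, rootSpace H α := by
    rw [iSup_genWeightSpace_eq_top' ℂ H L]; exact LieSubmodule.mem_top X
  induction hX using LieSubmodule.iSup_induction' with
  | zero => exact hH 0 H.zero_mem
  | mem α e he =>
    by_cases hα : α.IsZero
    · rw [hα.eq] at he
      exact hH e ((rootSpace_zero_eq ℂ L H).le he)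
    · exact hroot α hα e he
  | add X Y _ _ hX hY => exact hadd X Y hX hY

/-- The vectors obtained from `v` of weight `wt` by applying root vectors that are negative on `p`,
together with their weights. -/
inductive LoweredVector (ρ : L →ₗ⁅ℂ⁆ End ℂ V) (p : H) (wt : H → ℂ) (v : V) : (H → ℂ) → V → Prop
  | base : LoweredVector ρ p wt v wt v
  | step {μ : H → ℂ} {m : V} (β : Weight ℂ H L) (f : L) : LoweredVector ρ p wt v μ m →
      (β p).re < 0 → f ∈ rootSpace H β → LoweredVector ρ p wt v (μ + β) (ρ f m)

namespace LoweredVector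

variable {ρ : L →ₗ⁅ℂ⁆ End ℂ V} {p : H} {wt μ : H → ℂ} {v m : V}

theorem apply_eq_smul (hv : ∀ x : H, ρ x v = wt x • v) (h : LoweredVector ρ p wt v μ m) (x : H) :
    ρ x m = μ x • m := by
  induction h with
  | base => exact hv x
  | @step μ m β f _ _ hf ih =>
    rw [LieHom.apply_apply_eq, ih, map_smul]
    have : ⁅(x : L), f⁆ = β x • f := IsKilling.lie_eq_smul_of_mem_rootSpace hf x
    rw [this, map_smul, LinearMap.smul_apply, Pi.add_apply, add_smul]

theorem re_le (h : LoweredVector ρ p wt v μ m) {x : H}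
    (hx : ∀ α : Weight ℂ H L, 0 < (α p).re → 0 ≤ (α x).re) : (μ x).re ≤ (wt x).re := by
  induction h with
  | base => exact le_rfl
  | @step μ m β f _ hβ _ ih =>
    have h1 := hx (-β) (by simpa using hβ)
    rw [Weight.coe_neg, Pi.neg_apply, Complex.neg_re] at h1
    rw [Pi.add_apply, Complex.add_re]
    linarith

end LoweredVector

/-- The submodule generated by a highest weight vector. -/
theorem exists_stable_submodule_of_highestWeight (ρ : L →ₗ⁅ℂ⁆ End ℂ V) {p : H}
    (hp : ∀ α : Weight ℂ H L, α.IsNonZero → (α p).re ≠ 0) {wt : H → ℂ} {v : V}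
    (hv : ∀ x : H, ρ x v = wt x • v)
    (hpos : ∀ α : Weight ℂ H L, 0 < (α p).re → ∀ e ∈ rootSpace H α, ρ e v = 0) :
    ∃ N : Submodule ℂ V, v ∈ N ∧ (∀ X, ∀ m ∈ N, ρ X m ∈ N) ∧
      ∀ x : H, (∀ α : Weight ℂ H L, 0 < (α p).re → 0 ≤ (α x).re) → ∀ m ∈ N, m ≠ 0 →
        ∀ μ : ℂ, ρ x m = μ • m → μ.re ≤ (wt x).re := by
  let N := Submodule.span ℂ {m | ∃ μ, LoweredVector ρ p wt v μ m}
  have hmem {μ : H → ℂ} {m : V} (h : LoweredVector ρ p wt v μ m) : m ∈ N :=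
    Submodule.subset_span ⟨μ, h⟩
  have hneg (β : Weight ℂ H L) (hβ : (β p).re < 0) (f : L) (hf : f ∈ rootSpace H β) :
      ∀ m ∈ N, ρ f m ∈ N := by
    intro m hm
    induction hm using Submodule.span_induction with
    | mem m hm =>
      obtain ⟨μ, hm⟩ := hm
      exact hmem (hm.step β f hβ hf)
    | zero => rw [map_zero]; exact N.zero_mem
    | add m m' _ _ h h' => rw [map_add]; exact N.add_mem h h'
    | smul c m _ h => rw [map_smul]; exact N.smul_mem c h
  have hlow {μ : H → ℂ} {m : V} (h : LoweredVector ρ p wt v μ m) : ∀ X, ρ X m ∈ N := by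
    induction h with
    | base =>
      refine rootSpace_induction (H := H) (fun x hx ↦ ?_) (fun α hα e he ↦ ?_) fun X Y hX hY ↦ ?_
      · rw [hv ⟨x, hx⟩]
        exact N.smul_mem _ (hmem .base)
      · obtain h | h := lt_or_gt_of_ne (hp α hα)
        · exact hneg α h e he _ (hmem .base)
        · rw [hpos α h e he]; exact N.zero_mem
      · rw [map_add, LinearMap.add_apply]; exact N.add_mem hX hY
    | @step μ m β f _ hβ hf ih =>
      intro X
      rw [LieHom.apply_apply_eq]
      exact N.add_mem (hneg β hβ f hf _ (ih X)) (ih _)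
  refine ⟨N, hmem .base, fun X m hm ↦ ?_, fun x hx m hm hm0 μ hμ ↦ ?_⟩
  · induction hm using Submodule.span_induction with
    | mem m hm =>
      obtain ⟨μ, hm⟩ := hm
      exact hlow hm X
    | zero => rw [map_zero]; exact N.zero_mem
    | add m m' _ _ h h' => rw [map_add]; exact N.add_mem h h'
    | smul c m _ h => rw [map_smul]; exact N.smul_mem c h
  · by_contra! hlt
    -- `N` is spanned by eigenvectors of `ρ x` whose eigenvalues have real part at most that of `wt
    -- x`, so `μ` would not occur.
    have hle : N ≤ ⨆ k, ⨆ (_ : k ≠ μ), (ρ x).eigenspace k := by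
      refine Submodule.span_le.mpr ?_
      rintro m ⟨ν, hm⟩
      have h1 := hm.re_le hx
      exact Submodule.mem_iSup_of_mem (ν x) (Submodule.mem_iSup_of_mem
        (fun h ↦ absurd (h ▸ h1) (not_le.mpr hlt))
        (End.mem_eigenspace_iff.mpr (hm.apply_eq_smul hv x)))
    exact hm0 (Submodule.disjoint_def.mp ((ρ x).eigenspaces_iSupIndep μ) m
      (End.mem_eigenspace_iff.mpr hμ) (hle hm))

/-- Write α(z) as the difference of its positive and negative parts. The symmetry α ↦ -α shows that
both parts contribute equally to κ(z, x) = ∑ α(z)α(x). -/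
theorem sum_root_toNat_eq {z : H} {n : Weight ℂ H L → ℤ} (hn : ∀ α : Weight ℂ H L, α z = n α)
    (x : H) : ∑ α ∈ H.root, ((n α).toNat : ℂ) * α x = killingForm ℂ L z x / 2 := by
  have h1 : ∑ α ∈ H.root, ((n (-α)).toNat : ℂ) * α x =
      -∑ α ∈ H.root, ((n α).toNat : ℂ) * α x := by
    rw [← Finset.sum_neg_distrib]
    refine Finset.sum_equiv (Equiv.neg _) (fun α ↦ ?_) fun α _ ↦ ?_
    · simp
    · simp
  have h2 : ∑ α ∈ H.root, α z * α x = ∑ α ∈ H.root, ((n α).toNat : ℂ) * α x -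
      ∑ α ∈ H.root, ((n (-α)).toNat : ℂ) * α x := by
    rw [← Finset.sum_sub_distrib]
    refine Finset.sum_congr rfl fun α _ ↦ ?_
    have h3 : n (-α) = -n α := by
      have := hn (-α)
      rw [Weight.coe_neg, Pi.neg_apply, hn] at this
      exact_mod_cast this.symm
    have h4 : ((n α : ℤ) : ℂ) = (n α).toNat - (-n α).toNat := by
      have := Int.toNat_sub_toNat_neg (n α)
      exact_mod_cast this.symm
    rw [hn, h3, h4, sub_mul]
  rw [killingForm_eq_sum_root, h2, h1]
  ring

/-- The functional `u ↦ κ(e, u c)` on tuples. -/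
noncomputable def killingCoord (m : ℕ) (c : Fin m) : L →ₗ[ℂ] Dual ℂ (Fin m → L) :=
  (LinearMap.lcomp ℂ ℂ (LinearMap.proj c)) ∘ₗ killingForm ℂ L

theorem killingCoord_apply {m : ℕ} (c : Fin m) (e : L) (u : Fin m → L) :
    killingCoord m c e u = killingForm ℂ L e (u c) := rfl

/-- The diagonal adjoint representation on tuples. -/
def tupleRep (L : Type*) [LieRing L] [LieAlgebra ℂ L] (m : ℕ) :
    L →ₗ⁅ℂ⁆ End ℂ (Fin m → L) where
  toFun X := (ad ℂ L X).compLeft (Fin m)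
  map_add' X Y := by ext; simp
  map_smul' c X := by ext; simp
  map_lie' {X Y} := by
    refine LinearMap.ext fun u ↦ funext fun c ↦ ?_
    rw [LieRing.of_associative_ring_bracket]
    simp

theorem neg_killingCoord_comp_tupleRep {m : ℕ} (c : Fin m) (e X : L) :
    -(killingCoord m c e ∘ₗ tupleRep L m X) = killingCoord m c ⁅X, e⁆ := by
  refine LinearMap.ext fun u ↦ ?_
  change -killingForm ℂ L e ⁅X, u c⁆ = killingForm ℂ L ⁅X, e⁆ (u c)
  rw [← LieModule.traceForm_apply_lie_apply, ← lie_skew, map_neg]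
  exact neg_neg _

/-- For a dominant integral element `z`, the functional `κ(z, ·) / 2` is the highest weight of a
vector in some representation, in the space of multilinear forms on tuples. -/
theorem exists_highestWeight_vector {p : H}
    {z : H} (hz : IsIntegralElement z)
    (hpz : ∀ α : Weight ℂ H L, 0 < (α p).re → 0 ≤ (α z).re) :
    ∃ (V : Type u) (_ : AddCommGroup V) (_ : Module ℂ V) (_ : FiniteDimensional ℂ V)
      (ρ : L →ₗ⁅ℂ⁆ End ℂ V) (v : V), v ≠ 0 ∧
      (∀ x : H, ρ x v = (killingForm ℂ L z x / 2) • v) ∧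
      ∀ α : Weight ℂ H L, 0 < (α p).re → ∀ e ∈ rootSpace H α, ρ e v = 0 := by
  classical
  choose n hn using hz
  have key (α : H.root) : ∃ h e f : L, IsSl2Triple h e f ∧ e ∈ rootSpace H α.1 ∧
      f ∈ rootSpace H (-α.1 : H → ℂ) :=
    IsKilling.exists_isSl2Triple_of_weight_isNonZero ((Finset.mem_filter_univ _).mp α.2)
  choose h e f hsl he hf using key
  obtain ⟨m, hm⟩ : ∃ m : ℕ, ∀ α : H.root, (n α).toNat ≤ m :=
    ⟨∑ α : H.root, (n α).toNat, fun α ↦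
      Finset.single_le_sum (f := fun α : H.root ↦ (n α).toNat) (fun _ _ ↦ Nat.zero_le _)
        (Finset.mem_univ α)⟩
  -- Each root with α(z) > 0 contributes α(z) copies of its root vector, in distinct columns of a
  -- tuple of length `m`. The highest weight vector is the exterior product of all of them, seen as
  -- functionals through the Killing form; its weight is ∑ max(α(z), 0) α.
  let ι := Σ α : H.root, Fin (n α).toNat
  let col (a : ι) : Fin m := a.2.castLE (hm a.1)
  let ξ (a : ι) : Dual ℂ (Fin m → L) := killingCoord m (col a) (e a.1)
  have hrep (X : L) : formRep (tupleRep L m) X (detForm ξ) =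
      ∑ a, detForm (Function.update ξ a (killingCoord m (col a) ⁅X, e a.1⁆)) := by
    rw [formRep_detForm]
    exact Finset.sum_congr rfl fun a _ ↦ by rw [neg_killingCoord_comp_tupleRep]
  refine ⟨MultilinearMap ℂ (fun _ : ι ↦ Fin m → L) ℂ, inferInstance, inferInstance, inferInstance,
    formRep (tupleRep L m), detForm ξ, fun h0 ↦ ?_, fun x ↦ ?_, fun β hβ X hX ↦ ?_⟩
  · have h1 := congrArg (fun F ↦ F fun b : ι ↦ Pi.single (col b) (f b.1)) h0
    simp only [detForm_apply, zero_apply] at h1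
    have h2 : (Matrix.of fun b a : ι ↦ ξ a (Pi.single (col b) (f b.1))) =
        Matrix.diagonal fun a : ι ↦ killingForm ℂ L (e a.1) (f a.1) := by
      ext b a
      rw [Matrix.of_apply, killingCoord_apply]
      by_cases hab : b = a
      · subst hab; simp
      rw [Matrix.diagonal_apply_ne _ hab]
      by_cases hc : col a = col b
      · rw [hc, Pi.single_eq_same]
        refine killingForm_apply_eq_zero_of_mem_rootSpace_of_add_ne_zero ℂ L H (he a.1) (hf b.1)
          fun h3 ↦ hab ?_
        have h4 : a.1 = b.1 := Subtype.ext (DFunLike.coe_injective (add_neg_eq_zero.mp h3))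
        obtain ⟨α, i⟩ := a
        obtain ⟨β, j⟩ := b
        obtain rfl : α = β := h4
        have : (i : ℕ) = j := congrArg (fun k : Fin m ↦ (k : ℕ)) hc
        rw [Fin.ext this]
      · rw [Pi.single_eq_of_ne hc, map_zero]
    rw [h2, Matrix.det_diagonal] at h1
    obtain ⟨a, -, ha⟩ := Finset.prod_eq_zero_iff.mp h1
    have hH : h a.1 ∈ H := by
      have h5 := lie_mem_genWeightSpace_of_mem_genWeightSpace (he a.1) (hf a.1)
      rw [add_neg_cancel, (hsl a.1).lie_e_f] at h5
      exact (rootSpace_zero_eq ℂ L H).le h5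
    refine (hsl a.1).killingForm_self_ne_zero H hH ?_
    rw [(hsl a.1).killingForm_self, ha, mul_zero]
  · rw [hrep]
    have h1 (a : ι) : detForm (Function.update ξ a (killingCoord m (col a) ⁅(x : L), e a.1⁆)) =
        a.1.1 x • detForm ξ := by
      have : ⁅(x : L), e a.1⁆ = a.1.1 x • e a.1 := IsKilling.lie_eq_smul_of_mem_rootSpace (he a.1) x
      rw [this, map_smul, detForm_update_smul_self]
    rw [Finset.sum_congr rfl fun a _ ↦ h1 a, ← Finset.sum_smul, Fintype.sum_sigma,
      ← sum_root_toNat_eq hn x, ← Finset.sum_coe_sort H.root]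
    simp
  · rw [hrep]
    refine Finset.sum_eq_zero fun a _ ↦ ?_
    have h1 := lie_mem_genWeightSpace_of_mem_genWeightSpace hX (he a.1)
    by_cases h0 : ⁅X, e a.1⁆ = 0
    · have := detForm_update_smul ξ a 0 0
      rw [h0, map_zero]
      simpa using this
    have hw : genWeightSpace L (β + a.1.1 : H → ℂ) ≠ ⊥ := fun h2 ↦
      h0 (by rw [h2] at h1; exact h1)
    -- Since β(z) ≥ 0, the root `γ` has γ(z) ≥ α(z) for the root α of `a`, so its root vector
    -- already appears in the same column. Replacing the factor `a` by a multiple of it makes two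
    -- factors proportional.
    let γ : Weight ℂ H L := ⟨β + a.1.1, hw⟩
    have hnγ : n γ = n β + n a.1 := by
      have h3 : γ z = β z + a.1.1 z := rfl
      rw [hn, hn, hn] at h3
      exact_mod_cast h3
    have hβ0 : 0 ≤ n β := by
      have h3 := hpz β hβ
      rw [hn] at h3
      exact_mod_cast h3
    have ha0 : 0 < n a.1 := by
      have := a.2.2
      omega
    have hγ : γ.IsNonZero := fun h3 ↦ by
      have h4 := hn γ
      rw [h3, Pi.zero_apply] at h4
      have h5 : n γ = 0 := by exact_mod_cast h4.symm
      omega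
    let γ' : H.root := ⟨γ, (Finset.mem_filter_univ _).mpr hγ⟩
    let c : ι := ⟨γ', a.2.castLE (by show (n a.1).toNat ≤ (n γ).toNat; omega)⟩
    have hac : a ≠ c := fun h3 ↦ by
      have h4 : a.1.1 = γ := congrArg (fun i : ι ↦ i.1.1) h3
      have h5 : a.1.1 p = β p + a.1.1 p := congrFun (congrArg DFunLike.coe h4) p
      have h6 : β p = 0 := by simpa using h5
      rw [h6] at hβ
      exact absurd hβ (by simp)
    obtain ⟨t, ht⟩ : ∃ t : ℂ, t • e γ' = ⁅X, e a.1⁆ := by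
      have h3 := IsKilling.finrank_rootSpace_eq_one γ hγ
      rw [finrank_eq_one_iff_of_nonzero' (⟨e γ', he γ'⟩ : rootSpace H γ)
        fun h4 ↦ (hsl γ').e_ne_zero (congrArg Subtype.val h4)] at h3
      obtain ⟨t, ht⟩ := h3 ⟨⁅X, e a.1⁆, h1⟩
      exact ⟨t, congrArg Subtype.val ht⟩
    rw [← ht, map_smul]
    exact detForm_update_smul_of_ne ξ hac t

/-- The ambient space of forms may have larger weights; restricting to the submodule generated by
the highest weight vector gives the upper bound on eigenvalues. -/
theorem exists_highestWeight_representation {p : H}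
    (hp : ∀ α : Weight ℂ H L, α.IsNonZero → (α p).re ≠ 0) {z : H} (hz : IsIntegralElement z)
    (hpz : ∀ α : Weight ℂ H L, 0 < (α p).re → 0 ≤ (α z).re) :
    ∃ (V : Type u) (_ : AddCommGroup V) (_ : Module ℂ V) (_ : FiniteDimensional ℂ V)
      (ρ : L →ₗ⁅ℂ⁆ End ℂ V),
      (∃ v ≠ 0, ∀ x : H, ρ x v = (killingForm ℂ L z x / 2) • v) ∧
      ∀ x : H, (∀ α : Weight ℂ H L, 0 < (α p).re → 0 ≤ (α x).re) → ∀ v ≠ 0, ∀ μ : ℂ,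
        ρ x v = μ • v → μ.re ≤ (killingForm ℂ L z x / 2).re := by
  obtain ⟨V, _, _, _, ρ, v, hv0, hv, hpos⟩ := exists_highestWeight_vector hz hpz
  obtain ⟨N, hvN, hN, hbound⟩ := exists_stable_submodule_of_highestWeight
    (wt := fun x ↦ killingForm ℂ L z x / 2) ρ hp hv hpos
  let ρN : L →ₗ⁅ℂ⁆ End ℂ N :=
    { toFun X := (ρ X).restrict (hN X)
      map_add' X Y := by ext; simp
      map_smul' c X := by ext; simp
      map_lie' {X Y} := by
        ext u
        rw [LieRing.of_associative_ring_bracket]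
        simp [LieRing.of_associative_ring_bracket] }
  refine ⟨N, inferInstance, inferInstance, inferInstance, ρN,
    ⟨⟨v, hvN⟩, fun h ↦ hv0 (congrArg Subtype.val h), fun x ↦ Subtype.ext (hv x)⟩,
    fun x hx v hv μ h ↦ hbound x hx v v.2 (fun h ↦ hv (Subtype.ext h)) μ (congrArg Subtype.val h)⟩

end HighestWeight

/-! ### Transport and reindexing of bases -/

section BasisTransport

variable {L L' : Type*} [LieRing L] [LieAlgebra ℂ L] [LieRing L'] [LieAlgebra ℂ L']
  {H : LieSubalgebra ℂ L} {ι κ : Type*} [Finite ι] [Finite κ]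

theorem LieAlgebra.Basis.exists_map (b : LieAlgebra.Basis ι H) (φ : L ≃ₗ⁅ℂ⁆ L')
    {H' : LieSubalgebra ℂ L'} (hH : H.map (φ : L →ₗ⁅ℂ⁆ L') = H') :
    ∃ c : LieAlgebra.Basis ι H', (∀ i, c.h i = φ (b.h i)) ∧ ∀ i, c.e i = φ (b.e i) := by
  refine ⟨⟨b.A, fun i ↦ φ (b.h i), fun i ↦ φ (b.e i), fun i ↦ φ (b.f i), ?_, ?_,
    b.linInd.map' φ.toLinearEquiv.toLinearMap φ.toLinearEquiv.ker, b.nondegen, fun i ↦ ⟨?_, ?_, ?_, ?_⟩,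
    fun i j ↦ ?_, fun i j ↦ ?_, fun i j ↦ ?_, fun i j hij ↦ ?_⟩, fun i ↦ rfl, fun i ↦ rfl⟩
  · have h1 := congrArg (LieSubalgebra.map (φ : L →ₗ⁅ℂ⁆ L')) b.cartan_eq_lieSpan
    rw [← hH, h1, LieSubalgebra.map_lieSpan, ← Set.range_comp]
    rfl
  · have h1 := congrArg (LieSubalgebra.map (φ : L →ₗ⁅ℂ⁆ L')) b.span_ef
    rw [LieSubalgebra.map_lieSpan, Set.image_union, ← Set.range_comp, ← Set.range_comp] at h1
    refine h1.trans (eq_top_iff.mpr fun y _ ↦ ?_)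
    exact ⟨φ.symm y, LieSubalgebra.mem_top _, φ.apply_symm_apply y⟩
  · exact fun h ↦ (b.sl2 i).h_ne_zero (φ.injective (h.trans (map_zero φ).symm))
  · rw [← LieEquiv.map_lie, (b.sl2 i).lie_e_f]
  · rw [← LieEquiv.map_lie, (b.sl2 i).lie_h_e_nsmul, map_nsmul]
  · rw [← LieEquiv.map_lie, (b.sl2 i).lie_h_f_nsmul, map_neg, map_nsmul]
  · rw [← LieEquiv.map_lie, b.lie_h_h, map_zero]
  · rw [← LieEquiv.map_lie, b.lie_h_e, map_zsmul]
  · rw [← LieEquiv.map_lie, b.lie_h_f, map_zsmul]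
  · rw [← LieEquiv.map_lie, b.lie_e_f_ne i j hij, map_zero]

theorem LieAlgebra.Basis.exists_reindex [Fintype ι] [Fintype κ] (b : LieAlgebra.Basis ι H)
    (σ : κ ≃ ι) : ∃ c : LieAlgebra.Basis κ H, ∀ i, c.h i = b.h (σ i) := by
  classical
  refine ⟨⟨b.A.submatrix σ σ, b.h ∘ σ, b.e ∘ σ, b.f ∘ σ, ?_, ?_, b.linInd.comp σ σ.injective, ?_,
    fun i ↦ b.sl2 _, fun i j ↦ b.lie_h_h _ _, fun i j ↦ b.lie_h_e _ _, fun i j ↦ b.lie_h_f _ _,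
    fun i j hij ↦ b.lie_e_f_ne _ _ (σ.injective.ne hij)⟩, fun i ↦ rfl⟩
  · rw [σ.surjective.range_comp]; exact b.cartan_eq_lieSpan
  · rw [σ.surjective.range_comp, σ.surjective.range_comp]; exact b.span_ef
  · rw [Matrix.nondegenerate_iff_det_ne_zero, Matrix.det_submatrix_equiv_self]
    exact b.nondegen.det_ne_zero

end BasisTransport

/-! ### Uniqueness of the h-part up to inner automorphism and order -/

section BasisUniqueness

variable {L : Type u} [LieRing L] [LieAlgebra ℂ L] [FiniteDimensional ℂ L]
  [LieAlgebra.IsSemisimple ℂ L] {H H' : LieSubalgebra ℂ L} {ι : Type*} [Fintype ι]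

theorem LieAlgebra.Basis.exists_perm_of_base_support_eq (b c : LieAlgebra.Basis ι H)
    (h : b.base.support = c.base.support) : ∃ σ : Equiv.Perm ι, ∀ i, b.h i = c.h (σ i) := by
  have key (i : ι) : ∃ j, b.h i = c.h j := by
    have hi := h.le (b.baseSupportEquiv i).2
    obtain ⟨j, hj⟩ := c.baseSupportEquiv.surjective ⟨_, hi⟩
    have h1 := b.coroot_eq_h' i
    have h2 := c.coroot_eq_h' j
    rw [hj] at h2
    exact ⟨j, congrArg Subtype.val (h1.symm.trans h2)⟩
  choose f hf using key
  have hinj : Function.Injective f := fun i j hij ↦ b.linInd.injective (by rw [hf, hf, hij])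
  exact ⟨Equiv.ofBijective f (Finite.injective_iff_bijective.mp hinj), hf⟩

theorem LieAlgebra.Basis.apply_eq_one_of_mem_base_support (b : LieAlgebra.Basis ι H) {p : H}
    (hp : ∀ i, ⁅(p : L), b.e i⁆ = b.e i) {α} (hα : α ∈ b.base.support) : α.1 p = 1 := by
  obtain ⟨i, hi⟩ := b.baseSupportEquiv.surjective ⟨α, hα⟩
  have h1 := b.coe_baseSupportEquiv_apply i
  rw [hi] at h1
  have h2 := b.baseSupp_apply_smul_e i p
  rw [← h1] at h2
  have h3 : α.1 p • b.e i = (1 : ℂ) • b.e i := by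
    rw [one_smul, ← hp i]
    simpa [hp i] using h2
  exact smul_left_injective ℂ (b.sl2 i).e_ne_zero h3

/-- Such a `p` marks the base of `b` and is easy to follow through automorphisms, so bases are
compared via their marking elements. -/
theorem LieAlgebra.Basis.exists_lie_e_eq (b : LieAlgebra.Basis ι H) :
    ∃ p : H, ∀ i, ⁅(p : L), b.e i⁆ = b.e i := by
  have := b.isCartanSubalgebra
  obtain ⟨p, hp⟩ := b.base.exists_root_eq_one
  refine ⟨p, fun i ↦ ?_⟩
  have h1 := hp _ (b.baseSupportEquiv i).2
  have h2 : b.baseSupp i p = 1 := by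
    rw [← b.coe_baseSupportEquiv_apply]; exact h1
  have h3 := b.baseSupp_apply_smul_e i p
  rw [h2, one_smul] at h3
  exact h3.symm

/-- Up to order, the `h`-part of a basis is unique up to inner automorphisms. -/
theorem LieAlgebra.Basis.exists_isInner_perm (b : LieAlgebra.Basis ι H)
    (c : LieAlgebra.Basis ι H') :
    ∃ φ : L ≃ₗ[ℂ] L, IsInner φ ∧ ∃ σ : Equiv.Perm ι, ∀ i, φ (b.h i) = c.h (σ i) := by
  have := b.isCartanSubalgebra
  have := c.isCartanSubalgebra
  obtain ⟨φ, hφ, hφH⟩ := exists_isInner_map_isCartanSubalgebra H H'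
  let φ' : L ≃ₗ⁅ℂ⁆ L := { φ with map_lie' := hφ.map_lie _ _ }
  obtain ⟨b₁, hb₁, hb₁'⟩ := b.exists_map φ' (H' := H')
    (LieSubalgebra.toSubmodule_injective hφH)
  obtain ⟨q, hq⟩ := b₁.exists_lie_e_eq
  obtain ⟨p, hp⟩ := c.exists_lie_e_eq
  have hp' : ∀ α ∈ c.base.support, α.1 p = 1 := fun α ↦ c.apply_eq_one_of_mem_base_support hp
  have hq' : ∀ α ∈ b₁.base.support, α.1 q = 1 := fun α ↦ b₁.apply_eq_one_of_mem_base_support hq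
  -- Making `q` dominant for the base of `c` makes that base non-negative on `w q`; by
  -- `RootPairing.Base.support_subset` the two bases then agree.
  obtain ⟨w, hw, hdom⟩ := exists_mem_cartanWeylGroup_dominant
    (RootPairing.Base.isIntegralElement hp') (RootPairing.Base.isIntegralElement hq')
  obtain ⟨ψ, hψ, hψw⟩ := exists_isInner_of_mem_cartanWeylGroup H' hw
  let ψ' : L ≃ₗ⁅ℂ⁆ L := { ψ with map_lie' := hψ.map_lie _ _ }
  obtain ⟨b₂, hb₂, hb₂'⟩ := b₁.exists_map ψ' (H' := H') (by
    ext x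
    refine ⟨?_, fun hx ↦ ⟨w.symm ⟨x, hx⟩, (w.symm ⟨x, hx⟩).2, ?_⟩⟩
    · rintro ⟨y, hy, rfl⟩
      have := hψw ⟨y, hy⟩
      exact this ▸ (w ⟨y, hy⟩).2
    · have := hψw (w.symm ⟨x, hx⟩)
      rw [w.apply_symm_apply] at this
      exact this)
  have hwq : ∀ α ∈ b₂.base.support, α.1 (w q) = 1 := fun α ↦
    b₂.apply_eq_one_of_mem_base_support fun i ↦ by
      rw [hb₂', ← hψw]
      exact (ψ'.map_lie q (b₁.e i)).symm.trans (congrArg ψ' (hq i))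
  have hsub := RootPairing.Base.support_subset hwq (b := c.base) fun α hα ↦
    hdom α.1 (by rw [hp' α hα]; simp)
  have hcard : c.base.support.card ≤ b₂.base.support.card := by
    rw [← Fintype.card_coe, ← Fintype.card_coe, ← Fintype.card_congr c.baseSupportEquiv,
      ← Fintype.card_congr b₂.baseSupportEquiv]
  obtain ⟨σ, hσ⟩ := b₂.exists_perm_of_base_support_eq c (Finset.eq_of_subset_of_card_le hsub hcard)
  refine ⟨φ.trans ψ, hφ.trans hψ, σ, fun i ↦ ?_⟩
  rw [← hσ, hb₂, hb₁]
  rfl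

attribute [local instance] LieRing.ofAssociativeRing

/-- If a faithful representation maps two semisimple subalgebras to conjugate subalgebras, then, up
to order, it maps the `h`-parts of their Chevalley generators to conjugate families. -/
theorem exists_conj_h_eq {S₁ S₂ : LieSubalgebra ℂ L} [LieAlgebra.IsSemisimple ℂ S₁]
    [LieAlgebra.IsSemisimple ℂ S₂] {H₁ : LieSubalgebra ℂ S₁} {H₂ : LieSubalgebra ℂ S₂}
    (b₁ : LieAlgebra.Basis ι H₁) (b₂ : LieAlgebra.Basis ι H₂)
    {V : Type u} [AddCommGroup V] [Module ℂ V] [FiniteDimensional ℂ V] {ρ : L →ₗ⁅ℂ⁆ End ℂ V}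
    (hρ : Function.Injective ρ) {a : V ≃ₗ[ℂ] V}
    (ha : (S₁.map ρ).map (a.lieConj : End ℂ V →ₗ⁅ℂ⁆ End ℂ V) = S₂.map ρ) :
    ∃ (a' : V ≃ₗ[ℂ] V) (σ : Equiv.Perm ι), ∀ i, a'.conj (ρ (b₁.h i)) = ρ (b₂.h (σ i)) := by
  let f₁ : S₁ →ₗ⁅ℂ⁆ End ℂ V := (a.lieConj : End ℂ V →ₗ⁅ℂ⁆ End ℂ V).comp (ρ.comp S₁.incl)
  let f₂ : S₂ →ₗ⁅ℂ⁆ End ℂ V := ρ.comp S₂.incl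
  have hf₁ : Function.Injective f₁ := a.conj.injective.comp (hρ.comp Subtype.val_injective)
  have hf₂ : Function.Injective f₂ := hρ.comp Subtype.val_injective
  have hr : (f₁.range : Set (End ℂ V)) = f₂.range := by
    have h1 : f₁.range = (S₁.map ρ).map (a.lieConj : End ℂ V →ₗ⁅ℂ⁆ End ℂ V) := by
      ext z
      simp [f₁, LieSubalgebra.mem_map]
    have h2 : f₂.range = S₂.map ρ := by
      ext z
      simp [f₂, LieSubalgebra.mem_map]
    rw [h1, h2, ha]
  -- Conjugate faithful images yield an isomorphism of the subalgebras. It need not match the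
  -- generators, so the transported basis is compared with `b₂` inside `S₂`, where inner
  -- automorphisms are conjugations under the restriction of `ρ`.
  let φ : S₁ ≃ₗ⁅ℂ⁆ S₂ := (LieEquiv.ofInjective f₁ hf₁).trans
    ((LieEquiv.ofEq _ _ hr).trans (LieEquiv.ofInjective f₂ hf₂).symm)
  have hφ (x : S₁) : ρ (φ x) = a.conj (ρ x) := by
    have : (LieEquiv.ofInjective f₂ hf₂) (φ x) =
        (LieEquiv.ofEq _ _ hr) (LieEquiv.ofInjective f₁ hf₁ x) := by simp [φ]
    exact congrArg Subtype.val this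
  obtain ⟨c, hc, -⟩ := b₁.exists_map φ rfl
  obtain ⟨ψ, hψ, σ, hσ⟩ := c.exists_isInner_perm b₂
  obtain ⟨a', ha'⟩ := hψ V f₂
  refine ⟨a.trans a', σ, fun i ↦ ?_⟩
  have h1 : ρ (b₂.h (σ i)) = a'.conj (f₂ (c.h i)) := by rw [← ha', hσ]; rfl
  rw [h1, hc]
  exact congrArg a'.conj (hφ _).symm

end BasisUniqueness

/-- A functional not vanishing on `u i` turns the relation into a root of a nonzero polynomial in
`M`. -/
theorem finite_setOf_sum_pow_smul_eq_zero {E : Type*} [AddCommGroup E] [Module ℂ E] {r : ℕ}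
    {u : Fin r → E} {i : Fin r} (hi : u i ≠ 0) :
    {M : ℕ | ∑ j : Fin r, ((M ^ (j : ℕ) : ℕ) : ℤ) • u j = 0}.Finite := by
  obtain ⟨f, hf⟩ : ∃ f : Dual ℂ E, f (u i) ≠ 0 := by
    by_contra! h
    exact hi ((Module.forall_dual_apply_eq_zero_iff ℂ _).mp h)
  let P : Polynomial ℂ := ∑ j : Fin r, Polynomial.monomial (j : ℕ) (f (u j))
  have hP : P ≠ 0 := fun h0 ↦ hf <| by
    have h1 : P.coeff i = f (u i) := by
      rw [Polynomial.finsetSum_coeff, Finset.sum_eq_single i]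
      · simp
      · intro j _ hj
        rw [Polynomial.coeff_monomial, if_neg fun h ↦ hj (Fin.ext h)]
      · simp
    rw [← h1, h0, Polynomial.coeff_zero]
  refine (P.roots.toFinset.finite_toSet.preimage
    (f := fun M : ℕ ↦ (M : ℂ)) Nat.cast_injective.injOn).subset fun M hM ↦ ?_
  have h2 := congrArg f hM
  rw [map_sum, map_zero] at h2
  simp only [Set.mem_preimage, Finset.mem_coe, Multiset.mem_toFinset, Polynomial.mem_roots hP,
    Polynomial.IsRoot.def]
  rw [Polynomial.eval_finsetSum, ← h2]
  refine Finset.sum_congr rfl fun j _ ↦ ?_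
  rw [Polynomial.eval_monomial, map_zsmul, zsmul_eq_mul, mul_comm]
  push_cast
  rfl

/-! ### Separating Weyl group orbits by representations -/

section Separation

attribute [local instance] LieRing.ofAssociativeRing

variable {L : Type u} [LieRing L] [LieAlgebra ℂ L] [FiniteDimensional ℂ L]
  [LieAlgebra.IsSemisimple ℂ L] {H : LieSubalgebra ℂ L} [H.IsCartanSubalgebra]

theorem exists_weight_apply_eq {x : H} {v : L} (hv : v ≠ 0) {μ : ℂ} (h : ⁅(x : L), v⁆ = μ • v) :
    ∃ α : Weight ℂ H L, μ = α x := by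
  by_contra! hne
  have hle (X : L) : X ∈ ⨆ k, ⨆ (_ : k ≠ μ), (ad ℂ L (x : L)).eigenspace k := by
    have hmem (α : Weight ℂ H L) (e : L) (he : e ∈ rootSpace H α) :
        e ∈ ⨆ k, ⨆ (_ : k ≠ μ), (ad ℂ L (x : L)).eigenspace k :=
      Submodule.mem_iSup_of_mem (α x) (Submodule.mem_iSup_of_mem (hne α).symm
        (End.mem_eigenspace_iff.mpr (IsKilling.lie_eq_smul_of_mem_rootSpace he x)))
    have hX : X ∈ ⨆ α : Weight ℂ H L, rootSpace H α := by
      rw [iSup_genWeightSpace_eq_top' ℂ H L]; exact LieSubmodule.mem_top X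
    induction hX using LieSubmodule.iSup_induction' with
    | zero => exact zero_mem _
    | mem α e he => exact hmem α e he
    | add X Y _ _ hX hY => exact add_mem hX hY
  exact hv (Submodule.disjoint_def.mp ((ad ℂ L (x : L)).eigenspaces_iSupIndep μ) v
    (End.mem_eigenspace_iff.mpr h) (hle v))

/-- Both α and -α contribute `n ^ 2` to the sum of squares. This makes the adjoint eigenvalues too
small to interfere in the separation argument. -/
theorem two_mul_sq_le_killingForm {x : H} {a : ℕ} (hx : IsIntegralElement x)
    (hxa : killingForm ℂ L x x = a) {α : Weight ℂ H L} {n : ℕ} (hα : α x = n) : 2 * n ^ 2 ≤ a := by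
  classical
  obtain rfl | hn := Nat.eq_zero_or_pos n
  · simp
  choose c hc using hx
  have hαc : c α = n := by
    have := (hc α).symm.trans hα
    exact_mod_cast this
  have hαc' : c (-α) = -n := by
    have := hc (-α)
    rw [Weight.coe_neg, Pi.neg_apply, hα] at this
    exact_mod_cast this.symm
  have hα0 : α.IsNonZero := fun h ↦ by
    have h1 : α x = 0 := congrFun h x
    rw [hα] at h1
    exact hn.ne' (by exact_mod_cast h1)
  have hne : α ≠ -α := fun h ↦ by
    rw [← h, hαc] at hαc'
    omega
  have hsub : ({α, -α} : Finset (Weight ℂ H L)) ⊆ H.root := by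
    intro β hβ
    obtain rfl | rfl : β = α ∨ β = -α := by simpa using hβ
    · exact (Finset.mem_filter_univ _).mpr hα0
    · simpa using hα0
  have h1 : (∑ β ∈ H.root, c β * c β) = (a : ℤ) := by
    rw [killingForm_eq_sum_root] at hxa
    simp_rw [hc] at hxa
    exact_mod_cast hxa
  have h2 := Finset.sum_le_sum_of_subset_of_nonneg hsub (f := fun β ↦ c β * c β)
    fun β _ _ ↦ mul_self_nonneg _
  rw [Finset.sum_pair hne, h1, hαc, hαc'] at h2
  have : (2 * n ^ 2 : ℤ) ≤ a := by linarith
  exact_mod_cast this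

/-- The product of a representation with the adjoint representation. -/
def prodAd {V : Type*} [AddCommGroup V] [Module ℂ V] (ρ : L →ₗ⁅ℂ⁆ End ℂ V) :
    L →ₗ⁅ℂ⁆ End ℂ (V × L) where
  toFun X := (ρ X).prodMap (ad ℂ L X)
  map_add' X Y := by rw [map_add, map_add, LinearMap.prodMap_add]
  map_smul' c X := by rw [map_smul, map_smul, LinearMap.prodMap_smul]; rfl
  map_lie' {X Y} := by
    rw [LieHom.map_lie, LieHom.map_lie]
    simp only [LieRing.of_associative_ring_bracket]
    ext v <;> simp

theorem prodAd_apply {V : Type*} [AddCommGroup V] [Module ℂ V] (ρ : L →ₗ⁅ℂ⁆ End ℂ V) (X : L)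
    (v : V × L) : prodAd ρ X v = (ρ X v.1, ⁅X, v.2⁆) := rfl

theorem prodAd_injective {V : Type*} [AddCommGroup V] [Module ℂ V] (ρ : L →ₗ⁅ℂ⁆ End ℂ V) :
    Function.Injective (prodAd ρ) := by
  intro X Y h
  have hinj : Function.Injective (ad ℂ L) := by
    rw [← LieHom.ker_eq_bot, LieAlgebra.ad_ker_eq_self_module_ker]
    simp
  refine hinj (LinearMap.ext fun Z ↦ ?_)
  exact congrArg Prod.snd (LinearMap.congr_fun h (0, Z))

/-- A dominant integral element is determined, among the dominant integral elements that are not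
longer, by its conjugacy class in a suitable faithful representation. -/
theorem exists_injective_representation_eq_of_conj {p : H}
    (hp : ∀ α : Weight ℂ H L, α.IsNonZero → (α p).re ≠ 0) {x : H} (hx : IsIntegralElement x)
    (hpx : ∀ α : Weight ℂ H L, 0 < (α p).re → 0 ≤ (α x).re) :
    ∃ (V : Type u) (_ : AddCommGroup V) (_ : Module ℂ V) (_ : FiniteDimensional ℂ V)
      (ρ : L →ₗ⁅ℂ⁆ End ℂ V), Function.Injective ρ ∧ ∀ y : H, IsIntegralElement y →
        (∀ α : Weight ℂ H L, 0 < (α p).re → 0 ≤ (α y).re) →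
        (killingForm ℂ L y y).re ≤ (killingForm ℂ L x x).re →
        ∀ a : V ≃ₗ[ℂ] V, a.conj (ρ x) = ρ y → x = y := by
  obtain ⟨N, _, _, _, ρ, ⟨v, hv0, hv⟩, hbound⟩ :=
    -- Doubling `x` cancels the factor 1/2, so the highest weight is exactly κ(x, ·) and takes the
    -- value κ(x, x) at `x`.
    exists_highestWeight_representation hp (hx.add hx) fun α hα ↦ by
      rw [← Weight.toLinear_apply, map_add, Weight.toLinear_apply, Complex.add_re]
      linarith [hpx α hα]
  have hκ (y : H) : killingForm ℂ L (x + x : H) y / 2 = killingForm ℂ L x y := by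
    rw [H.coe_add, map_add, LinearMap.add_apply]
    ring
  simp_rw [hκ] at hv hbound
  refine ⟨N × L, inferInstance, inferInstance, inferInstance, prodAd ρ, prodAd_injective ρ,
    fun y hy hpy hle a ha ↦ ?_⟩
  obtain ⟨n, hn, hn0⟩ := hx.killingForm_self
  obtain ⟨m, hm, hm0⟩ := hy.killingForm_self
  have hmn : m ≤ n := by
    rw [hm, hn, Complex.natCast_re, Complex.natCast_re] at hle
    exact_mod_cast hle
  have hu0 : a (v, 0) ≠ 0 := fun h ↦ hv0 (congrArg Prod.fst ((map_eq_zero_iff a a.injective).mp h))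
  have hu : prodAd ρ y (a (v, 0)) = (n : ℂ) • a (v, 0) := by
    rw [← ha, LinearEquiv.conj_apply_apply, LinearEquiv.symm_apply_apply, prodAd_apply, hv, hn,
      lie_zero, ← map_smul, Prod.smul_mk, smul_zero]
  -- If the eigenvalue `n` of `y` comes from the adjoint part, then `2n² ≤ m ≤ n` forces both
  -- elements to vanish. Otherwise the highest weight bound gives `n ≤ κ(x, y)`, hence κ(x - y, x -
  -- y) ≤ m - n ≤ 0.
  by_cases h1 : (a (v, 0)).1 = 0
  · have h2 : (a (v, 0)).2 ≠ 0 := fun h2 ↦ hu0 (Prod.ext h1 h2)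
    obtain ⟨α, hα⟩ := exists_weight_apply_eq h2 (congrArg Prod.snd hu)
    have h3 := two_mul_sq_le_killingForm hy hm hα.symm
    have hn' : n = 0 := by nlinarith
    rw [hn0 hn', hm0 (by omega)]
  · have h2 := hbound y hpy _ h1 n (congrArg Prod.fst hu)
    obtain ⟨k, hk, hk0⟩ := (hx.sub hy).killingForm_self
    have h3 : killingForm ℂ L (x - y : H) (x - y : H) = n + m - 2 * killingForm ℂ L x y := by
      rw [H.coe_sub, map_sub, map_sub, LinearMap.sub_apply, LinearMap.sub_apply, hn, hm,
        LieModule.traceForm_comm ℂ L L (y : L) x]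
      ring
    rw [hk] at h3
    have h4 := congrArg Complex.re h3
    simp only [Complex.natCast_re, Complex.sub_re, Complex.add_re, Complex.mul_re, Complex.re_ofNat,
      Complex.im_ofNat, zero_mul, sub_zero] at h4 h2
    have h5 : (m : ℝ) ≤ n := by exact_mod_cast hmn
    have h6 : (k : ℝ) ≤ 0 := by linarith
    exact sub_eq_zero.mp (hk0 (by exact_mod_cast le_antisymm h6 k.cast_nonneg))

/-- If all faithful representations conjugate the families `v₁` and `v₂` up to order, then the
combinations of `v₁` with integral coefficients are conjugate under the Weyl group to combinations
of `v₂`, unless the latter are longer. -/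
theorem exists_cartanWeylGroup_apply_sum_eq {ι : Type*} [Fintype ι] {v₁ v₂ : ι → H}
    (h₁ : ∀ i, IsIntegralElement (v₁ i)) (h₂ : ∀ i, IsIntegralElement (v₂ i))
    (hconj : ∀ (V : Type u) [AddCommGroup V] [Module ℂ V] [FiniteDimensional ℂ V]
      (ρ : L →ₗ⁅ℂ⁆ End ℂ V), Function.Injective ρ → ∃ (a : V ≃ₗ[ℂ] V) (σ : Equiv.Perm ι),
        ∀ i, a.conj (ρ (v₁ i)) = ρ (v₂ (σ i))) (t : ι → ℤ) (τ : Equiv.Perm ι)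
    (hle : ∀ σ : Equiv.Perm ι,
      (killingForm ℂ L (∑ i, t i • v₂ (σ i) : H) (∑ i, t i • v₂ (σ i) : H)).re ≤
        (killingForm ℂ L (∑ i, t i • v₁ (τ i) : H) (∑ i, t i • v₁ (τ i) : H)).re) :
    ∃ w ∈ cartanWeylGroup H, ∃ σ : Equiv.Perm ι,
      w (∑ i, t i • v₁ (τ i)) = ∑ i, t i • v₂ (σ i) := by
  obtain ⟨b⟩ := (IsKilling.rootSystem H).nonempty_base
  obtain ⟨p, hp⟩ := b.exists_root_eq_one
  have hp' (α : Weight ℂ H L) (hα : α.IsNonZero) : (α p).re ≠ 0 :=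
    RootPairing.Base.re_apply_ne_zero hp ⟨α, (Finset.mem_filter_univ _).mpr hα⟩
  have hint := RootPairing.Base.isIntegralElement hp
  have hx : IsIntegralElement (∑ i, t i • v₁ (τ i)) := .sum _ _ fun i _ ↦ (h₁ _).zsmul _
  obtain ⟨w, hw, hdom⟩ := exists_mem_cartanWeylGroup_dominant hint hx
  obtain ⟨V, _, _, _, ρ, hρ, huniq⟩ := exists_injective_representation_eq_of_conj hp'
    (hx.cartanWeylGroup_apply hw) hdom
  obtain ⟨a, σ, haσ⟩ := hconj V ρ hρ
  have hy : IsIntegralElement (∑ i, t i • v₂ (τ.trans σ i)) := .sum _ _ fun i _ ↦ (h₂ _).zsmul _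
  obtain ⟨w', hw', hdom'⟩ := exists_mem_cartanWeylGroup_dominant hint hy
  obtain ⟨φ, hφ, hφw⟩ := exists_isInner_of_mem_cartanWeylGroup H hw
  obtain ⟨φ', hφ', hφw'⟩ := exists_isInner_of_mem_cartanWeylGroup H hw'
  obtain ⟨c, hc⟩ := hφ V ρ
  obtain ⟨c', hc'⟩ := hφ' V ρ
  have hsum (v : ι → H) : ρ (∑ i, t i • v i : H) = ∑ i, t i • ρ (v i) := by
    have : ((∑ i, t i • v i : H) : L) = ∑ i, t i • (v i : L) :=
      map_sum H.subtype _ _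
    rw [this, map_sum]
    exact Finset.sum_congr rfl fun i _ ↦ map_zsmul ρ _ _
  have ha : a.conj (ρ (∑ i, t i • v₁ (τ i) : H)) = ρ (∑ i, t i • v₂ (τ.trans σ i) : H) := by
    rw [hsum fun i ↦ v₁ (τ i), hsum fun i ↦ v₂ (τ.trans σ i), map_sum]
    refine Finset.sum_congr rfl fun i _ ↦ ?_
    rw [map_zsmul, haσ]
    rfl
  have key := huniq _ (hy.cartanWeylGroup_apply hw') hdom' (by
    rw [killingForm_cartanWeylGroup hw', killingForm_cartanWeylGroup hw]
    exact hle _) (c.symm.trans (a.trans c')) (by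
      rw [← hφw, ← hφw', hc, hc', ← ha]
      ext m
      simp [LinearEquiv.conj_apply_apply])
  refine ⟨w'⁻¹ * w, mul_mem (inv_mem hw') hw, τ.trans σ, ?_⟩
  rw [LinearEquiv.mul_apply, key]
  exact w'.symm_apply_apply _

/-- Finite families of integral elements that are conjugate up to order in all faithful
representations are conjugate under the Weyl group up to order. -/
theorem exists_cartanWeylGroup_perm {r : ℕ} {v₁ v₂ : Fin r → H}
    (h₁ : ∀ i, IsIntegralElement (v₁ i)) (h₂ : ∀ i, IsIntegralElement (v₂ i))
    (hconj : ∀ (V : Type u) [AddCommGroup V] [Module ℂ V] [FiniteDimensional ℂ V]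
      (ρ : L →ₗ⁅ℂ⁆ End ℂ V), Function.Injective ρ → ∃ (a : V ≃ₗ[ℂ] V) (σ : Equiv.Perm (Fin r)),
        ∀ i, a.conj (ρ (v₁ i)) = ρ (v₂ (σ i))) :
    ∃ w ∈ cartanWeylGroup H, ∃ σ : Equiv.Perm (Fin r), ∀ i, w (v₁ i) = v₂ (σ i) := by
  -- The finitely many `M` for which equality of the weighted sums might fail to imply equality of
  -- the families, for some `w` and orderings.
  have hbad : (⋃ w ∈ (cartanWeylGroup H : Set (H ≃ₗ[ℂ] H)), ⋃ (τ : Equiv.Perm (Fin r)),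
      ⋃ (σ : Equiv.Perm (Fin r)), ⋃ i, ⋃ (_ : w (v₁ (τ i)) - v₂ (σ i) ≠ 0),
        {M : ℕ | ∑ j : Fin r, ((M ^ (j : ℕ) : ℕ) : ℤ) • (w (v₁ (τ j)) - v₂ (σ j)) = 0}).Finite :=
    finite_cartanWeylGroup.biUnion fun w _ ↦ Set.finite_iUnion fun τ ↦ Set.finite_iUnion fun σ ↦
      Set.finite_iUnion fun i ↦ Set.finite_iUnion fun hi ↦ finite_setOf_sum_pow_smul_eq_zero
        (u := fun j ↦ w (v₁ (τ j)) - v₂ (σ j)) hi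
  obtain ⟨M, hM⟩ := hbad.exists_notMem
  let t (j : Fin r) : ℤ := ((M ^ (j : ℕ) : ℕ) : ℤ)
  suffices ∃ w ∈ cartanWeylGroup H, ∃ τ σ : Equiv.Perm (Fin r),
      w (∑ i, t i • v₁ (τ i)) = ∑ i, t i • v₂ (σ i) by
    obtain ⟨w, hw, τ, σ, h⟩ := this
    refine ⟨w, hw, τ.symm.trans σ, fun i ↦ ?_⟩
    by_contra hi
    simp only [Set.mem_iUnion, not_exists] at hM
    refine hM w hw τ σ (τ.symm i) (by simpa [sub_eq_zero] using hi) ?_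
    simp only [Set.mem_ofPred_eq]
    rw [map_sum] at h
    simp only [smul_sub, Finset.sum_sub_distrib]
    rw [sub_eq_zero, ← h]
    exact Finset.sum_congr rfl fun j _ ↦ (map_zsmul w _ _).symm
  let q (v : Fin r → H) (σ : Equiv.Perm (Fin r)) : ℝ :=
    (killingForm ℂ L (∑ i, t i • v (σ i) : H) (∑ i, t i • v (σ i) : H)).re
  obtain ⟨τ₁, hτ₁⟩ := Finite.exists_max (q v₁)
  obtain ⟨τ₂, hτ₂⟩ := Finite.exists_max (q v₂)
  -- The representation is chosen before its permutation is known, so the element defining it must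
  -- be at least as long as every reordering on the other side. The longer of the two maxima is
  -- used, and `w` is inverted when it comes from `v₂`.
  obtain h | h := le_total (q v₂ τ₂) (q v₁ τ₁)
  · obtain ⟨w, hw, σ, hσ⟩ := exists_cartanWeylGroup_apply_sum_eq h₁ h₂ hconj t τ₁
      fun σ ↦ (hτ₂ σ).trans h
    exact ⟨w, hw, τ₁, σ, hσ⟩
  · obtain ⟨w, hw, σ, hσ⟩ := exists_cartanWeylGroup_apply_sum_eq h₂ h₁ (fun V _ _ _ ρ hρ ↦ by
      obtain ⟨a, σ, ha⟩ := hconj V ρ hρ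
      refine ⟨a.symm, σ.symm, fun i ↦ ?_⟩
      have := ha (σ.symm i)
      rw [Equiv.apply_symm_apply] at this
      rw [← this]
      ext m
      simp) t τ₂ fun σ ↦ (hτ₁ σ).trans h
    refine ⟨w⁻¹, inv_mem hw, σ, τ₂, ?_⟩
    rw [← hσ]
    exact w.symm_apply_apply _

end Separation

end

/-! ### The main theorem -/

theorem corollary1 {𝔤 : Type u} [LieRing 𝔤] [LieAlgebra ℂ 𝔤] [FiniteDimensional ℂ 𝔤]
    [LieAlgebra.IsSemisimple ℂ 𝔤] (𝔥 : LieSubalgebra ℂ 𝔤) [𝔥.IsCartanSubalgebra]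
    {𝔤t : Type*} [LieRing 𝔤t] [LieAlgebra ℂ 𝔤t]
    (𝔤₁ 𝔤₂ : LieSubalgebra ℂ 𝔤)
    [LieAlgebra.IsSemisimple ℂ 𝔤₁] [LieAlgebra.IsSemisimple ℂ 𝔤₂]
    (iso₁ : Nonempty (𝔤₁ ≃ₗ⁅ℂ⁆ 𝔤t)) (iso₂ : Nonempty (𝔤₂ ≃ₗ⁅ℂ⁆ 𝔤t))
    {r : ℕ} (x₁ y₁ h₁ : Fin r → 𝔤₁) (x₂ y₂ h₂ : Fin r → 𝔤₂)
    (gen₁ : IsCanonicalGeneratingSet x₁ y₁ h₁) (gen₂ : IsCanonicalGeneratingSet x₂ y₂ h₂)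
    (mem₁ : ∀ i, (h₁ i : 𝔤) ∈ 𝔥) (mem₂ : ∀ i, (h₂ i : 𝔤) ∈ 𝔥) :
    LinearlyEquivalent 𝔤₁ 𝔤₂ ↔
      ∃ w ∈ cartanWeylGroup 𝔥,
        Set.range (fun i => w ⟨h₁ i, mem₁ i⟩) = Set.range (fun i => (⟨h₂ i, mem₂ i⟩ : 𝔥)) := by
  obtain ⟨H₁, b₁, rfl⟩ : ∃ (H : LieSubalgebra ℂ 𝔤₁) (b : LieAlgebra.Basis (Fin r) H), b.h = h₁ := by
    obtain ⟨b, -, -, hb⟩ := gen₁.exists_lieAlgebraBasis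
    exact ⟨_, b, hb⟩
  obtain ⟨H₂, b₂, rfl⟩ : ∃ (H : LieSubalgebra ℂ 𝔤₂) (b : LieAlgebra.Basis (Fin r) H), b.h = h₂ := by
    obtain ⟨b, -, -, hb⟩ := gen₂.exists_lieAlgebraBasis
    exact ⟨_, b, hb⟩
  constructor
  · intro hle
    obtain ⟨w, hw, σ, hσ⟩ := exists_cartanWeylGroup_perm (H := 𝔥)
      (v₁ := fun i ↦ ⟨b₁.h i, mem₁ i⟩) (v₂ := fun i ↦ ⟨b₂.h i, mem₂ i⟩)
      (fun i ↦ .of_isSl2Triple (b₁.sl2 i).coe (mem₁ i))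
      (fun i ↦ .of_isSl2Triple (b₂.sl2 i).coe (mem₂ i)) fun V _ _ _ ρ hρ ↦ by
        obtain ⟨a, ha⟩ := hle V ρ
        exact exists_conj_h_eq b₁ b₂ hρ ha
    refine ⟨w, hw, ?_⟩
    simp_rw [hσ]
    exact σ.surjective.range_comp fun i ↦ (⟨b₂.h i, mem₂ i⟩ : 𝔥)
  · rintro ⟨w, hw, hr⟩
    have key (i : Fin r) : ∃ j, (⟨b₂.h j, mem₂ j⟩ : 𝔥) = w ⟨b₁.h i, mem₁ i⟩ :=
      hr.le ⟨i, rfl⟩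
    choose f hf using key
    -- The `h i` are linearly independent, hence distinct, so equality of the two sets comes from a
    -- permutation of the indices.
    have hinj : Function.Injective f := fun i j hij ↦ by
      have h1 := (hf i).symm.trans ((congrArg (fun k ↦ (⟨b₂.h k, mem₂ k⟩ : 𝔥)) hij).trans (hf j))
      exact b₁.linInd.injective (Subtype.ext (congrArg (fun x : 𝔥 ↦ (x : 𝔤)) (w.injective h1)))
    obtain ⟨c, hc⟩ := b₂.exists_reindex
      (Equiv.ofBijective f (Finite.injective_iff_bijective.mp hinj))
    have hcm (i : Fin r) : (c.h i : 𝔤) ∈ 𝔥 := by rw [hc]; exact mem₂ _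
    refine linearlyEquivalent_of_mem_cartanWeylGroup 𝔥 b₁ c mem₁ hcm hw fun i ↦ ?_
    rw [← hf]
    exact Subtype.ext (congrArg (fun x : 𝔤₂ ↦ (x : 𝔤)) (hc i).symm)
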